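/- Let $L_0=\emptyset$, $L_{\alpha+1}=\mathrm{Def}(L_\alpha)$ (the set of subsets of $L_\alpha$ first-order definable over $(L_\alpha,\in)$ with parameters), and $L_\alpha=\bigcup_{\beta<\alpha}L_\beta$ for limit $\alpha$. For a limit ordinal $\lambda$, an ordinal $\alpha\in L_\lambda$ is called a cardinal in $L_\lambda$ if there are no $\xi<\alpha$ and $f\in L_\lambda$ such that $f$ is a surjection from $\xi$ onto $\alpha$; and $\mu\in L_\lambda$ is called a successor cardinal in $L_\lambda$ if it is a cardinal in $L_\lambda$ and there is a largest ordinal $\pi<\mu$ that is a cardinal in $L_\lambda$. Let $\mathsf{ZF}^-$ be Zermelo–Fraenkel set theory without the Power Set axiom (Extensionality, Foundation, Pairing, Union, Infinity, and the schemes of Separation, Replacement and Collection). **Proposition.** Let $\lambda$ be a limit ordinal and let $\mu\in L_\lambda$ be an ordinal such that $L_\lambda\models$ "$\mu>\omega$ and $\mu$ is a successor cardinal". Then $L_\mu\models\mathsf{ZF}^-$. -/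

import Mathlib

universe u

namespace ConstructibleLevels

/-! ### The language of set theory and its structures -/

/-- The only nonlogical symbol of the language of set theory: a binary relation symbol. -/
inductive MemSymbol : ℕ → Type
  | mem : MemSymbol 2

/-- The first-order language `{∈}` of set theory (equality is a logical symbol). -/
def setLang : FirstOrder.Language := ⟨fun _ => Empty, MemSymbol⟩

/-- Every type with a membership relation on itself is a structure for the language `{∈}`. -/
instance memStructure (M : Type*) [Membership M M] : setLang.Structure M where
  funMap := fun f => Empty.elim f
  RelMap := fun r => match r with
    | MemSymbol.mem => fun v => v 0 ∈ v 1

/-- The domain of the `{∈}`-structure `(x, ∈)` given by a set `x`. -/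
structure Carrier (x : ZFSet.{u}) : Type (u + 1) where
  val : ZFSet.{u}
  property : val ∈ x

/-- The membership relation of `(x, ∈)` is the true one. -/
instance (x : ZFSet.{u}) : Membership (Carrier x) (Carrier x) := ⟨fun b a => a.val ∈ b.val⟩

/-! ### The constructible hierarchy -/

/-- `Def x` is the set of all subsets of `x` that are first-order definable over `(x, ∈)` with
parameters from `x`. -/
noncomputable def Def (x : ZFSet.{u}) : ZFSet.{u} :=
  (ZFSet.powerset x).sep fun y =>
    (Set.univ : Set (Carrier x)).Definable₁ setLang {z : Carrier x | z.val ∈ y}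

/-- The levels of the constructible hierarchy: `L 0 = ∅`, `L (α + 1) = Def (L α)`, and
`L α = ⋃ β < α, L β` for `α` a limit. -/
noncomputable def L (α : Ordinal.{u}) : ZFSet.{u} :=
  Ordinal.limitRecOn α ∅ (fun _ x => Def x)
    (fun α _ ih => ZFSet.iUnion fun β : Set.Iio α => ih β.1 β.2)

/-! ### Set-theoretic notions, interpreted in a structure `(M, ∈)`

All quantifiers range over `M`, so `IsCard (M := M) a` says `M ⊨ "a is a cardinal"`, and so on. -/

section Notions

variable {M : Type*} [Membership M M]

/-- `M ⊨ z = {x, y}`. -/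
def IsUnorderedPair (z x y : M) : Prop := ∀ w : M, w ∈ z ↔ w = x ∨ w = y

/-- `M ⊨ p = (x, y)`, with Kuratowski's pair `{{x}, {x, y}}`. -/
def IsOrderedPair (p x y : M) : Prop :=
  ∃ s t : M, IsUnorderedPair s x x ∧ IsUnorderedPair t x y ∧ IsUnorderedPair p s t

/-- `M ⊨ "x is transitive"`. -/
def IsTrans (x : M) : Prop := ∀ y ∈ x, ∀ z ∈ y, z ∈ x

/-- `M ⊨ "x is an ordinal"`: a transitive set of transitive sets. -/
def IsOrd (x : M) : Prop := IsTrans x ∧ ∀ y ∈ x, IsTrans y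

/-- `M ⊨ "x is a (nonzero) limit ordinal"`. -/
def IsLimitOrd (x : M) : Prop := IsOrd x ∧ (∃ y, y ∈ x) ∧ ∀ y ∈ x, ∃ z ∈ x, y ∈ z

/-- `M ⊨ x = ω`: the least limit ordinal. -/
def IsOmega (x : M) : Prop := IsLimitOrd x ∧ ∀ y ∈ x, ¬ IsLimitOrd y

/-- `M ⊨ "f is a function from x onto y"`. -/
def IsSurjection (f x y : M) : Prop :=
  (∀ p ∈ f, ∃ a ∈ x, ∃ b ∈ y, IsOrderedPair p a b) ∧
  (∀ a ∈ x, ∃! b, ∃ p ∈ f, IsOrderedPair p a b) ∧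
  (∀ b ∈ y, ∃ a ∈ x, ∃ p ∈ f, IsOrderedPair p a b)

/-- `M ⊨ "a is a cardinal"`: `a` is an ordinal onto which no smaller ordinal can be mapped. -/
def IsCard (a : M) : Prop := IsOrd a ∧ ¬ ∃ b ∈ a, ∃ f : M, IsSurjection f b a

/-- `M ⊨ "a is a successor cardinal"`: `a` is a cardinal, and among the cardinals smaller than `a`
there is a largest one. -/
def IsSuccCard (a : M) : Prop :=
  IsCard a ∧ ∃ k ∈ a, IsCard k ∧ ∀ c ∈ a, IsCard c → c ∈ k ∨ c = k

/-- `M ⊨ a > ω`, for an ordinal `a` of `M`. -/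
def ExceedsOmega (a : M) : Prop := ∃ w : M, IsOmega w ∧ w ∈ a

end Notions

/-- `M ⊨ ZF⁻`, Zermelo–Fraenkel set theory without the power set axiom. The three schemes are
stated for arbitrary first-order formulas `φ` in the language `{∈}` with a tuple `p` of parameters
from `M`. (Collection and Replacement are both listed, as without power sets the former need not
follow from the other axioms.) -/
structure ModelsZFMinus (M : Type*) [Membership M M] : Prop where
  extensionality : ∀ a b : M, (∀ x, x ∈ a ↔ x ∈ b) → a = b
  foundation : ∀ a : M, (∃ x, x ∈ a) → ∃ x ∈ a, ∀ y ∈ a, y ∉ x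
  pairing : ∀ a b : M, ∃ c : M, ∀ x, x ∈ c ↔ x = a ∨ x = b
  union : ∀ a : M, ∃ u : M, ∀ x, x ∈ u ↔ ∃ y ∈ a, x ∈ y
  infinity : ∃ w : M, (∃ e ∈ w, ∀ x, x ∉ e) ∧ ∀ x ∈ w, ∃ s ∈ w, ∀ y, y ∈ s ↔ y ∈ x ∨ y = x
  separation : ∀ (n : ℕ) (φ : setLang.Formula (Fin n ⊕ Fin 1)) (p : Fin n → M) (a : M),
    ∃ b : M, ∀ x, x ∈ b ↔ x ∈ a ∧ φ.Realize (Sum.elim p ![x])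
  replacement : ∀ (n : ℕ) (φ : setLang.Formula (Fin n ⊕ Fin 2)) (p : Fin n → M) (a : M),
    (∀ x ∈ a, ∃! y, φ.Realize (Sum.elim p ![x, y])) →
      ∃ b : M, ∀ y, y ∈ b ↔ ∃ x ∈ a, φ.Realize (Sum.elim p ![x, y])
  collection : ∀ (n : ℕ) (φ : setLang.Formula (Fin n ⊕ Fin 2)) (p : Fin n → M) (a : M),
    (∀ x ∈ a, ∃ y, φ.Realize (Sum.elim p ![x, y])) →
      ∃ b : M, ∀ x ∈ a, ∃ y ∈ b, φ.Realize (Sum.elim p ![x, y])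

end ConstructibleLevels

/-! ### De Bruijn formulas and their satisfaction -/

section

open FirstOrder FirstOrder.Language

namespace ConstructibleLevels

/-! Let `k` be the largest cardinal of `L l` below `m`. Since `ω` is a cardinal of `L l`, `ω ≤ k`,
and induction shows that in `L l` every `n < m` is an image of `k`, while `m` is not
(`IsSuccCard.exists_onto`, `IsCard.not_onto`). Everything else follows from these two facts.

First, an element `G` of `L l` that is a subset of some `L n`, `n < m`, belongs to `L m`
(`mem_L_of_subset`). Take the least `c` with `G` definable over `L c` and suppose `m ≤ c`. The
definable hull of `L n` and the parameters of `G` in `L c` collapses to some `L d`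
(`Elementary.condensation`); `G` is definable over `L d`, so `d = c` by minimality, and `L c` is
itself the hull of `L n` and finitely many points. Such a hull is an image of `k` in `L l`
(`onto_hull`), hence so is `m ⊆ L c`, a contradiction.

Secondly, `L m` has elementary submodels `L d` with `d < m` containing any given finitely many
parameters (`exists_elementary_level`). The hull of `k + 1` and the parameters in `L m` is
transitive, because by the first fact every element of `L m` is covered in `L m` by a map from `k`;
so the hull is a level `L d`, and `d ≠ m` because the hull is an image of `k`. Separation,
Replacement and Collection in `L m` follow: instances are decided in `L d`, which is an element of
`L m` (`modelsZFMinus_of_reflection`).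

As `l` is an arbitrary limit, `L l` is a weak theory and each auxiliary object has to be located at
an explicit level. Counting a hull needs maps from `k` onto its finite subsets (`onto_finSubsets`),
via the colexicographic enumeration, and a satisfaction relation a few levels above the structure
(`satCode_iff`). Hulls are taken in `(L a, ∈, IsLevel)`: with the levels as a predicate,
condensation holds at every ordinal `a`, not only at limits. Witnesses in hulls come from minimising
ordinal parameters one at a time (`exists_mem_hull`), so no well-ordering of `L` is needed. -/

/-- `scons a v` is the assignment `a, v 0, v 1, …`. -/
def scons {M : Type*} (a : M) (v : ℕ → M) : ℕ → M
  | 0 => a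
  | n + 1 => v n

@[simp] lemma scons_zero {M : Type*} (a : M) (v : ℕ → M) : scons a v 0 = a := rfl

@[simp] lemma scons_succ {M : Type*} (a : M) (v : ℕ → M) (n : ℕ) : scons a v (n + 1) = v n := rfl

lemma scons_forall {M : Type*} {p : M → Prop} {a : M} {v : ℕ → M} (ha : p a) (hv : ∀ i, p (v i)) :
    ∀ i, p (scons a v i)
  | 0 => ha
  | n + 1 => hv n

lemma scons_comp {M N : Type*} (f : M → N) (a : M) (v : ℕ → M) :
    f ∘ scons a v = scons (f a) (f ∘ v) := by
  funext i; cases i <;> rfl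

/-- Formulas with de Bruijn indices in the language with membership and one unary predicate. -/
inductive Fm : Type
  | mem (i j : ℕ) : Fm
  | lev (i : ℕ) : Fm
  | nand (φ ψ : Fm) : Fm
  | ex (φ : Fm) : Fm

/-- Satisfaction in the structure `(x, ∈, U)`. -/
def Sat (x : ZFSet.{u}) (U : ZFSet.{u} → Prop) : Fm → (ℕ → ZFSet.{u}) → Prop
  | .mem i j, v => v i ∈ v j
  | .lev i, v => U (v i)
  | .nand φ ψ, v => ¬ (Sat x U φ v ∧ Sat x U ψ v)
  | .ex φ, v => ∃ a ∈ x, Sat x U φ (scons a v)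

/-- Lifting of a renaming under a quantifier. -/
def liftVar (f : ℕ → ℕ) : ℕ → ℕ
  | 0 => 0
  | n + 1 => f n + 1

/-- Renaming of the free variables. -/
def Fm.rename : (ℕ → ℕ) → Fm → Fm
  | f, .mem i j => .mem (f i) (f j)
  | f, .lev i => .lev (f i)
  | f, .nand φ ψ => .nand (φ.rename f) (ψ.rename f)
  | f, .ex φ => .ex (φ.rename (liftVar f))

lemma scons_liftVar {M : Type*} (a : M) (v : ℕ → M) (f : ℕ → ℕ) :
    (fun i => scons a v (liftVar f i)) = scons a (fun i => v (f i)) := by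
  funext i; cases i <;> rfl

lemma sat_rename (x : ZFSet.{u}) (U : ZFSet.{u} → Prop) (φ : Fm) (f : ℕ → ℕ) (v : ℕ → ZFSet.{u}) :
    Sat x U (φ.rename f) v ↔ Sat x U φ (fun i => v (f i)) := by
  induction φ generalizing f v with
  | mem i j => rfl
  | lev i => rfl
  | nand φ ψ h1 h2 => simp only [Fm.rename, Sat, h1, h2]
  | ex φ h => simp only [Fm.rename, Sat, h, scons_liftVar]

/-- Satisfaction depends on finitely many variables only. -/
lemma exists_sat_bound (φ : Fm) : ∃ N : ℕ, ∀ (x : ZFSet.{u}) (U : ZFSet.{u} → Prop)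
    (v w : ℕ → ZFSet.{u}), (∀ i < N, v i = w i) → (Sat x U φ v ↔ Sat x U φ w) := by
  induction φ with
  | mem i j =>
    refine ⟨max i j + 1, fun x U v w h => ?_⟩
    simp only [Sat, h i (by omega), h j (by omega)]
  | lev i =>
    refine ⟨i + 1, fun x U v w h => ?_⟩
    simp only [Sat, h i (by omega)]
  | nand φ ψ h1 h2 =>
    obtain ⟨N, hN⟩ := h1
    obtain ⟨K, hK⟩ := h2
    refine ⟨max N K, fun x U v w h => ?_⟩
    simp only [Sat, hN x U v w fun i hi => h i (by omega), hK x U v w fun i hi => h i (by omega)]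
  | ex φ h1 =>
    obtain ⟨N, hN⟩ := h1
    refine ⟨N, fun x U v w h => ?_⟩
    simp only [Sat]
    refine exists_congr fun a => and_congr_right fun _ => hN x U _ _ fun i hi => ?_
    cases i with
    | zero => rfl
    | succ n => exact h n (by omega)

lemma sat_congr_pred {x : ZFSet.{u}} {U V : ZFSet.{u} → Prop} (h : ∀ z ∈ x, U z ↔ V z) (φ : Fm)
    {v : ℕ → ZFSet.{u}} (hv : ∀ i, v i ∈ x) : Sat x U φ v ↔ Sat x V φ v := by
  induction φ generalizing v with
  | mem i j => rfl
  | lev i => exact h _ (hv i)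
  | nand φ ψ h1 h2 => simp only [Sat, h1 hv, h2 hv]
  | ex φ h1 =>
    simp only [Sat]
    exact exists_congr fun a => and_congr_right fun ha => h1 (scons_forall (p := (· ∈ x)) ha hv)

/-- The formula obtained by reading the unary predicate as empty. -/
def Fm.delev : Fm → Fm
  | .mem i j => .mem i j
  | .lev i => .mem i i
  | .nand φ ψ => .nand φ.delev ψ.delev
  | .ex φ => .ex φ.delev

lemma sat_delev (x : ZFSet.{u}) (U : ZFSet.{u} → Prop) (φ : Fm) (v : ℕ → ZFSet.{u}) :
    Sat x U φ.delev v ↔ Sat x (fun _ => False) φ v := by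
  induction φ generalizing v with
  | mem i j => rfl
  | lev i => simp [Fm.delev, Sat, ZFSet.mem_irrefl]
  | nand φ ψ h1 h2 => simp only [Fm.delev, Sat, h1, h2]
  | ex φ h => simp only [Fm.delev, Sat, h]

/-- Negation. -/
def Fm.neg (φ : Fm) : Fm := .nand φ φ

@[simp] lemma sat_neg {x : ZFSet.{u}} {U : ZFSet.{u} → Prop} {φ : Fm} {v : ℕ → ZFSet.{u}} :
    Sat x U φ.neg v ↔ ¬ Sat x U φ v := by simp [Fm.neg, Sat]

/-- Implication. -/
def Fm.imp (φ ψ : Fm) : Fm := .nand φ ψ.neg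

@[simp] lemma sat_imp {x : ZFSet.{u}} {U : ZFSet.{u} → Prop} {φ ψ : Fm} {v : ℕ → ZFSet.{u}} :
    Sat x U (φ.imp ψ) v ↔ (Sat x U φ v → Sat x U ψ v) := by simp [Fm.imp, Sat]

/-- Universal quantification. -/
def Fm.all (φ : Fm) : Fm := (Fm.ex φ.neg).neg

@[simp] lemma sat_all {x : ZFSet.{u}} {U : ZFSet.{u} → Prop} {φ : Fm} {v : ℕ → ZFSet.{u}} :
    Sat x U φ.all v ↔ ∀ a ∈ x, Sat x U φ (scons a v) := by simp [Fm.all, Sat]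

/-- Equality, valid in transitive structures. -/
def Fm.eq (i j : ℕ) : Fm :=
  Fm.all (Fm.nand ((Fm.mem 0 (i + 1)).imp (.mem 0 (j + 1)))
    ((Fm.mem 0 (j + 1)).imp (.mem 0 (i + 1)))).neg

/-- Transitivity puts all members of `v i` and `v j` in the range of the quantifier, so
extensionality applies. -/
lemma sat_eq {x : ZFSet.{u}} (hx : x.IsTransitive) {U : ZFSet.{u} → Prop} {i j : ℕ}
    {v : ℕ → ZFSet.{u}} (hi : v i ∈ x) (hj : v j ∈ x) : Sat x U (.eq i j) v ↔ v i = v j := by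
  simp only [Fm.eq, sat_all, sat_neg, Sat, sat_imp, scons_zero, scons_succ, not_not]
  constructor
  · intro h
    ext z
    exact ⟨fun hz => (h z (hx _ hi hz)).1 hz, fun hz => (h z (hx _ hj hz)).2 hz⟩
  · rintro h a -
    rw [h]
    exact ⟨id, id⟩

/-! ### Translation between `Fm` and first-order formulas -/

variable {x : ZFSet.{u}}

lemma Carrier.ext {a b : Carrier x} (h : a.val = b.val) : a = b := by
  cases a; cases b; cases h; rfl

lemma term_eq_var {α : Type*} (t : setLang.Term α) : ∃ a, t = Term.var a := by
  cases t with
  | var a => exact ⟨a, rfl⟩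
  | func f => exact f.elim

lemma exists_fm_of_boundedFormula (hx : x.IsTransitive) {α : Type*} {n : ℕ}
    (ψ : setLang.BoundedFormula α n) (e : α ⊕ Fin n → ℕ) :
    ∃ φ : Fm, ∀ v : ℕ → Carrier x, ψ.Realize (fun a => v (e (.inl a))) (fun i => v (e (.inr i))) ↔
      Sat x (fun _ => False) φ (fun i => (v i).val) := by
  induction ψ with
  | falsum =>
    refine ⟨.mem 0 0, fun v => ?_⟩
    simp [BoundedFormula.Realize, Sat, ZFSet.mem_irrefl]
  | @equal n t s =>
    obtain ⟨a, rfl⟩ := term_eq_var t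
    obtain ⟨b, rfl⟩ := term_eq_var s
    refine ⟨.eq (e a) (e b), fun v => ?_⟩
    rw [sat_eq hx (v _).property (v _).property]
    simp only [BoundedFormula.Realize, Term.realize_var]
    have key : ∀ c : α ⊕ Fin n, Sum.elim (fun a => v (e (.inl a))) (fun i => v (e (.inr i))) c
        = v (e c) := by rintro (c | c) <;> rfl
    rw [key, key]
    exact ⟨fun h => by rw [h], Carrier.ext⟩
  | @rel n l R ts =>
    cases R with
    | mem =>
    obtain ⟨a, ha⟩ := term_eq_var (ts 0)
    obtain ⟨b, hb⟩ := term_eq_var (ts 1)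
    refine ⟨.mem (e a) (e b), fun v => ?_⟩
    have key : ∀ c : α ⊕ Fin n, Sum.elim (fun a => v (e (.inl a))) (fun i => v (e (.inr i))) c
        = v (e c) := by rintro (c | c) <;> rfl
    change (Term.realize _ (ts 0) ∈ Term.realize _ (ts 1)) ↔ _
    rw [ha, hb, Term.realize_var, Term.realize_var, key, key]
    rfl
  | imp f g hf hg =>
    obtain ⟨φ, hφ⟩ := hf e
    obtain ⟨ψ, hψ⟩ := hg e
    refine ⟨φ.imp ψ, fun v => ?_⟩
    rw [sat_imp, ← hφ, ← hψ, BoundedFormula.realize_imp]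
  | @all n f hf =>
    -- Under the quantifier every old variable moves up by one, and the new bound variable, last in
    -- the `Fin` numbering, receives index 0.
    obtain ⟨φ, hφ⟩ := hf (Sum.elim (fun a => e (.inl a) + 1)
      (Fin.snoc (α := fun _ => ℕ) (fun i => e (.inr i) + 1) 0))
    refine ⟨φ.all, fun v => ?_⟩
    rw [sat_all, BoundedFormula.realize_all]
    have key : ∀ a : Carrier x, f.Realize (fun a => v (e (.inl a)))
        (Fin.snoc (fun i => v (e (.inr i))) a) ↔
        Sat x (fun _ => False) φ (scons a.val fun i => (v i).val) := by
      intro a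
      have := hφ (scons a v)
      rw [show (fun i => (scons a v i).val) = scons a.val fun i => (v i).val from
        scons_comp Carrier.val a v] at this
      rw [← this]
      refine iff_of_eq (congrArg₂ _ rfl ?_)
      funext i
      refine Fin.lastCases ?_ (fun i => ?_) i <;> simp
    exact ⟨fun h a ha => (key ⟨a, ha⟩).1 (h _), fun h a => (key a).2 (h _ a.property)⟩

lemma exists_formula_of_fm (φ : Fm) : ∃ ψ : setLang.Formula ℕ, ∀ v : ℕ → Carrier x,
    ψ.Realize v ↔ Sat x (fun _ => False) φ (fun i => (v i).val) := by
  induction φ with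
  | mem i j =>
    refine ⟨Relations.formula (n := 2) (L := setLang)
      (show setLang.Relations 2 from MemSymbol.mem) ![.var i, .var j], fun v => ?_⟩
    exact Formula.realize_rel
  | lev i => exact ⟨⊥, fun v => by simp [Sat, Formula.Realize]⟩
  | nand φ ψ h1 h2 =>
    obtain ⟨f, hf⟩ := h1
    obtain ⟨g, hg⟩ := h2
    refine ⟨∼(f ⊓ g), fun v => ?_⟩
    rw [Formula.realize_not, Formula.realize_inf, hf, hg]
    rfl
  | ex φ h =>
    obtain ⟨f, hf⟩ := h
    let g : ℕ → ℕ ⊕ Fin 1 := fun i => Nat.casesOn i (.inr 0) .inl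
    refine ⟨(BoundedFormula.relabel (n := 1) (k := 0) g f).ex, fun v => ?_⟩
    simp only [Formula.Realize, BoundedFormula.realize_ex, BoundedFormula.realize_relabel, Sat]
    have key : ∀ a : Carrier x, (f.Realize (scons a v)) ↔
        Sat x (fun _ => False) φ (scons a.val fun i => (v i).val) := by
      intro a
      rw [hf, show (fun i => (scons a v i).val) = scons a.val fun i => (v i).val from
        scons_comp Carrier.val a v]
    have key2 : ∀ a : Carrier x, BoundedFormula.Realize f
        (Sum.elim v ((Fin.snoc default a : Fin 1 → Carrier x) ∘ Fin.castAdd 0) ∘ g)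
        ((Fin.snoc default a : Fin 1 → Carrier x) ∘ Fin.natAdd 1) ↔ f.Realize (scons a v) := by
      intro a
      refine iff_of_eq (congrArg₂ _ ?_ (Subsingleton.elim _ _))
      funext i
      cases i with
      | zero => rfl
      | succ n => rfl
    constructor
    · rintro ⟨a, ha⟩
      exact ⟨a.val, a.property, (key a).1 ((key2 a).1 ha)⟩
    · rintro ⟨a, ha, h⟩
      exact ⟨⟨a, ha⟩, (key2 _).2 ((key ⟨a, ha⟩).2 h)⟩

lemma mem_Def {x y : ZFSet.{u}} : y ∈ Def x ↔
    y ⊆ x ∧ (Set.univ : Set (Carrier x)).Definable₁ setLang {z : Carrier x | z.val ∈ y} := by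
  rw [Def, ZFSet.mem_sep, ZFSet.mem_powerset]

lemma mem_Def_of_sat {y : ZFSet.{u}} (hy : y ⊆ x) (φ : Fm) (v : ℕ → ZFSet.{u}) (hv : ∀ i, v i ∈ x)
    (h : ∀ z ∈ x, z ∈ y ↔ Sat x (fun _ => False) φ (scons z v)) : y ∈ Def x := by
  refine mem_Def.2 ⟨hy, ?_⟩
  obtain ⟨ψ, hψ⟩ := exists_formula_of_fm (x := x) φ
  refine Set.definable_iff_exists_formula_sum.2
    ⟨ψ.relabel (fun i => Nat.casesOn i (.inr 0) fun n => .inl ⟨⟨v n, hv n⟩, Set.mem_univ _⟩), ?_⟩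
  ext z
  refine Iff.trans ?_ (Formula.realize_relabel.trans (hψ _)).symm
  refine (h _ (z 0).property).trans (iff_of_eq (congrArg _ ?_))
  funext i
  cases i <;> rfl

/-- The case `x = ∅` stands apart because there is then no assignment `ℕ → x`, although `∅` is
definable. -/
lemma mem_Def_iff (hx : x.IsTransitive) {y : ZFSet.{u}} : y ∈ Def x ↔ y ⊆ x ∧
    (x = ∅ ∨ ∃ (φ : Fm) (v : ℕ → ZFSet.{u}), (∀ i, v i ∈ x) ∧
      ∀ z ∈ x, z ∈ y ↔ Sat x (fun _ => False) φ (scons z v)) := by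
  constructor
  · intro h
    obtain ⟨hy, hd⟩ := mem_Def.1 h
    refine ⟨hy, ?_⟩
    rcases ZFSet.eq_empty_or_nonempty x with hx0 | ⟨x0, hx0⟩
    · exact .inl hx0
    refine .inr ?_
    obtain ⟨ψ, hψ⟩ := Set.definable_iff_exists_formula_sum.1 hd
    classical
    -- Every element of `x` is a possible parameter of `ψ`; only the finitely many that occur are
    -- numbered. Index 0 is kept for the element being tested, and `x0` fills the unused places.
    let F := ψ.freeVarFinset
    let ψ' := ψ.restrictFreeVar (fun a : F => a)
    let k : F ≃ Fin (Fintype.card F) := Fintype.equivFin F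
    let e : F ⊕ Fin 0 → ℕ := Sum.elim
      (fun a => Sum.elim (fun _ => (k a : ℕ) + 1) (fun _ => 0) a.1) (fun _ => 0)
    obtain ⟨φ, hφ⟩ := exists_fm_of_boundedFormula hx ψ' e
    let w : ℕ → Carrier x := fun i => if hi : i < Fintype.card F then
      Sum.elim (fun c => c.1) (fun _ => ⟨x0, hx0⟩) (k.symm ⟨i, hi⟩).1 else ⟨x0, hx0⟩
    refine ⟨φ, fun i => (w i).val, fun i => (w i).property, fun z hz => ?_⟩
    have h1 : z ∈ y ↔ ψ.Realize (Sum.elim (fun c => c.1) fun _ : Fin 1 => (⟨z, hz⟩ : Carrier x)) := by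
      have := Set.ext_iff.1 hψ (fun _ => ⟨z, hz⟩)
      exact this
    rw [h1, ← show (fun i => (scons ⟨z, hz⟩ w i).val) = scons z (fun i => (w i).val) from
      scons_comp Carrier.val ⟨z, hz⟩ w, ← hφ, Formula.Realize]
    refine ((BoundedFormula.realize_restrictFreeVar _ ?_).trans
      (iff_of_eq (congrArg _ (Subsingleton.elim _ _)))).symm
    rintro ⟨a | a, ha⟩
    · change w (k ⟨.inl a, ha⟩) = _
      simp only [w, Fin.is_lt, dite_true, Fin.eta, Equiv.symm_apply_apply]
      rfl
    · rfl
  · rintro ⟨hy, rfl | ⟨φ, v, hv, h⟩⟩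
    · refine mem_Def.2 ⟨hy, ?_⟩
      have : {z : Fin 1 → Carrier (∅ : ZFSet.{u}) | (z 0).val ∈ y} = ∅ := by
        ext z
        exact (ZFSet.notMem_empty _ (z 0).property).elim
      change Set.Definable _ _ {z : Fin 1 → Carrier (∅ : ZFSet.{u}) | (z 0).val ∈ y}
      rw [this]
      exact Set.definable_empty
    · exact mem_Def_of_sat hy φ v hv h

end ConstructibleLevels

end

/-! ### Uniformly definable predicates, with formulas found by instance search -/

namespace ConstructibleLevels

/-- A predicate on assignments, formulated uniformly for all structures `(x, ∈, U)` with `x`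
transitive, is *uniformly definable* if it is given by a single formula. -/
class UDfn (P : ZFSet.{u} → (ZFSet.{u} → Prop) → (ℕ → ZFSet.{u}) → Prop) : Prop where
  exists_fm : ∃ φ : Fm, ∀ x : ZFSet.{u}, x.IsTransitive → ∀ (U : ZFSet.{u} → Prop)
    (v : ℕ → ZFSet.{u}), (∀ i, v i ∈ x) → (Sat x U φ v ↔ P x U v)

namespace UDfn

variable {P Q : ZFSet.{u} → (ZFSet.{u} → Prop) → (ℕ → ZFSet.{u}) → Prop}

lemma congr (hP : UDfn P) (h : ∀ x : ZFSet.{u}, x.IsTransitive → ∀ (U : ZFSet.{u} → Prop)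
    (v : ℕ → ZFSet.{u}), (∀ i, v i ∈ x) → (P x U v ↔ Q x U v)) : UDfn Q := by
  obtain ⟨φ, hφ⟩ := hP.1
  exact ⟨φ, fun x hx U v hv => (hφ x hx U v hv).trans (h x hx U v hv)⟩

instance mem {i j : ℕ} : UDfn.{u} fun _ _ v => v i ∈ v j :=
  ⟨.mem i j, fun _ _ _ _ _ => Iff.rfl⟩

instance lev {i : ℕ} : UDfn.{u} fun _ U v => U (v i) :=
  ⟨.lev i, fun _ _ _ _ _ => Iff.rfl⟩

instance eq {i j : ℕ} : UDfn.{u} fun _ _ v => v i = v j :=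
  ⟨.eq i j, fun _ hx _ _ hv => sat_eq hx (hv i) (hv j)⟩

instance not [hP : UDfn P] : UDfn fun x U v => ¬ P x U v := by
  obtain ⟨φ, hφ⟩ := hP.1
  exact ⟨φ.neg, fun x hx U v hv => by rw [sat_neg, hφ x hx U v hv]⟩

instance and [hP : UDfn P] [hQ : UDfn Q] : UDfn fun x U v => P x U v ∧ Q x U v := by
  obtain ⟨φ, hφ⟩ := hP.1
  obtain ⟨ψ, hψ⟩ := hQ.1
  exact ⟨(Fm.nand φ ψ).neg, fun x hx U v hv => by
    rw [sat_neg, Sat, hφ x hx U v hv, hψ x hx U v hv, not_not]⟩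

instance imp [hP : UDfn P] [hQ : UDfn Q] : UDfn fun x U v => P x U v → Q x U v := by
  obtain ⟨φ, hφ⟩ := hP.1
  obtain ⟨ψ, hψ⟩ := hQ.1
  exact ⟨φ.imp ψ, fun x hx U v hv => by rw [sat_imp, hφ x hx U v hv, hψ x hx U v hv]⟩

instance or [UDfn P] [UDfn Q] : UDfn fun x U v => P x U v ∨ Q x U v :=
  congr (P := fun x U v => ¬ P x U v → Q x U v) inferInstance
    fun _ _ _ _ _ => or_iff_not_imp_left.symm

instance iff [UDfn P] [UDfn Q] : UDfn fun x U v => P x U v ↔ Q x U v :=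
  congr (P := fun x U v => (P x U v → Q x U v) ∧ (Q x U v → P x U v)) inferInstance
    fun _ _ _ _ _ => iff_iff_implies_and_implies.symm

instance true : UDfn.{u} fun _ _ _ => True :=
  congr (P := fun _ _ v => v 0 = v 0) inferInstance fun _ _ _ _ _ => by simp

instance false : UDfn.{u} fun _ _ _ => False :=
  congr (P := fun _ _ v => ¬ v 0 = v 0) inferInstance fun _ _ _ _ _ => by simp

/-- The bound element is a separate argument of `Q`, so that unification can match the body of a
quantifier; the search then continues with that element as `v 0` and the old variables shifted. -/
instance ex {Q : ZFSet.{u} → (ZFSet.{u} → Prop) → ZFSet.{u} → (ℕ → ZFSet.{u}) → Prop}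
    [h : UDfn fun x U v => Q x U (v 0) (fun k => v (k + 1))] :
    UDfn fun x U v => ∃ y ∈ x, Q x U y v := by
  obtain ⟨φ, hφ⟩ := h.1
  refine ⟨.ex φ, fun x hx U v hv => ?_⟩
  exact exists_congr fun a => and_congr_right fun ha =>
    hφ x hx U _ (scons_forall (p := (· ∈ x)) ha hv)

instance all {Q : ZFSet.{u} → (ZFSet.{u} → Prop) → ZFSet.{u} → (ℕ → ZFSet.{u}) → Prop}
    [h : UDfn fun x U v => Q x U (v 0) (fun k => v (k + 1))] :
    UDfn fun x U v => ∀ y ∈ x, Q x U y v := by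
  obtain ⟨φ, hφ⟩ := h.1
  refine ⟨φ.all, fun x hx U v hv => ?_⟩
  rw [sat_all]
  exact forall₂_congr fun a ha => hφ x hx U _ (scons_forall (p := (· ∈ x)) ha hv)

/-- As `x` is transitive, members of `v i` lie in `x`, and the bounded quantifier is an ordinary one
with a side condition. -/
instance bex {i : ℕ} {Q : ZFSet.{u} → (ZFSet.{u} → Prop) → ZFSet.{u} → (ℕ → ZFSet.{u}) → Prop}
    [UDfn fun x U v => Q x U (v 0) (fun k => v (k + 1))] :
    UDfn fun x U v => ∃ y ∈ v i, Q x U y v :=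
  congr (P := fun x U v => ∃ y ∈ x, y ∈ v i ∧ Q x U y v) inferInstance fun _ hx _ _ hv =>
    ⟨fun ⟨y, _, h⟩ => ⟨y, h⟩, fun ⟨y, hy, h⟩ => ⟨y, hx _ (hv i) hy, hy, h⟩⟩

instance ball {i : ℕ} {Q : ZFSet.{u} → (ZFSet.{u} → Prop) → ZFSet.{u} → (ℕ → ZFSet.{u}) → Prop}
    [UDfn fun x U v => Q x U (v 0) (fun k => v (k + 1))] :
    UDfn fun x U v => ∀ y ∈ v i, Q x U y v :=
  congr (P := fun x U v => ∀ y ∈ x, y ∈ v i → Q x U y v) inferInstance fun _ hx _ _ hv =>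
    ⟨fun h y hy => h y (hx _ (hv i) hy) hy, fun h y _ hy => h y hy⟩

lemma rename (hP : UDfn P) (f : ℕ → ℕ) : UDfn fun x U v => P x U (fun i => v (f i)) := by
  obtain ⟨φ, hφ⟩ := hP.1
  exact ⟨φ.rename f, fun x hx U v hv => by
    rw [sat_rename, hφ x hx U (fun i => v (f i)) fun i => hv _]⟩

instance isTransitive {i : ℕ} : UDfn.{u} fun _ _ v => (v i).IsTransitive :=
  congr (P := fun _ _ v => ∀ y ∈ v i, ∀ z ∈ y, z ∈ v i) inferInstance fun _ _ _ _ _ => Iff.rfl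

instance subset {i j : ℕ} : UDfn.{u} fun _ _ v => v i ⊆ v j :=
  congr (P := fun _ _ v => ∀ y ∈ v i, y ∈ v j) inferInstance fun _ _ _ _ _ => Iff.rfl

instance isOrdinal {i : ℕ} : UDfn.{u} fun _ _ v => (v i).IsOrdinal :=
  congr (P := fun _ _ v => (v i).IsTransitive ∧ ∀ y ∈ v i, y.IsTransitive) inferInstance
    fun _ _ _ _ _ => ZFSet.isOrdinal_iff_forall_mem_isTransitive.symm

instance eq_empty {i : ℕ} : UDfn.{u} fun _ _ v => v i = ∅ :=
  congr (P := fun _ _ v => ∀ y ∈ v i, False) inferInstance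
    fun _ _ _ _ _ => (ZFSet.eq_empty _).symm

instance eq_insert {i j k : ℕ} : UDfn.{u} fun _ _ v => v i = insert (v j) (v k) :=
  congr (P := fun _ _ v => (∀ z ∈ v i, z = v j ∨ z ∈ v k) ∧ v j ∈ v i ∧ ∀ z ∈ v k, z ∈ v i)
    inferInstance fun _ _ _ v _ => by
      rw [ZFSet.ext_iff]
      simp only [ZFSet.mem_insert_iff]
      exact ⟨fun h z => ⟨h.1 z, fun hz => hz.elim (fun e => e ▸ h.2.1) (h.2.2 z)⟩,
        fun h => ⟨fun z => (h z).1, (h _).2 (.inl rfl), fun z hz => (h z).2 (.inr hz)⟩⟩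

instance eq_singleton {i j : ℕ} : UDfn.{u} fun _ _ v => v i = {v j} :=
  congr (P := fun _ _ v => (∀ z ∈ v i, z = v j) ∧ v j ∈ v i)
    inferInstance fun _ _ _ v _ => by
      rw [ZFSet.ext_iff]
      simp only [ZFSet.mem_singleton]
      exact ⟨fun h z => ⟨h.1 z, fun hz => hz ▸ h.2⟩,
        fun h => ⟨fun z => (h z).1, (h _).2 rfl⟩⟩

instance eq_upair {i j k : ℕ} : UDfn.{u} fun _ _ v => v i = {v j, v k} :=
  congr (P := fun _ _ v => (∀ z ∈ v i, z = v j ∨ z = v k) ∧ v j ∈ v i ∧ v k ∈ v i)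
    inferInstance fun _ _ _ v _ => by
      rw [ZFSet.ext_iff]
      simp only [ZFSet.mem_pair]
      exact ⟨fun h z => ⟨h.1 z, fun hz => hz.elim (fun e => e ▸ h.2.1) (fun e => e ▸ h.2.2)⟩,
        fun h => ⟨fun z => (h z).1, (h _).2 (.inl rfl), (h _).2 (.inr rfl)⟩⟩

instance eq_pair {i j k : ℕ} : UDfn.{u} fun _ _ v => v i = ZFSet.pair (v j) (v k) :=
  congr (P := fun _ _ v => (∀ z ∈ v i, z = {v j} ∨ z = {v j, v k}) ∧ (∃ z ∈ v i, z = {v j}) ∧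
      ∃ z ∈ v i, z = {v j, v k})
    inferInstance fun _ _ _ v _ => by
      rw [ZFSet.ext_iff]
      simp only [ZFSet.pair, ZFSet.mem_pair]
      constructor
      · rintro ⟨h, ⟨a, ha, rfl⟩, b, hb, rfl⟩ z
        exact ⟨h z, fun hz => hz.elim (fun e => e ▸ ha) (fun e => e ▸ hb)⟩
      · exact fun h => ⟨fun z => (h z).1, ⟨_, (h _).2 (.inl rfl), rfl⟩, _, (h _).2 (.inr rfl), rfl⟩

instance pair_mem {i j k : ℕ} : UDfn.{u} fun _ _ v => ZFSet.pair (v j) (v k) ∈ v i :=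
  congr (P := fun _ _ v => ∃ z ∈ v i, z = ZFSet.pair (v j) (v k)) inferInstance
    fun _ _ _ v _ => by simp

end UDfn

/-! ### Elementary properties of the levels -/

lemma L_zero : L.{u} 0 = ∅ := by
  rw [L, Ordinal.limitRecOn_zero]

lemma L_add_one (a : Ordinal.{u}) : L (a + 1) = Def (L a) := by
  rw [L, Ordinal.limitRecOn_add_one, L]

lemma mem_L_limit {a : Ordinal.{u}} (ha : Order.IsSuccLimit a) {z : ZFSet.{u}} :
    z ∈ L a ↔ ∃ b < a, z ∈ L b := by
  rw [L, Ordinal.limitRecOn_limit _ _ _ _ ha, ZFSet.mem_iUnion]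
  simp only [Subtype.exists, Set.mem_Iio, L, exists_prop]

lemma subset_of_mem_Def {x y : ZFSet.{u}} (h : y ∈ Def x) : y ⊆ x := (mem_Def.1 h).1

lemma subset_Def {x : ZFSet.{u}} (hx : x.IsTransitive) : x ⊆ Def x := by
  intro z hz
  refine mem_Def_of_sat (hx _ hz) (.mem 0 1) (fun _ => z) (fun _ => hz) fun w _ => Iff.rfl

/-- The two claims need each other: `L a ⊆ Def (L a)` rests on the transitivity of `L a`, and
transitivity of the next level rests on this inclusion. -/
lemma L_aux (a : Ordinal.{u}) : (L a).IsTransitive ∧ ∀ b < a, L b ⊆ L a := by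
  induction a using Ordinal.limitRecOn with
  | zero => exact ⟨L_zero ▸ ZFSet.isTransitive_empty, fun b hb => (not_lt_zero hb).elim⟩
  | add_one a ih =>
    have h := subset_Def ih.1
    rw [L_add_one]
    refine ⟨fun y hy z hz => h (subset_of_mem_Def hy hz), fun b hb z hz => h ?_⟩
    rcases (Order.lt_add_one_iff.1 hb).lt_or_eq with hb | rfl
    · exact ih.2 b hb hz
    · exact hz
  | limit a ha ih =>
    refine ⟨fun y hy z hz => ?_, fun b hb z hz => (mem_L_limit ha).2 ⟨b, hb, hz⟩⟩
    obtain ⟨b, hb, hyb⟩ := (mem_L_limit ha).1 hy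
    exact (mem_L_limit ha).2 ⟨b, hb, (ih b hb).1 _ hyb hz⟩

lemma L_transitive (a : Ordinal.{u}) : (L a).IsTransitive := (L_aux a).1

lemma L_mono {a b : Ordinal.{u}} (h : a ≤ b) : L a ⊆ L b := by
  rcases h.lt_or_eq with h | rfl
  · exact (L_aux b).2 a h
  · exact fun _ => id

lemma L_trans {a : Ordinal.{u}} {y z : ZFSet.{u}} (hy : y ∈ L a) (hz : z ∈ y) : z ∈ L a :=
  L_transitive a _ hy hz

/-- This description covers zero, successors and limits at once, so later inductions on levels need
no case distinction. -/
lemma mem_L_iff {a : Ordinal.{u}} {z : ZFSet.{u}} : z ∈ L a ↔ ∃ b < a, z ∈ Def (L b) := by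
  simp only [← L_add_one]
  refine ⟨fun h => ?_, fun ⟨b, hb, h⟩ => L_mono (Order.add_one_le_of_lt hb) h⟩
  induction a using Ordinal.limitRecOn with
  | zero => rw [L_zero] at h; exact (ZFSet.notMem_empty _ h).elim
  | add_one a ih => exact ⟨a, lt_add_one a, h⟩
  | limit a ha ih =>
    obtain ⟨b, hb, hz⟩ := (mem_L_limit ha).1 h
    obtain ⟨c, hc, hz⟩ := ih b hb hz
    exact ⟨c, hc.trans hb, hz⟩

lemma rank_lt_of_mem_L {a : Ordinal.{u}} {z : ZFSet.{u}} (h : z ∈ L a) : z.rank < a := by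
  induction a using WellFoundedLT.induction generalizing z with
  | ind a ih =>
    obtain ⟨b, hb, hz⟩ := mem_L_iff.1 h
    exact (ZFSet.rank_le_iff.2 fun y hy => ih b hb (subset_of_mem_Def hz hy)).trans_lt hb

lemma self_mem_Def (x : ZFSet.{u}) : x ∈ Def x := by
  refine mem_Def.2 ⟨fun _ => id, ?_⟩
  have : {z : Fin 1 → Carrier x | (z 0).val ∈ x} = Set.univ :=
    Set.eq_univ_of_forall fun z => (z 0).property
  change Set.Definable _ _ {z : Fin 1 → Carrier x | (z 0).val ∈ x}
  rw [this]
  exact Set.definable_univ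

lemma L_mem_L {a b : Ordinal.{u}} : L a ∈ L b ↔ a < b := by
  refine ⟨fun h => ?_, fun h => mem_L_iff.2 ⟨a, h, self_mem_Def _⟩⟩
  by_contra hab
  exact ZFSet.mem_irrefl _ (L_mono (not_lt.1 hab) h)

lemma L_injective : Function.Injective L.{u} := by
  intro a b h
  rcases lt_trichotomy a b with hab | hab | hab
  · have := L_mem_L.2 hab
    rw [h] at this
    exact (ZFSet.mem_irrefl _ this).elim
  · exact hab
  · have := L_mem_L.2 hab
    rw [h] at this
    exact (ZFSet.mem_irrefl _ this).elim

lemma empty_mem_L {a : Ordinal.{u}} (ha : 0 < a) : ∅ ∈ L a := by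
  have := L_mem_L.2 ha
  rwa [L_zero] at this

/-- The assignment listing `l`, and constantly empty beyond its length. -/
def lst : List ZFSet.{u} → ℕ → ZFSet.{u}
  | [] => fun _ => ∅
  | a :: l => scons a (lst l)

lemma lst_mem {a : Ordinal.{u}} (ha : 0 < a) {l : List ZFSet.{u}} (h : ∀ p ∈ l, p ∈ L a) (i : ℕ) :
    lst l i ∈ L a := by
  induction l generalizing i with
  | nil => exact empty_mem_L ha
  | cons p l ih =>
    exact scons_forall (p := (· ∈ L a)) (h p (by simp)) (ih fun q hq => h q (by simp [hq])) i

lemma mem_L_add_one_of_udfn {P : ZFSet.{u} → (ZFSet.{u} → Prop) → (ℕ → ZFSet.{u}) → Prop}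
    (hP : UDfn P) {a : Ordinal.{u}} {v : ℕ → ZFSet.{u}} (hv : ∀ i, v i ∈ L a) {s : ZFSet.{u}}
    (hs : ∀ z, z ∈ s ↔ z ∈ L a ∧ P (L a) (fun _ => False) (scons z v)) : s ∈ L (a + 1) := by
  obtain ⟨φ, hφ⟩ := hP.1
  rw [L_add_one]
  refine mem_Def_of_sat (fun z hz => ((hs z).1 hz).1) φ v hv fun z hz => ?_
  rw [hφ _ (L_transitive a) _ _ (scons_forall (p := (· ∈ L a)) hz hv), hs]
  exact and_iff_right hz

/-- Separation over `L a`, with a list of parameters. -/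
lemma sep_mem_L_add_one {P : ZFSet.{u} → (ZFSet.{u} → Prop) → (ℕ → ZFSet.{u}) → Prop}
    (hP : UDfn P) {a : Ordinal.{u}} {p : ZFSet.{u}} (l : List ZFSet.{u}) (hp : p ∈ L a)
    (hl : ∀ q ∈ l, q ∈ L a) {s : ZFSet.{u}}
    (hs : ∀ z, z ∈ s ↔ z ∈ L a ∧ P (L a) (fun _ => False) (lst (z :: p :: l))) : s ∈ L (a + 1) := by
  have ha : 0 < a := by
    rw [pos_iff_ne_zero]
    rintro rfl
    rw [L_zero] at hp
    exact ZFSet.notMem_empty _ hp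
  refine mem_L_add_one_of_udfn hP (v := lst (p :: l)) (lst_mem ha ?_) hs
  simpa using ⟨hp, hl⟩

lemma upair_mem_L {a : Ordinal.{u}} {x y : ZFSet.{u}} (hx : x ∈ L a) (hy : y ∈ L a) :
    {x, y} ∈ L (a + 1) := by
  refine sep_mem_L_add_one (P := fun _ _ v => v 0 = v 1 ∨ v 0 = v 2) inferInstance [y] hx
    (by simpa using hy) fun z => ?_
  rw [ZFSet.mem_pair]
  exact ⟨fun h => ⟨h.elim (fun e => e ▸ hx) (fun e => e ▸ hy), h⟩, And.right⟩

lemma singleton_mem_L {a : Ordinal.{u}} {x : ZFSet.{u}} (hx : x ∈ L a) : {x} ∈ L (a + 1) := by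
  rw [← ZFSet.pair_eq_singleton]
  exact upair_mem_L hx hx

lemma pair_mem_L {a : Ordinal.{u}} {x y : ZFSet.{u}} (hx : x ∈ L a) (hy : y ∈ L a) :
    ZFSet.pair x y ∈ L (a + 2) := by
  rw [show a + 2 = a + 1 + 1 by rw [add_assoc, one_add_one_eq_two]]
  exact upair_mem_L (singleton_mem_L hx) (upair_mem_L hx hy)

lemma mem_of_pair_mem_L {a : Ordinal.{u}} {x y : ZFSet.{u}} (h : ZFSet.pair x y ∈ L a) :
    x ∈ L a ∧ y ∈ L a := by
  have h2 : {x, y} ∈ L a := L_trans h (by simp [ZFSet.pair])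
  exact ⟨L_trans h2 (by simp), L_trans h2 (by simp)⟩

lemma sUnion_mem_L {a : Ordinal.{u}} {x : ZFSet.{u}} (hx : x ∈ L a) :
    ZFSet.sUnion x ∈ L (a + 1) := by
  refine sep_mem_L_add_one (P := fun _ _ v => ∃ y ∈ v 1, v 0 ∈ y) inferInstance []
    hx (by simp) fun z => ?_
  rw [ZFSet.mem_sUnion]
  exact ⟨fun h => ⟨let ⟨y, hy, hz⟩ := h; L_trans (L_trans hx hy) hz, h⟩, And.right⟩

instance UDfn.bounded_ex_eq (N : ℕ) : UDfn.{u} fun _ _ v => ∃ i < N, v 0 = v (i + 1) := by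
  induction N with
  | zero => exact UDfn.congr (P := fun _ _ _ => False) inferInstance fun _ _ _ _ _ => by simp
  | succ N ih =>
    refine UDfn.congr (P := fun _ _ v => (∃ i < N, v 0 = v (i + 1)) ∨ v 0 = v (N + 1))
      inferInstance fun _ _ _ v _ => ?_
    simp only [Nat.lt_succ_iff_lt_or_eq, or_and_right, exists_or, exists_eq_left]

/-- A finite disjunction of equations `z = v i` defines the set. -/
lemma finite_mem_L {a : Ordinal.{u}} {t : ZFSet.{u}} (ht : (t : Set ZFSet.{u}).Finite)
    (h : t ⊆ L a) : t ∈ L (a + 1) := by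
  rcases ZFSet.eq_empty_or_nonempty t with rfl | ⟨p, hp⟩
  · exact empty_mem_L (by simp)
  obtain ⟨N, f, hf⟩ := ht.fin_param
  let v : ℕ → ZFSet.{u} := fun i => if hi : i < N then f ⟨i, hi⟩ else p
  have hft : ∀ i, f i ∈ t := fun i => by
    have : f i ∈ Set.range f := ⟨i, rfl⟩
    rw [hf.2] at this
    exact this
  refine mem_L_add_one_of_udfn (UDfn.bounded_ex_eq N) (v := v) (fun i => ?_) fun z => ?_
  · by_cases hi : i < N
    · simp only [v, hi, dite_true]; exact h (hft _)
    · simp only [v, hi, dite_false]; exact h hp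
  · have : z ∈ t ↔ ∃ i < N, z = v i := by
      rw [← SetLike.mem_coe, ← hf.2]
      constructor
      · rintro ⟨i, rfl⟩
        exact ⟨i, i.2, by simp [v]⟩
      · rintro ⟨i, hi, rfl⟩
        exact ⟨⟨i, hi⟩, by simp [v, hi]⟩
    exact ⟨fun hz => ⟨h hz, this.1 hz⟩, fun hz => this.2 hz.2⟩

-- By induction and the rank bound, the ordinals in `L b` are exactly the elements of `b`, so "being
-- an ordinal" defines `b` over `L b`. The case `b = 0` is separate because `L 0` has no element to
-- serve as parameter.
open Ordinal in
lemma toZFSet_mem_L {a b : Ordinal.{u}} : b.toZFSet ∈ L a ↔ b < a := by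
  refine ⟨fun h => rank_toZFSet b ▸ rank_lt_of_mem_L h, fun h => ?_⟩
  induction b using WellFoundedLT.induction generalizing a with
  | ind b ih =>
    refine L_mono (Order.add_one_le_of_lt h) ?_
    rcases eq_or_ne b 0 with rfl | hb
    · rw [toZFSet_zero]; exact empty_mem_L (by simp)
    refine sep_mem_L_add_one (P := fun _ _ v => (v 0).IsOrdinal) inferInstance [] (p := ∅)
      (empty_mem_L (pos_iff_ne_zero.2 hb)) (by simp) fun z => ?_
    rw [mem_toZFSet_iff]
    constructor
    · rintro ⟨c, hc, rfl⟩
      exact ⟨ih c hc hc, ZFSet.isOrdinal_toZFSet c⟩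
    · rintro ⟨hz, hzo⟩
      have hzo : z.IsOrdinal := hzo
      exact ⟨z.rank, rank_lt_of_mem_L hz, hzo.toZFSet_rank_eq⟩

lemma toZFSet_subset_L {a b : Ordinal.{u}} (h : b ≤ a) : b.toZFSet ⊆ L a := by
  intro z hz
  obtain ⟨c, hc, rfl⟩ := Ordinal.mem_toZFSet_iff.1 hz
  exact toZFSet_mem_L.2 (hc.trans_le h)

/-! ### Limit levels -/

section Limit

variable {l : Ordinal.{u}} (hl : Order.IsSuccLimit l)

include hl

lemma exists_level (ps : List ZFSet.{u}) (h : ∀ p ∈ ps, p ∈ L l) :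
    ∃ a < l, ∀ p ∈ ps, p ∈ L a := by
  induction ps with
  | nil => exact ⟨0, hl.bot_lt, by simp⟩
  | cons p ps ih =>
    obtain ⟨a, ha, h1⟩ := ih fun q hq => h q (by simp [hq])
    obtain ⟨b, hb, h2⟩ := (mem_L_limit hl).1 (h p (by simp))
    refine ⟨max a b, max_lt ha hb, fun q hq => ?_⟩
    rcases List.mem_cons.1 hq with rfl | hq
    · exact L_mono (le_max_right _ _) h2
    · exact L_mono (le_max_left _ _) (h1 q hq)

lemma add_nat_lt {a : Ordinal.{u}} (ha : a < l) (n : ℕ) : a + n < l := by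
  induction n with
  | zero => simpa using ha
  | succ n ih => rw [Nat.cast_succ, ← add_assoc]; exact hl.add_one_lt ih

lemma pair_mem_limit {x y : ZFSet.{u}} (hx : x ∈ L l) (hy : y ∈ L l) : ZFSet.pair x y ∈ L l := by
  obtain ⟨a, ha, h⟩ := exists_level hl [x, y] (by simp [hx, hy])
  exact L_mono (add_nat_lt hl ha 2).le (pair_mem_L (h x (by simp)) (h y (by simp)))

/-- Separation in a limit level, with a list of parameters. -/
lemma sep_mem_limit {P : (ℕ → ZFSet.{u}) → Prop} (hP : UDfn fun _ _ v => P v) {t : ZFSet.{u}}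
    (ht : t ∈ L l) (ps : List ZFSet.{u}) (hps : ∀ q ∈ ps, q ∈ L l) :
    t.sep (fun z => P (lst (z :: ps))) ∈ L l := by
  obtain ⟨a, ha, h⟩ := exists_level hl (t :: ps) (by simpa using ⟨ht, hps⟩)
  have hta := h t (by simp)
  -- The set `t` is inserted as an additional parameter at index 1; the renaming makes `P` skip it.
  -- As `P` does not mention the ambient level, it may be evaluated over `L a`.
  refine L_mono (hl.add_one_lt ha).le (sep_mem_L_add_one
    (P := fun _ _ v => v 0 ∈ v 1 ∧ P (fun i => v (Nat.casesOn i 0 fun n => n + 2)))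
    (UDfn.and (hQ := hP.rename _)) ps hta (fun q hq => h q (by simp [hq])) fun z => ?_)
  rw [ZFSet.mem_sep]
  have e : (fun i => lst (z :: t :: ps) (Nat.casesOn i 0 fun n => n + 2)) = lst (z :: ps) := by
    funext i; cases i <;> rfl
  rw [e]
  exact ⟨fun hz => ⟨L_trans hta hz.1, hz⟩, And.right⟩

end Limit

end ConstructibleLevels

open Ordinal

namespace ConstructibleLevels

/-! ### Partial surjections inside a limit level -/

lemma add_one_add_two (a : Ordinal.{u}) : a + 1 + 2 = a + 3 := by
  rw [add_assoc]
  congr 1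
  exact_mod_cast (rfl : 1 + 2 = 3)

/-- There is a partial function in `L l` from the ordinal `a` whose range covers `C`. -/
def Onto (l a : Ordinal.{u}) (C : Set ZFSet.{u}) : Prop :=
  ∃ G ∈ L l, (∀ x y y', ZFSet.pair x y ∈ G → ZFSet.pair x y' ∈ G → y = y') ∧
    ∀ y ∈ C, ∃ b < a, ZFSet.pair b.toZFSet y ∈ G

/-- The finite subsets of a class. -/
def finSubsets (C : Set ZFSet.{u}) : Set ZFSet.{u} :=
  {t | (t : Set ZFSet.{u}).Finite ∧ ∀ y ∈ t, y ∈ C}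

lemma exists_zfset_of_finite {s : Set ZFSet.{u}} (hs : s.Finite) :
    ∃ t : ZFSet.{u}, ∀ z, z ∈ t ↔ z ∈ s := by
  induction s, hs using Set.Finite.induction_on with
  | empty => exact ⟨∅, fun z => by simp⟩
  | @insert a s _ _ ih =>
    obtain ⟨t, ht⟩ := ih
    exact ⟨insert a t, fun z => by simp [ht]⟩

lemma singleton_mem_finSubsets {C : Set ZFSet.{u}} {x : ZFSet.{u}} (hx : x ∈ C) :
    {x} ∈ finSubsets C :=
  ⟨by simp, fun y hy => by rw [ZFSet.mem_singleton] at hy; exact hy ▸ hx⟩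

lemma upair_mem_finSubsets {C : Set ZFSet.{u}} {x y : ZFSet.{u}} (hx : x ∈ C) (hy : y ∈ C) :
    {x, y} ∈ finSubsets C := by
  refine ⟨by simp, fun z hz => ?_⟩
  rcases ZFSet.mem_pair.1 hz with rfl | rfl
  · exact hx
  · exact hy

lemma pair_mem_finSubsets {C : Set ZFSet.{u}} {x y : ZFSet.{u}} (hx : x ∈ C) (hy : y ∈ C) :
    ZFSet.pair x y ∈ finSubsets (finSubsets C) :=
  upair_mem_finSubsets (singleton_mem_finSubsets hx) (upair_mem_finSubsets hx hy)

section

variable {l : Ordinal.{u}}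

lemma exists_sep (hl : Order.IsSuccLimit l) (P : (ℕ → ZFSet.{u}) → Prop)
    [hP : UDfn fun _ _ v => P v] {t : ZFSet.{u}}
    (ht : t ∈ L l) (ps : List ZFSet.{u}) (hps : ∀ q ∈ ps, q ∈ L l) :
    ∃ s ∈ L l, ∀ z, z ∈ s ↔ z ∈ t ∧ P (lst (z :: ps)) :=
  ⟨_, sep_mem_limit hl hP ht ps hps, fun _ => ZFSet.mem_sep⟩

namespace Onto

variable {a b : Ordinal.{u}} {B C : Set ZFSet.{u}}

lemma mono (h : Onto l a C) (hab : a ≤ b) (hB : B ⊆ C) : Onto l b B := by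
  obtain ⟨G, hG, h1, h2⟩ := h
  exact ⟨G, hG, h1, fun y hy => let ⟨c, hc, h⟩ := h2 y (hB hy); ⟨c, hc.trans_le hab, h⟩⟩

lemma self (hl : Order.IsSuccLimit l) (ha : a < l) : Onto l a (a.toZFSet : Set ZFSet.{u}) := by
  obtain ⟨G, hG, h⟩ := exists_sep hl (fun v => ∃ x ∈ v 1, v 0 = ZFSet.pair x x)
    (t := L (a + 2)) (L_mem_L.2 (add_nat_lt hl ha 2)) [a.toZFSet]
    (by simpa using toZFSet_mem_L.2 ha)
  replace h : ∀ z, z ∈ G ↔ z ∈ L (a + 2) ∧ ∃ x ∈ a.toZFSet, z = ZFSet.pair x x := h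
  refine ⟨G, hG, fun x y y' h1 h2 => ?_, fun y hy => ?_⟩
  · obtain ⟨-, z, -, hz⟩ := (h _).1 h1
    obtain ⟨-, w, -, hw⟩ := (h _).1 h2
    rw [ZFSet.pair_inj] at hz hw
    rw [hz.2, hw.2, ← hz.1, ← hw.1]
  · obtain ⟨b, hb, rfl⟩ := mem_toZFSet_iff.1 hy
    have := toZFSet_mem_L.2 hb
    exact ⟨b, hb, (h _).2 ⟨pair_mem_L this this, _, hy, rfl⟩⟩

lemma comp (hl : Order.IsSuccLimit l) (hB : Onto l a B) {R : ZFSet.{u}} (hR : R ∈ L l)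
    (hf : ∀ x y y', ZFSet.pair x y ∈ R → ZFSet.pair x y' ∈ R → y = y')
    (hC : ∀ c ∈ C, ∃ b ∈ B, ZFSet.pair b c ∈ R) : Onto l a C := by
  obtain ⟨G, hG, h1, h2⟩ := hB
  obtain ⟨d, hd, hps⟩ := exists_level hl [G, R] (by simp [hG, hR])
  obtain ⟨G', hG', h⟩ := exists_sep hl (fun v => ∃ x ∈ v 1, ∃ y ∈ v 1, ∃ z ∈ v 1,
      v 0 = ZFSet.pair x z ∧ ZFSet.pair x y ∈ v 2 ∧ ZFSet.pair y z ∈ v 3)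
    (t := L (d + 2)) (L_mem_L.2 (add_nat_lt hl hd 2)) [L d, G, R]
    (by simp [hG, hR, L_mem_L.2 hd])
  replace h : ∀ p, p ∈ G' ↔ p ∈ L (d + 2) ∧ ∃ x ∈ L d, ∃ y ∈ L d, ∃ z ∈ L d,
    p = ZFSet.pair x z ∧ ZFSet.pair x y ∈ G ∧ ZFSet.pair y z ∈ R := h
  refine ⟨G', hG', fun x z z' hz hz' => ?_, fun z hz => ?_⟩
  · obtain ⟨-, x1, -, y, -, z1, -, e, hy, hyz⟩ := (h _).1 hz
    obtain ⟨-, x2, -, y', -, z2, -, e', hy', hyz'⟩ := (h _).1 hz'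
    rw [ZFSet.pair_inj] at e e'
    rw [← e.1] at hy
    rw [← e'.1] at hy'
    rw [← e.2] at hyz
    rw [← e'.2] at hyz'
    rw [h1 _ _ _ hy hy'] at hyz
    exact hf _ _ _ hyz hyz'
  · obtain ⟨y, hy, hyz⟩ := hC z hz
    obtain ⟨b, hb, hby⟩ := h2 y hy
    have m1 := mem_of_pair_mem_L (L_trans (hps R (by simp)) hyz)
    have m2 := mem_of_pair_mem_L (L_trans (hps G (by simp)) hby)
    exact ⟨b, hb, (h _).2 ⟨pair_mem_L m2.1 m1.2, _, m2.1, _, m2.2, _, m1.2, rfl, hby, hyz⟩⟩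

/-- Images of finite sets under a partial function. -/
lemma fin (hl : Order.IsSuccLimit l) (ha : Onto l a (finSubsets a.toZFSet)) (hB : Onto l a B) :
    Onto l a (finSubsets B) := by
  obtain ⟨G, hG, h1, h2⟩ := hB
  obtain ⟨F, hF, f1, f2⟩ := ha
  obtain ⟨d, hd, hps⟩ := exists_level hl [G, F] (by simp [hG, hF])
  -- `G'` sends `x` to the image under `G` of the finite set `s` that `F` assigns to `x`; the last
  -- two clauses say that `t` is this image.
  obtain ⟨G', hG', h⟩ := exists_sep hl (fun v => ∃ x ∈ v 1, ∃ t ∈ v 2, v 0 = ZFSet.pair x t ∧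
      ∃ s ∈ v 1, ZFSet.pair x s ∈ v 4 ∧ (∀ y ∈ t, ∃ b ∈ s, ZFSet.pair b y ∈ v 3) ∧
      ∀ b ∈ s, ∀ y ∈ v 1, ZFSet.pair b y ∈ v 3 → y ∈ t)
    (t := L (d + 3)) (L_mem_L.2 (add_nat_lt hl hd 3)) [L d, L (d + 1), G, F]
    (by simp [hG, hF, L_mem_L.2 hd, L_mem_L.2 (hl.add_one_lt hd)])
  replace h : ∀ p, p ∈ G' ↔ p ∈ L (d + 3) ∧ ∃ x ∈ L d, ∃ t ∈ L (d + 1), p = ZFSet.pair x t ∧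
      ∃ s ∈ L d, ZFSet.pair x s ∈ F ∧ (∀ y ∈ t, ∃ b ∈ s, ZFSet.pair b y ∈ G) ∧
      ∀ b ∈ s, ∀ y ∈ L d, ZFSet.pair b y ∈ G → y ∈ t := h
  have mG : ∀ {x y}, ZFSet.pair x y ∈ G → x ∈ L d ∧ y ∈ L d := fun h =>
    mem_of_pair_mem_L (L_trans (hps G (by simp)) h)
  have mF : ∀ {x y}, ZFSet.pair x y ∈ F → x ∈ L d ∧ y ∈ L d := fun h =>
    mem_of_pair_mem_L (L_trans (hps F (by simp)) h)
  refine ⟨G', hG', fun x t t' ht ht' => ?_, fun t ht => ?_⟩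
  · obtain ⟨-, x1, -, t1, -, e, s, -, hs, p1, p2⟩ := (h _).1 ht
    obtain ⟨-, x2, -, t2, -, e', s', -, hs', p1', p2'⟩ := (h _).1 ht'
    rw [ZFSet.pair_inj] at e e'
    obtain ⟨rfl, rfl⟩ := e
    obtain ⟨rfl, rfl⟩ := e'
    obtain rfl := f1 _ _ _ hs hs'
    ext y
    constructor
    · intro hy
      obtain ⟨b, hb, hby⟩ := p1 y hy
      exact p2' b hb y (mG hby).2 hby
    · intro hy
      obtain ⟨b, hb, hby⟩ := p1' y hy
      exact p2 b hb y (mG hby).2 hby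
  · obtain ⟨htf, htB⟩ := ht
    -- One preimage is chosen for each element of `t`. The chosen ordinals form a finite subset of
    -- `a` whose image is exactly `t`, since `G` is single-valued.
    have : ∀ y : ZFSet.{u}, ∃ b : Ordinal.{u}, y ∈ t → b < a ∧ ZFSet.pair b.toZFSet y ∈ G := by
      intro y
      by_cases hy : y ∈ t
      · obtain ⟨b, hb⟩ := h2 y (htB y hy)
        exact ⟨b, fun _ => hb⟩
      · exact ⟨0, fun h => (hy h).elim⟩
    choose g hg using this
    obtain ⟨s, hs⟩ := exists_zfset_of_finite (htf.image fun y => (g y).toZFSet)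
    have hsa : s ∈ finSubsets (a.toZFSet : Set ZFSet.{u}) := by
      refine ⟨(htf.image fun y => (g y).toZFSet).subset fun z hz => (hs z).1 hz, fun z hz => ?_⟩
      obtain ⟨y, hy, rfl⟩ := (hs z).1 hz
      exact toZFSet_mem_toZFSet_iff.2 (hg y hy).1
    obtain ⟨x, hx, hxs⟩ := f2 s hsa
    have htL : t ∈ L (d + 1) := finite_mem_L htf fun y hy => (mG (hg y hy).2).2
    refine ⟨x, hx, (h _).2 ⟨?_, _, (mF hxs).1, t, htL, rfl, s, (mF hxs).2, hxs, ?_, ?_⟩⟩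
    · have := pair_mem_L (L_mono (le_self_add (b := 1)) (mF hxs).1) htL
      rwa [add_one_add_two] at this
    · intro y hy
      exact ⟨_, (hs _).2 ⟨y, hy, rfl⟩, (hg y hy).2⟩
    · intro b hb y _ hby
      obtain ⟨y', hy', rfl⟩ := (hs b).1 hb
      rw [h1 _ _ _ hby (hg y' hy').2]
      exact hy'

/-- The finite subsets of `B` are already covered and leave room for one more value: `{y}` is
decoded as `y`, and `∅` as `c`. -/
lemma insert (hl : Order.IsSuccLimit l) (ha : Onto l a (finSubsets a.toZFSet)) (hB : Onto l a B)
    {c : ZFSet.{u}} (hc : c ∈ L l) : Onto l a (Insert.insert c B) := by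
  have hfin := fin hl ha hB
  obtain ⟨G, hG, h1, h2⟩ := hB
  obtain ⟨d, hd, hps⟩ := exists_level hl [G, c] (by simp [hG, hc])
  obtain ⟨R, hR, h⟩ := exists_sep hl (fun v => (∃ x ∈ v 1, x = ∅ ∧ v 0 = ZFSet.pair x (v 3)) ∨
      ∃ s ∈ v 1, ∃ y ∈ v 2, s = {y} ∧ v 0 = ZFSet.pair s y)
    (t := L (d + 3)) (L_mem_L.2 (add_nat_lt hl hd 3)) [L (d + 1), L d, c]
    (by simp [hc, L_mem_L.2 hd, L_mem_L.2 (hl.add_one_lt hd)])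
  replace h : ∀ p, p ∈ R ↔ p ∈ L (d + 3) ∧ ((∃ x ∈ L (d + 1), x = ∅ ∧ p = ZFSet.pair x c) ∨
      ∃ s ∈ L (d + 1), ∃ y ∈ L d, s = {y} ∧ p = ZFSet.pair s y) := h
  have hp : ∀ {x y}, x ∈ L (d + 1) → y ∈ L d → ZFSet.pair x y ∈ L (d + 3) := fun hx hy => by
    have := pair_mem_L hx (L_mono (le_self_add (b := 1)) hy)
    rwa [add_one_add_two] at this
  refine comp hl hfin hR (fun x y y' hy hy' => ?_) fun y hy => ?_
  · rcases (h _).1 hy with ⟨-, ⟨x1, -, rfl, e⟩ | ⟨s, -, y1, -, rfl, e⟩⟩ <;>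
    rcases (h _).1 hy' with ⟨-, ⟨x2, -, rfl, e'⟩ | ⟨s', -, y2, -, rfl, e'⟩⟩ <;>
    rw [ZFSet.pair_inj] at e e' <;> obtain ⟨rfl, rfl⟩ := e <;> obtain ⟨e1, rfl⟩ := e'
    · rfl
    · exact absurd (e1 ▸ ZFSet.mem_singleton.2 rfl : y' ∈ (∅ : ZFSet.{u})) (ZFSet.notMem_empty _)
    · exact absurd (e1 ▸ ZFSet.mem_singleton.2 rfl : y ∈ (∅ : ZFSet.{u})) (ZFSet.notMem_empty _)
    · exact ZFSet.singleton_injective e1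
  · rcases hy with rfl | hy
    · have he : ∅ ∈ L (d + 1) := empty_mem_L (by simp)
      exact ⟨∅, ⟨by simp, by simp⟩, (h _).2 ⟨hp he (hps _ (by simp)), .inl ⟨∅, he, rfl, rfl⟩⟩⟩
    · obtain ⟨b, -, hby⟩ := h2 y hy
      have hyd := (mem_of_pair_mem_L (L_trans (hps G (by simp)) hby)).2
      exact ⟨{y}, singleton_mem_finSubsets hy, (h _).2 ⟨hp (singleton_mem_L hyd) hyd,
        .inr ⟨_, singleton_mem_L hyd, y, hyd, rfl, rfl⟩⟩⟩

end Onto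

end

/-! ### The colexicographic enumeration of finite sets of ordinals -/

/-- Outer induction on a strict bound for the elements; for sets with maximum `m`, inner induction
on the part below `m`. A predecessor either still contains `m` and has a smaller remainder, or is
bounded by `m`. -/
instance wellFoundedLT_colex : WellFoundedLT (Colex (Finset Ordinal.{u})) := by
  have key : ∀ a : Ordinal.{u}, ∀ s : Finset Ordinal.{u}, (∀ b ∈ s, b < a) →
      Acc (· < ·) (toColex s) := by
    intro a
    induction a using WellFoundedLT.induction with
    | ind a ih =>
      intro s hs
      rcases s.eq_empty_or_nonempty with rfl | hne
      · exact Acc.intro _ fun t ht => (not_lt_bot ht).elim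
      let m := s.max' hne
      have hm : m < a := hs _ (s.max'_mem hne)
      have inner : ∀ t : Colex (Finset Ordinal.{u}), Acc (· < ·) t →
          (∀ b ∈ ofColex t, b < m) → Acc (· < ·) (toColex (insert m (ofColex t))) := by
        intro t ht
        induction ht with
        | intro t _ iht =>
          intro htm
          refine Acc.intro _ fun r hr => ?_
          by_cases hmr : m ∈ ofColex r
          · have hle : ∀ b ∈ ofColex r, b ≤ m := Finset.Colex.forall_le_mono (s := ofColex r)
              hr.le fun b hb => (Finset.mem_insert.1 hb).elim le_of_eq fun h => (htm b h).le
            have hlt : ∀ b ∈ (ofColex r).erase m, b < m := fun b hb =>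
              lt_of_le_of_ne (hle b (Finset.mem_of_mem_erase hb)) (Finset.ne_of_mem_erase hb)
            have h2 : toColex ((ofColex r).erase m) < t := by
              have hmt : m ∉ ofColex t := fun h => lt_irrefl _ (htm m h)
              rw [Finset.Colex.lt_iff_exists_forall_lt]
              rw [Finset.Colex.lt_iff_exists_forall_lt] at hr
              obtain ⟨c, hc, hcr, hcb⟩ := hr
              have hcm : c ≠ m := fun e => hcr (e ▸ hmr)
              refine ⟨c, (Finset.mem_insert.1 hc).resolve_left hcm,
                fun h => hcr (Finset.mem_of_mem_erase h), fun b hb hbt => ?_⟩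
              refine hcb b (Finset.mem_of_mem_erase hb) fun h => ?_
              exact (Finset.mem_insert.1 h).elim (Finset.ne_of_mem_erase hb) hbt
            have := iht _ h2 hlt
            rwa [ofColex_toColex, Finset.insert_erase hmr, toColex_ofColex] at this
          · have hle : ∀ b ∈ ofColex r, b ≤ m := Finset.Colex.forall_le_mono (s := ofColex r)
              hr.le fun b hb => (Finset.mem_insert.1 hb).elim le_of_eq fun h => (htm b h).le
            exact ih m hm (ofColex r) fun b hb =>
              lt_of_le_of_ne (hle b hb) fun e => hmr (e ▸ hb)
      have hers : ∀ b ∈ s.erase m, b < m := fun b hb =>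
        lt_of_le_of_ne (s.le_max' b (Finset.mem_of_mem_erase hb)) (Finset.ne_of_mem_erase hb)
      have := inner (toColex (s.erase m)) (ih m hm _ hers) hers
      rwa [ofColex_toColex, Finset.insert_erase (s.max'_mem hne)] at this
  refine ⟨⟨fun s => ?_⟩⟩
  rcases (ofColex s).eq_empty_or_nonempty with h | hne
  · exact key 0 (ofColex s) (by simp [h])
  · exact key ((ofColex s).max' hne + 1) (ofColex s)
      fun b hb => Order.lt_add_one_iff.2 ((ofColex s).le_max' b hb)

/-- A surjection from a proper initial segment would make the finite sets of ordinals small, but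
singletons embed all ordinals. -/
lemma exists_notMem_range {a : Ordinal.{u}} (f : Set.Iio a → Colex (Finset Ordinal.{u})) :
    {s | ∀ b, f b ≠ s}.Nonempty := by
  by_contra h
  have hf : Function.Surjective f := by
    intro s
    by_contra hs
    exact h ⟨s, fun b hb => hs ⟨b, hb⟩⟩
  have : Small.{u} (Colex (Finset Ordinal.{u})) := small_of_surjective hf
  have hinj : Function.Injective fun c : Ordinal.{u} => toColex ({c} : Finset Ordinal.{u}) :=
    fun c d hcd => Finset.singleton_injective (toColex.injective hcd)
  exact not_small_ordinal.{u} (small_of_injective hinj)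

/-- The enumeration of the finite sets of ordinals in colexicographic order. -/
noncomputable def enumFin : Ordinal.{u} → Colex (Finset Ordinal.{u}) :=
  WellFoundedLT.fix (fun _ f => wellFounded_lt.min
    {s | ∀ b : Set.Iio _, f b.1 b.2 ≠ s} (exists_notMem_range fun b => f b.1 b.2))

lemma enumFin_spec (a : Ordinal.{u}) : (∀ b < a, enumFin b ≠ enumFin a) ∧
    ∀ s < enumFin a, ∃ b < a, enumFin b = s := by
  have e : enumFin a = wellFounded_lt.min {s | ∀ b : Set.Iio a, enumFin b.1 ≠ s}
      (exists_notMem_range fun b => enumFin b.1) := by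
    rw [enumFin, WellFoundedLT.fix_eq]
  constructor
  · have := wellFounded_lt.min_mem {s | ∀ b : Set.Iio a, enumFin b.1 ≠ s}
      (exists_notMem_range fun b => enumFin b.1)
    rw [← e] at this
    exact fun b hb => this ⟨b, hb⟩
  · intro s hs
    by_contra h
    push Not at h
    rw [e] at hs
    exact wellFounded_lt.not_lt_min {s | ∀ b : Set.Iio a, enumFin b.1 ≠ s}
      (fun b => h b.1 b.2) hs

lemma enumFin_injective : Function.Injective enumFin.{u} := by
  intro a b h
  rcases lt_trichotomy a b with hab | hab | hab
  · exact ((enumFin_spec b).1 a hab h).elim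
  · exact hab
  · exact ((enumFin_spec a).1 b hab h.symm).elim

/-- The second hypothesis tests only `t = enumFin a`, the one predecessor whose membership in the
ambient level has to be checked when this is applied to approximations. -/
lemma eq_enumFin {a : Ordinal.{u}} {s : Colex (Finset Ordinal.{u})} (h1 : ∀ b < a, enumFin b ≠ s)
    (h2 : ∀ t < s, t = enumFin a → ∃ b < a, enumFin b = t) : s = enumFin a := by
  rcases lt_trichotomy s (enumFin a) with h | h | h
  · obtain ⟨b, hb, e⟩ := (enumFin_spec a).2 s h
    exact (h1 b hb e).elim
  · exact h
  · obtain ⟨b, hb, e⟩ := h2 _ h rfl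
    exact ((enumFin_spec a).1 b hb e).elim

lemma le_of_enumFin_eq_singleton (b : Ordinal.{u}) : ∀ a, enumFin a = toColex {b} → b ≤ a := by
  induction b using WellFoundedLT.induction with
  | ind b ih =>
    intro a ha
    by_contra h
    push Not at h
    have hlt : toColex {a} < enumFin a := by
      rw [ha]
      exact Finset.Colex.singleton_lt_singleton.2 h
    obtain ⟨c, hc, e⟩ := (enumFin_spec a).2 _ hlt
    exact not_lt_of_ge (ih a h c e) hc

/-- The singleton `{a}` cannot occur before stage `a`, so `enumFin a` is at most `{a}`. This keeps
stage `a` of the enumeration in `L (a + 1 + 1)`. -/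
lemma le_of_mem_enumFin {a b : Ordinal.{u}} (h : b ∈ ofColex (enumFin a)) : b ≤ a := by
  have hle : enumFin a ≤ toColex {a} := by
    by_contra hlt
    obtain ⟨c, hc, e⟩ := (enumFin_spec a).2 _ (not_le.1 hlt)
    exact not_lt_of_ge (le_of_enumFin_eq_singleton a c e) hc
  exact Finset.Colex.forall_le_mono (s := ofColex (enumFin a)) hle (by simp) b h

/-- The finite set of ordinals `s`, as a set in the sense of `ZFSet`. -/
noncomputable def ordSet (s : Finset Ordinal.{u}) : ZFSet.{u} :=
  (exists_zfset_of_finite (s.finite_toSet.image toZFSet)).choose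

lemma mem_ordSet {s : Finset Ordinal.{u}} {z : ZFSet.{u}} : z ∈ ordSet s ↔ ∃ b ∈ s, b.toZFSet = z :=
  (exists_zfset_of_finite (s.finite_toSet.image toZFSet)).choose_spec z

@[simp] lemma toZFSet_mem_ordSet {s : Finset Ordinal.{u}} {b : Ordinal.{u}} :
    b.toZFSet ∈ ordSet s ↔ b ∈ s := by
  rw [mem_ordSet]
  exact ⟨fun ⟨c, hc, e⟩ => toZFSet_injective e ▸ hc, fun h => ⟨b, h, rfl⟩⟩

lemma ordSet_injective : Function.Injective ordSet.{u} := by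
  intro s t h
  ext b
  rw [← toZFSet_mem_ordSet, h, toZFSet_mem_ordSet]

lemma finite_ordSet (s : Finset Ordinal.{u}) : (ordSet s : Set ZFSet.{u}).Finite :=
  (s.finite_toSet.image toZFSet).subset fun _ hz => mem_ordSet.1 hz

lemma ordSet_mem_L {s : Finset Ordinal.{u}} {a : Ordinal.{u}} (h : ∀ b ∈ s, b < a) :
    ordSet s ∈ L (a + 1) := by
  refine finite_mem_L (finite_ordSet s) fun z hz => ?_
  obtain ⟨b, hb, rfl⟩ := mem_ordSet.1 hz
  exact toZFSet_mem_L.2 (h b hb)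

lemma exists_eq_ordSet {a : Ordinal.{u}} {t : ZFSet.{u}} (ht : (t : Set ZFSet.{u}).Finite)
    (h : ∀ y ∈ t, y ∈ a.toZFSet) : ∃ s : Finset Ordinal.{u}, t = ordSet s ∧ ∀ b ∈ s, b < a := by
  have hfin : {b : Ordinal.{u} | b.toZFSet ∈ t}.Finite :=
    ht.preimage (toZFSet_injective.injOn)
  refine ⟨hfin.toFinset, ?_, fun b hb => ?_⟩
  · ext z
    rw [mem_ordSet]
    constructor
    · intro hz
      obtain ⟨b, -, rfl⟩ := mem_toZFSet_iff.1 (h z hz)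
      exact ⟨b, by simpa using hz, rfl⟩
    · rintro ⟨b, hb, rfl⟩
      simpa using hb
  · exact toZFSet_mem_toZFSet_iff.1 (h _ (by simpa using hb))

/-! ### Defining the enumeration inside a level -/

/-- `s` is a set of ordinals each nonempty initial segment of which has a maximum. -/
def FinOrd (x s : ZFSet.{u}) : Prop :=
  (∀ b ∈ s, b.IsOrdinal) ∧ ∀ c ∈ x, (∃ a ∈ s, a ∈ c) → ∃ m ∈ s, m ∈ c ∧ ∀ a ∈ s, a ∈ c → a ∈ m ∨ a = m

instance UDfn.finOrd {i : ℕ} : UDfn.{u} fun x _ v => FinOrd x (v i) := by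
  unfold FinOrd
  infer_instance

lemma finOrd_ordSet (x : ZFSet.{u}) (s : Finset Ordinal.{u}) : FinOrd x (ordSet s) := by
  refine ⟨fun b hb => ?_, fun c _ hne => ?_⟩
  · obtain ⟨b, -, rfl⟩ := mem_ordSet.1 hb
    exact ZFSet.isOrdinal_toZFSet b
  · classical
    let t := s.filter fun b => b.toZFSet ∈ c
    have ht : t.Nonempty := by
      obtain ⟨a, ha, hac⟩ := hne
      obtain ⟨b, hb, rfl⟩ := mem_ordSet.1 ha
      exact ⟨b, Finset.mem_filter.2 ⟨hb, hac⟩⟩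
    have hm := Finset.mem_filter.1 (t.max'_mem ht)
    refine ⟨(t.max' ht).toZFSet, toZFSet_mem_ordSet.2 hm.1, hm.2, fun a ha hac => ?_⟩
    obtain ⟨b, hb, rfl⟩ := mem_ordSet.1 ha
    rw [toZFSet_mem_toZFSet_iff, toZFSet_injective.eq_iff, ← le_iff_lt_or_eq]
    exact t.le_max' b (Finset.mem_filter.2 ⟨hb, hac⟩)

/-- The part of `s` below `d` is finite by induction on `d`: it is its maximum `k` together with the
part below `k`. Since `a` is a limit and `s ∈ L c` with `c < a`, each `d ≤ c` is available in `L a`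
as a test set. -/
lemma FinOrd.exists_eq {a : Ordinal.{u}} (ha : Order.IsSuccLimit a) {s : ZFSet.{u}} (hs : s ∈ L a)
    (h : FinOrd (L a) s) : ∃ F : Finset Ordinal.{u}, s = ordSet F ∧ ∀ b ∈ F, b < a := by
  obtain ⟨c, hc, hsc⟩ := (mem_L_limit ha).1 hs
  have hsub : ∀ y ∈ s, y ∈ c.toZFSet := fun y hy => by
    rw [← (h.1 y hy).toZFSet_rank_eq, toZFSet_mem_toZFSet_iff]
    exact rank_lt_of_mem_L (L_trans hsc hy)
  suffices hfin : (s : Set ZFSet.{u}).Finite by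
    obtain ⟨F, e, hF⟩ := exists_eq_ordSet hfin hsub
    exact ⟨F, e, fun b hb => (hF b hb).trans hc⟩
  have key : ∀ d : Ordinal.{u}, d ≤ c → {y | y ∈ s ∧ y ∈ d.toZFSet}.Finite := by
    intro d
    induction d using WellFoundedLT.induction with
    | ind d ih =>
      intro hd
      by_cases hne : ∃ a ∈ s, a ∈ d.toZFSet
      · obtain ⟨m, hm, hmd, hmax⟩ := h.2 d.toZFSet (toZFSet_mem_L.2 (hd.trans_lt hc)) hne
        obtain ⟨k, hk, rfl⟩ := mem_toZFSet_iff.1 hmd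
        refine ((ih k hk (hk.le.trans hd)).insert k.toZFSet).subset ?_
        rintro y ⟨hy, hyd⟩
        exact (hmax y hy hyd).elim (fun h => .inr ⟨hy, h⟩) .inl
      · refine Set.finite_empty.subset ?_
        rintro y ⟨hy, hyd⟩
        exact (hne ⟨y, hy, hyd⟩).elim
  exact (key c le_rfl).subset fun y hy => ⟨hy, hsub y hy⟩

/-- The colexicographic order on sets of ordinals. -/
def ColexLT (s t : ZFSet.{u}) : Prop := ∃ a ∈ t, a ∉ s ∧ ∀ b ∈ s, b ∉ t → b ∈ a

instance UDfn.colexLT {i j : ℕ} : UDfn.{u} fun _ _ v => ColexLT (v i) (v j) := by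
  unfold ColexLT
  infer_instance

lemma colexLT_ordSet {s t : Finset Ordinal.{u}} :
    ColexLT (ordSet s) (ordSet t) ↔ toColex s < toColex t := by
  rw [Finset.Colex.toColex_lt_toColex_iff_exists_forall_lt]
  constructor
  · rintro ⟨a, ha, has, h⟩
    obtain ⟨c, hc, rfl⟩ := mem_ordSet.1 ha
    refine ⟨c, hc, by simpa using has, fun b hb hbt => ?_⟩
    exact toZFSet_mem_toZFSet_iff.1 (h b.toZFSet (by simpa) (by simpa))
  · rintro ⟨a, ha, has, h⟩
    refine ⟨a.toZFSet, by simpa, by simpa, fun b hb hbt => ?_⟩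
    obtain ⟨c, hc, rfl⟩ := mem_ordSet.1 hb
    exact toZFSet_mem_toZFSet_iff.2 (h c hc (by simpa using hbt))

/-- The graph of the enumeration of finite sets of ordinals below `a`. -/
noncomputable def enumGraph (a : Ordinal.{u}) : ZFSet.{u} :=
  ZFSet.range fun b : Set.Iio a => ZFSet.pair b.1.toZFSet (ordSet (ofColex (enumFin b.1)))

lemma mem_enumGraph {a : Ordinal.{u}} {z : ZFSet.{u}} : z ∈ enumGraph a ↔
    ∃ b < a, z = ZFSet.pair b.toZFSet (ordSet (ofColex (enumFin b))) := by
  rw [enumGraph, ZFSet.mem_range]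
  simp only [Subtype.exists, Set.mem_Iio, exists_prop, eq_comm]

lemma pair_mem_enumGraph {a b : Ordinal.{u}} {z : ZFSet.{u}} :
    ZFSet.pair b.toZFSet z ∈ enumGraph a ↔ b < a ∧ z = ordSet (ofColex (enumFin b)) := by
  rw [mem_enumGraph]
  simp only [ZFSet.pair_inj, toZFSet_injective.eq_iff]
  exact ⟨fun ⟨c, hc, e, h⟩ => by subst e; exact ⟨hc, h⟩, fun h => ⟨b, h.1, rfl, h.2⟩⟩

/-- `g` is an initial part of the enumeration of finite sets of ordinals. -/
def EnumApprox (x g : ZFSet.{u}) : Prop :=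
  ∀ p ∈ g, ∃ a ∈ x, ∃ s ∈ x, p = ZFSet.pair a s ∧ a.IsOrdinal ∧ FinOrd x s ∧
    (∀ b ∈ a, ∃ t ∈ x, ZFSet.pair b t ∈ g) ∧ (∀ b ∈ a, ∀ t ∈ x, ZFSet.pair b t ∈ g → t ≠ s) ∧
    ∀ t ∈ x, FinOrd x t → ColexLT t s → ∃ b ∈ a, ZFSet.pair b t ∈ g

instance UDfn.enumApprox {i : ℕ} : UDfn.{u} fun x _ v => EnumApprox x (v i) := by
  unfold EnumApprox
  infer_instance

lemma ordSet_enumFin_mem_L (a : Ordinal.{u}) : ordSet (ofColex (enumFin a)) ∈ L (a + 1 + 1) :=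
  ordSet_mem_L fun _ hb => Order.lt_add_one_iff.2 (le_of_mem_enumFin hb)

lemma EnumApprox.eq_enumFin {l : Ordinal.{u}} (hl : Order.IsSuccLimit l) {g : ZFSet.{u}}
    (hg : g ∈ L l) (h : EnumApprox (L l) g) (a : Ordinal.{u}) :
    ∀ s, ZFSet.pair a.toZFSet s ∈ g → a < l ∧ s = ordSet (ofColex (enumFin a)) := by
  induction a using WellFoundedLT.induction with
  | ind a ih =>
    intro s hs
    obtain ⟨a', ha', s', hs', e, -, hf, h1, h2, h3⟩ := h _ hs
    rw [ZFSet.pair_inj] at e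
    obtain ⟨rfl, rfl⟩ := e
    have hal : a < l := toZFSet_mem_L.1 ha'
    refine ⟨hal, ?_⟩
    obtain ⟨F, rfl, hF⟩ := hf.exists_eq hl hs'
    have hprev : ∀ b < a, ZFSet.pair b.toZFSet (ordSet (ofColex (enumFin b))) ∈ g := by
      intro b hb
      obtain ⟨t, ht, hbt⟩ := h1 b.toZFSet (toZFSet_mem_toZFSet_iff.2 hb)
      rw [← (ih b hb t hbt).2]
      exact hbt
    congr 1
    refine toColex.injective (ConstructibleLevels.eq_enumFin (s := toColex F) (fun b hb e => ?_)
      fun t ht e => ?_)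
    · refine h2 b.toZFSet (toZFSet_mem_toZFSet_iff.2 hb) _
        (mem_of_pair_mem_L (L_trans hg (hprev b hb))).2 (hprev b hb) ?_
      rw [e, ofColex_toColex]
    · have htL : ordSet (ofColex t) ∈ L l := by
        rw [e]
        exact L_mono (hl.add_one_lt (hl.add_one_lt hal)).le (ordSet_enumFin_mem_L a)
      obtain ⟨b, hb, hbt⟩ := h3 _ htL (finOrd_ordSet _ _) (colexLT_ordSet.2 ht)
      obtain ⟨c, hc, rfl⟩ := mem_toZFSet_iff.1 hb
      refine ⟨c, hc, ?_⟩
      exact (ofColex.injective (ordSet_injective (ih c hc _ hbt).2)).symm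

lemma enumApprox_enumGraph {l a : Ordinal.{u}} (hl : Order.IsSuccLimit l) (ha : a ≤ l) :
    EnumApprox (L l) (enumGraph a) := by
  have hL : ∀ b < a, ordSet (ofColex (enumFin b)) ∈ L l := fun b hb =>
    L_mono (hl.add_one_lt (hl.add_one_lt (hb.trans_le ha))).le (ordSet_enumFin_mem_L b)
  intro p hp
  obtain ⟨b, hb, rfl⟩ := mem_enumGraph.1 hp
  refine ⟨_, toZFSet_mem_L.2 (hb.trans_le ha), _, hL b hb, rfl, ZFSet.isOrdinal_toZFSet b,
    finOrd_ordSet _ _, fun c hc => ?_, fun c hc t _ ht e => ?_, fun t ht hf hlt => ?_⟩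
  · obtain ⟨c, hcb, rfl⟩ := mem_toZFSet_iff.1 hc
    exact ⟨_, hL c (hcb.trans hb), pair_mem_enumGraph.2 ⟨hcb.trans hb, rfl⟩⟩
  · obtain ⟨c, hcb, rfl⟩ := mem_toZFSet_iff.1 hc
    have := (pair_mem_enumGraph.1 ht).2
    exact hcb.ne (enumFin_injective (ofColex.injective (ordSet_injective (this.symm.trans e))))
  · obtain ⟨F, rfl, -⟩ := hf.exists_eq hl ht
    obtain ⟨c, hc, e⟩ := (enumFin_spec b).2 _ (colexLT_ordSet.1 hlt)
    exact ⟨c.toZFSet, toZFSet_mem_toZFSet_iff.2 hc,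
      pair_mem_enumGraph.2 ⟨hc.trans hb, by rw [e, ofColex_toColex]⟩⟩

lemma insert_mem_limit {l : Ordinal.{u}} (hl : Order.IsSuccLimit l) {x s : ZFSet.{u}}
    (hx : x ∈ L l) (hs : s ∈ L l) : insert x s ∈ L l := by
  obtain ⟨a, ha, h⟩ := exists_level hl [x, s] (by simp [hx, hs])
  refine L_mono (hl.add_one_lt ha).le (sep_mem_L_add_one (P := fun _ _ v => v 0 = v 1 ∨ v 0 ∈ v 2)
    inferInstance [s] (h x (by simp)) (by simpa using h s (by simp)) fun z => ?_)
  rw [ZFSet.mem_insert_iff]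
  exact ⟨fun hz => ⟨hz.elim (fun e => e ▸ h x (by simp)) (L_trans (h s (by simp))), hz⟩, And.right⟩

lemma isSuccLimit_add_omega0 (a : Ordinal.{u}) : Order.IsSuccLimit (a + ω) :=
  isSuccLimit_add a isSuccLimit_omega0

lemma lt_add_omega0 (a : Ordinal.{u}) : a < a + ω := by
  simp

lemma add_omega0_le {a l : Ordinal.{u}} (hl : Order.IsSuccLimit l) (ha : a < l) : a + ω ≤ l := by
  refine le_of_forall_lt fun c hc => ?_
  obtain ⟨d, hd, hcd⟩ := (lt_add_iff_of_isSuccLimit isSuccLimit_omega0).1 hc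
  obtain ⟨n, rfl⟩ := lt_omega0.1 hd
  exact hcd.trans (add_nat_lt hl ha n)

/-- Sets built by transfinite recursion, adding one element at a time, appear quickly. -/
lemma mem_L_add_omega0_of_step {S t : Ordinal.{u} → ZFSet.{u}} (h0 : S 0 = ∅)
    (hs : ∀ a, S (a + 1) = insert (t a) (S a)) (ht : ∀ a, t a ∈ L (a + ω))
    (hlim : ∀ a, Order.IsSuccLimit a → (∀ b < a, S b ∈ L a) → S a ∈ L (a + ω))
    (a : Ordinal.{u}) : S a ∈ L (a + ω) := by
  induction a using Ordinal.limitRecOn with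
  | zero => rw [h0]; exact empty_mem_L (by simp)
  | add_one a ih =>
    rw [hs, add_assoc, one_add_omega0]
    exact insert_mem_limit (isSuccLimit_add_omega0 a) (ht a) ih
  | limit a ha ih =>
    exact hlim a ha fun b hb => L_mono (add_omega0_le ha hb) (ih b hb)

/-- At a limit `a` the graph is defined over `L a` as the union of the approximations lying in `L
a`; a successor step inserts one pair, and the finitely many levels this costs are absorbed by `ω`.
-/
lemma enumGraph_mem_L (a : Ordinal.{u}) : enumGraph a ∈ L (a + ω) := by
  refine mem_L_add_omega0_of_step
    (t := fun b => ZFSet.pair b.toZFSet (ordSet (ofColex (enumFin b)))) ?_ (fun a => ?_)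
    (fun a => ?_) (fun a ha ih => ?_) a
  · ext z
    simp [mem_enumGraph]
  · ext z
    rw [ZFSet.mem_insert_iff, mem_enumGraph, mem_enumGraph]
    simp only [Order.lt_add_one_iff, le_iff_lt_or_eq]
    constructor
    · rintro ⟨b, hb | rfl, rfl⟩
      · exact .inr ⟨b, hb, rfl⟩
      · exact .inl rfl
    · rintro (rfl | ⟨b, hb, rfl⟩)
      · exact ⟨a, .inr rfl, rfl⟩
      · exact ⟨b, .inl hb, rfl⟩
  · have hl := isSuccLimit_add_omega0 a
    have ha := lt_add_omega0 a
    exact pair_mem_limit hl (toZFSet_mem_L.2 ha)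
      (L_mono (hl.add_one_lt (hl.add_one_lt ha)).le (ordSet_enumFin_mem_L a))
  · refine L_mono ((isSuccLimit_add_omega0 a).add_one_lt (lt_add_omega0 a)).le
      (sep_mem_L_add_one (P := fun x _ v => ∃ g ∈ x, v 0 ∈ g ∧ EnumApprox x g) inferInstance []
        (p := ∅) (empty_mem_L ha.bot_lt) (by simp) fun z => ?_)
    change z ∈ enumGraph a ↔ z ∈ L a ∧ ∃ g ∈ L a, z ∈ g ∧ EnumApprox (L a) g
    constructor
    · intro hz
      obtain ⟨b, hb, rfl⟩ := mem_enumGraph.1 hz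
      have hg := ih (b + 1) (ha.add_one_lt hb)
      have hzg : ZFSet.pair b.toZFSet (ordSet (ofColex (enumFin b))) ∈ enumGraph (b + 1) :=
        pair_mem_enumGraph.2 ⟨lt_add_one b, rfl⟩
      exact ⟨L_trans hg hzg, _, hg, hzg, enumApprox_enumGraph ha (ha.add_one_lt hb).le⟩
    · rintro ⟨-, g, hg, hz, happ⟩
      obtain ⟨c, hc, s, -, rfl, hco, -⟩ := happ z hz
      rw [← hco.toZFSet_rank_eq] at hz ⊢
      exact pair_mem_enumGraph.2 (happ.eq_enumFin ha hg _ s hz)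

lemma exists_inverse {l : Ordinal.{u}} (hl : Order.IsSuccLimit l) {G : ZFSet.{u}} (hG : G ∈ L l) :
    ∃ R ∈ L l, ∀ x y, ZFSet.pair y x ∈ R ↔ ZFSet.pair x y ∈ G := by
  obtain ⟨d, hd, hps⟩ := exists_level hl [G] (by simp [hG])
  obtain ⟨R, hR, h⟩ := exists_sep hl (fun v => ∃ x ∈ v 1, ∃ y ∈ v 1, v 0 = ZFSet.pair y x ∧
    ZFSet.pair x y ∈ v 2) (t := L (d + 2)) (L_mem_L.2 (add_nat_lt hl hd 2)) [L d, G]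
    (by simp [hG, L_mem_L.2 hd])
  replace h : ∀ p, p ∈ R ↔ p ∈ L (d + 2) ∧ ∃ x ∈ L d, ∃ y ∈ L d, p = ZFSet.pair y x ∧
    ZFSet.pair x y ∈ G := h
  refine ⟨R, hR, fun x y => ?_⟩
  rw [h]
  constructor
  · rintro ⟨-, x', -, y', -, e, hG⟩
    rw [ZFSet.pair_inj] at e
    rwa [e.1, e.2]
  · intro hxy
    have := mem_of_pair_mem_L (L_trans (hps G (by simp)) hxy)
    exact ⟨pair_mem_L this.2 this.1, x, this.1, y, this.2, rfl, hxy⟩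

/-- An infinite ordinal can be mapped onto its finite subsets. -/
lemma onto_finSubsets {l : Ordinal.{u}} (hl : Order.IsSuccLimit l) (a : Ordinal.{u}) (ha : ω ≤ a)
    (hal : a < l) : Onto l a (finSubsets a.toZFSet) := by
  induction a using WellFoundedLT.induction with
  | ind a ih =>
    -- If a smaller infinite `b` already maps onto `a`, the induction hypothesis for `b` is carried
    -- over by taking images of finite sets.
    by_cases hc : ∃ b, ω ≤ b ∧ b < a ∧ Onto l b (a.toZFSet : Set ZFSet.{u})
    · obtain ⟨b, hb, hba, hon⟩ := hc
      exact (Onto.fin hl (ih b hba hb (hba.trans hal)) hon).mono hba.le le_rfl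
    have hG : enumGraph a ∈ L l := L_mono (add_omega0_le hl hal) (enumGraph_mem_L a)
    -- Either the first `a` values of the enumeration exhaust the finite subsets of `a`, or some `s`
    -- is missed and all those values lie colexicographically below `s`.
    by_cases hcov : ∀ s : Finset Ordinal.{u}, (∀ b ∈ s, b < a) → ∃ b < a, enumFin b = toColex s
    · refine ⟨enumGraph a, hG, fun x y y' h h' => ?_, fun t ht => ?_⟩
      · obtain ⟨b, -, e⟩ := mem_enumGraph.1 h
        obtain ⟨b', -, e'⟩ := mem_enumGraph.1 h'
        rw [ZFSet.pair_inj] at e e'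
        have := toZFSet_injective (e.1.symm.trans e'.1)
        rw [e.2, e'.2, this]
      · obtain ⟨s, rfl, hs⟩ := exists_eq_ordSet ht.1 ht.2
        obtain ⟨b, hb, e⟩ := hcov s hs
        exact ⟨b, hb, pair_mem_enumGraph.2 ⟨hb, by rw [e, ofColex_toColex]⟩⟩
    push Not at hcov
    obtain ⟨s, hs, hne⟩ := hcov
    have hle : ∀ b < a, enumFin b ≤ toColex s := by
      intro b hb
      by_contra h
      obtain ⟨c, hcb, e⟩ := (enumFin_spec b).2 _ (not_le.1 h)
      exact hne c (hcb.trans hb) e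
    -- Were `a = d + 1`, the infinite ordinal `d` would map onto `a` by `Onto.insert`, against `hc`.
    have hlim : ∀ d < a, d + 1 < a := by
      intro d hd
      refine lt_of_le_of_ne (Order.add_one_le_of_lt hd) ?_
      rintro rfl
      have hωd : ω ≤ d := by
        by_contra h
        exact not_lt_of_ge ha (isSuccLimit_omega0.add_one_lt (not_le.1 h))
      have hdl := hd.trans hal
      refine hc ⟨d, hωd, hd, ?_⟩
      rw [toZFSet_add_one, ZFSet.coe_insert]
      exact Onto.insert hl (ih d hd hωd hdl) (Onto.self hl hdl) (toZFSet_mem_L.2 hdl)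
    have hbd : ∃ d < a, ∀ b < a, ∀ c ∈ ofColex (enumFin b), c < d := by
      rcases s.eq_empty_or_nonempty with rfl | hsn
      · refine ⟨0, omega0_pos.trans_le ha, fun b hb c hcm => ?_⟩
        have : enumFin b = ⊥ := le_bot_iff.1 (hle b hb)
        rw [this] at hcm
        simp at hcm
      · refine ⟨s.max' hsn + 1, hlim _ (hs _ (s.max'_mem hsn)), fun b hb c hcm => ?_⟩
        exact Order.lt_add_one_iff.2
          (Finset.Colex.forall_le_mono (s := ofColex (enumFin b)) (hle b hb) (s.le_max') c hcm)
    obtain ⟨d, hda, hd⟩ := hbd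
    rcases ha.lt_or_eq with hωa | rfl
    · exfalso
      -- The first `a` values are distinct finite subsets of `d`, so the inverse of the enumeration,
      -- after a map from `max d ω` onto its own finite subsets, covers `a`, against `hc`.
      have hma : max d ω < a := max_lt hda hωa
      refine hc ⟨max d ω, le_max_right _ _, hma, ?_⟩
      have hml := hma.trans hal
      obtain ⟨R, hR, h⟩ := exists_inverse hl hG
      refine Onto.comp hl (ih _ hma (le_max_right _ _) hml) hR (fun y x x' hx hx' => ?_)
        fun c hc => ?_
      · obtain ⟨b, -, e⟩ := mem_enumGraph.1 ((h _ _).1 hx)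
        obtain ⟨b', -, e'⟩ := mem_enumGraph.1 ((h _ _).1 hx')
        rw [ZFSet.pair_inj] at e e'
        have := enumFin_injective (ofColex.injective (ordSet_injective (e.2.symm.trans e'.2)))
        rw [e.1, e'.1, this]
      · obtain ⟨b, hb, rfl⟩ := mem_toZFSet_iff.1 hc
        refine ⟨_, ⟨finite_ordSet _, fun z hz => ?_⟩, (h _ _).2 (pair_mem_enumGraph.2 ⟨hb, rfl⟩)⟩
        obtain ⟨k, hk, rfl⟩ := mem_ordSet.1 hz
        exact toZFSet_mem_toZFSet_iff.2 ((hd b hb k hk).trans_le (le_max_left _ _))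
    · exfalso
      -- Here `a = ω`, and infinitely many distinct sets would be subsets of the finite set `n`.
      obtain ⟨n, rfl⟩ := lt_omega0.1 hda
      have hfin : (Set.Iio (n : Ordinal.{u})).Finite := by
        refine ((Set.finite_lt_nat n).image fun k : ℕ => (k : Ordinal.{u})).subset fun c hc => ?_
        obtain ⟨k, rfl⟩ := lt_omega0.1 ((show c < n from hc).trans (natCast_lt_omega0 n))
        exact ⟨k, Nat.cast_lt.1 (show (k : Ordinal.{u}) < n from hc), rfl⟩
      refine Set.infinite_range_of_injective
        (enumFin_injective.comp (Nat.cast_injective (R := Ordinal.{u})))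
        ((hfin.toFinset.powerset.finite_toSet.image toColex).subset ?_)
      rintro _ ⟨k, rfl⟩
      refine ⟨ofColex (enumFin k), ?_, toColex_ofColex _⟩
      rw [Finset.mem_coe, Finset.mem_powerset]
      intro c hc
      simpa using hd k (natCast_lt_omega0 k) c hc

/-! ### Natural numbers as sets and a coding of formulas -/

/-- The natural number `n` as a set. -/
noncomputable def nat (n : ℕ) : ZFSet.{u} := (n : Ordinal.{u}).toZFSet

/-- The set of natural numbers. -/
noncomputable def om : ZFSet.{u} := (ω : Ordinal.{u}).toZFSet

lemma nat_mem_nat {m n : ℕ} : nat.{u} m ∈ nat.{u} n ↔ m < n := by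
  rw [nat, nat, toZFSet_mem_toZFSet_iff, Nat.cast_lt]

lemma nat_injective : Function.Injective nat.{u} := fun m n h => by
  have := toZFSet_injective h
  exact_mod_cast this

@[simp] lemma nat_inj {m n : ℕ} : nat.{u} m = nat.{u} n ↔ m = n := nat_injective.eq_iff

@[simp] lemma nat_zero : nat.{u} 0 = ∅ := by simp [nat]

lemma nat_succ (n : ℕ) : nat.{u} (n + 1) = insert (nat n) (nat n) := by
  rw [nat, Nat.cast_succ, toZFSet_add_one, nat]

lemma mem_om {z : ZFSet.{u}} : z ∈ om.{u} ↔ ∃ n : ℕ, z = nat n := by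
  rw [om, mem_toZFSet_iff]
  constructor
  · rintro ⟨a, ha, rfl⟩
    obtain ⟨n, rfl⟩ := lt_omega0.1 ha
    exact ⟨n, rfl⟩
  · rintro ⟨n, rfl⟩
    exact ⟨n, natCast_lt_omega0 n, rfl⟩

lemma nat_mem_om (n : ℕ) : nat.{u} n ∈ om.{u} := mem_om.2 ⟨n, rfl⟩

lemma mem_nat {z : ZFSet.{u}} {n : ℕ} : z ∈ nat.{u} n ↔ ∃ m < n, z = nat m := by
  constructor
  · intro h
    obtain ⟨a, ha, rfl⟩ := mem_toZFSet_iff.1 h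
    obtain ⟨m, rfl⟩ := lt_omega0.1 (ha.trans (natCast_lt_omega0 n))
    exact ⟨m, by exact_mod_cast ha, rfl⟩
  · rintro ⟨m, hm, rfl⟩
    exact nat_mem_nat.2 hm

lemma nat_mem_L {a : Ordinal.{u}} (ha : ω ≤ a) (n : ℕ) : nat.{u} n ∈ L a :=
  toZFSet_mem_L.2 ((natCast_lt_omega0 n).trans_le ha)

lemma om_mem_L {a : Ordinal.{u}} : om.{u} ∈ L a ↔ ω < a := toZFSet_mem_L

instance UDfn.eq_nat {i n : ℕ} : UDfn.{u} fun _ _ v => v i = nat n := by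
  induction n generalizing i with
  | zero => simpa using UDfn.eq_empty
  | succ n ih =>
    refine UDfn.congr (P := fun _ _ v => ∃ z ∈ v i, z = nat n ∧ v i = insert z z) inferInstance
      fun _ _ _ v _ => ?_
    rw [nat_succ]
    constructor
    · rintro ⟨z, -, rfl, h⟩
      exact h
    · intro h
      exact ⟨nat n, by rw [h]; simp, rfl, h⟩

instance UDfn.pair_pair_mem {i j k m : ℕ} :
    UDfn.{u} fun _ _ v => ZFSet.pair (v i) (ZFSet.pair (v j) (v k)) ∈ v m :=
  UDfn.congr (P := fun x _ v => ∃ q ∈ x, q = ZFSet.pair (v j) (v k) ∧ ZFSet.pair (v i) q ∈ v m)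
    inferInstance fun x hx _ v hv => by
      constructor
      · rintro ⟨q, -, rfl, h⟩
        exact h
      · intro h
        have h1 := hx _ (hx _ (hv m) h) (ZFSet.mem_pair.2 (.inr rfl) :
          {v i, ZFSet.pair (v j) (v k)} ∈ ZFSet.pair (v i) (ZFSet.pair (v j) (v k)))
        exact ⟨_, hx _ h1 (ZFSet.mem_pair.2 (.inr rfl)), rfl, h⟩

/-- Kuratowski pairs of naturals are finite sets of finite sets of naturals, so two applications of
`Onto.fin` to the identity on `ω` cover them. Numbers whose value is not such a pair are sent to
`(0, 0)` to make the function total. -/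
lemma exists_unpairing : ∃ f : ℕ → ℕ × ℕ, Function.Surjective f ∧ ∃ R ∈ L.{u} (ω + ω),
    ∀ z, z ∈ R ↔ ∃ n, z = ZFSet.pair (nat n) (ZFSet.pair (nat (f n).1) (nat (f n).2)) := by
  have hl := isSuccLimit_add_omega0 ω
  have hω : ω < ω + ω := lt_add_omega0 ω
  have h1 := onto_finSubsets hl ω le_rfl hω
  have h2 := Onto.fin hl h1 (Onto.fin hl h1 (Onto.self hl hω))
  obtain ⟨G, hG, hf, hc⟩ := h2
  have hcov : ∀ i j : ℕ, ∃ n : ℕ, ZFSet.pair (nat n) (ZFSet.pair (nat i) (nat j)) ∈ G := by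
    intro i j
    obtain ⟨b, hb, h⟩ := hc _ (pair_mem_finSubsets (nat_mem_om i) (nat_mem_om j))
    obtain ⟨n, rfl⟩ := lt_omega0.1 hb
    exact ⟨n, h⟩
  classical
  let f : ℕ → ℕ × ℕ := fun n =>
    if h : ∃ q : ℕ × ℕ, ZFSet.pair (nat n) (ZFSet.pair (nat q.1) (nat q.2)) ∈ G
    then h.choose else (0, 0)
  have hf1 : ∀ n i j, ZFSet.pair (nat n) (ZFSet.pair (nat i) (nat j)) ∈ G → f n = (i, j) := by
    intro n i j h
    have h' : ∃ q : ℕ × ℕ, ZFSet.pair (nat n) (ZFSet.pair (nat q.1) (nat q.2)) ∈ G := ⟨(i, j), h⟩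
    have e : f n = h'.choose := dif_pos h'
    have := hf _ _ _ h h'.choose_spec
    rw [ZFSet.pair_inj, nat_inj, nat_inj] at this
    rw [e]
    exact Prod.ext this.1.symm this.2.symm
  have hf2 : ∀ n, (∀ i j, ZFSet.pair (nat n) (ZFSet.pair (nat i) (nat j)) ∉ G) → f n = (0, 0) :=
    fun n h => dif_neg fun ⟨q, hq⟩ => h _ _ hq
  obtain ⟨R, hR, h⟩ := exists_sep hl (fun v => ∃ n ∈ v 1, ∃ i ∈ v 1, ∃ j ∈ v 1, ∃ q ∈ v 2,
      q = ZFSet.pair i j ∧ v 0 = ZFSet.pair n q ∧ (ZFSet.pair n (ZFSet.pair i j) ∈ v 3 ∨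
      (i = ∅ ∧ j = ∅ ∧ ∀ i' ∈ v 1, ∀ j' ∈ v 1, ZFSet.pair n (ZFSet.pair i' j') ∉ v 3)))
    (t := L ω) (L_mem_L.2 hω) [om, L ω, G] (by simp [hG, L_mem_L, om_mem_L])
  replace h : ∀ p, p ∈ R ↔ p ∈ L ω ∧ ∃ n ∈ om, ∃ i ∈ om, ∃ j ∈ om, ∃ q ∈ L ω, q = ZFSet.pair i j ∧
      p = ZFSet.pair n q ∧ (ZFSet.pair n (ZFSet.pair i j) ∈ G ∨ (i = ∅ ∧ j = ∅ ∧
        ∀ i' ∈ om, ∀ j' ∈ om, ZFSet.pair n (ZFSet.pair i' j') ∉ G)) := h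
  refine ⟨f, fun ⟨i, j⟩ => ?_, R, hR, fun z => ?_⟩
  · obtain ⟨n, hn⟩ := hcov i j
    exact ⟨n, hf1 n i j hn⟩
  · rw [h]
    constructor
    · rintro ⟨-, n, hn, i, hi, j, hj, q, -, rfl, rfl, hor⟩
      obtain ⟨n, rfl⟩ := mem_om.1 hn
      obtain ⟨i, rfl⟩ := mem_om.1 hi
      obtain ⟨j, rfl⟩ := mem_om.1 hj
      refine ⟨n, ?_⟩
      rcases hor with hor | ⟨hi0, hj0, hor⟩
      · rw [hf1 n i j hor]
      · rw [hf2 n fun i j => hor _ (nat_mem_om i) _ (nat_mem_om j), hi0, hj0, nat_zero]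
    · rintro ⟨n, rfl⟩
      have hp : ∀ i j : ℕ, ZFSet.pair (nat.{u} i) (nat j) ∈ L ω := fun i j =>
        pair_mem_limit isSuccLimit_omega0 (nat_mem_L le_rfl i) (nat_mem_L le_rfl j)
      refine ⟨pair_mem_limit isSuccLimit_omega0 (nat_mem_L le_rfl n) (hp _ _), nat n,
        nat_mem_om n, _, nat_mem_om _, _, nat_mem_om _, _, hp _ _, rfl, rfl, ?_⟩
      by_cases hex : ∃ q : ℕ × ℕ, ZFSet.pair (nat n) (ZFSet.pair (nat q.1) (nat q.2)) ∈ G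
      · obtain ⟨⟨i, j⟩, hq⟩ := hex
        rw [hf1 n i j hq]
        exact .inl hq
      · rw [hf2 n fun i j hij => hex ⟨(i, j), hij⟩]
        refine .inr ⟨nat_zero, nat_zero, fun i hi j hj => ?_⟩
        obtain ⟨i, rfl⟩ := mem_om.1 hi
        obtain ⟨j, rfl⟩ := mem_om.1 hj
        exact fun hij => hex ⟨(i, j), hij⟩

/-- A surjection of the natural numbers onto pairs, the graph of which is in `L (ω + ω)`. -/
noncomputable def unpair : ℕ → ℕ × ℕ := exists_unpairing.{u}.choose

lemma unpair_surjective : Function.Surjective unpair.{u} := exists_unpairing.{u}.choose_spec.1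

/-- The graph of `unpair`. -/
noncomputable def unpairGraph : ZFSet.{u} := exists_unpairing.{u}.choose_spec.2.choose

lemma unpairGraph_mem_L : unpairGraph.{u} ∈ L (ω + ω) :=
  exists_unpairing.{u}.choose_spec.2.choose_spec.1

lemma mem_unpairGraph {n i j : ℕ} :
    ZFSet.pair (nat n) (ZFSet.pair (nat i) (nat j)) ∈ unpairGraph.{u} ↔ unpair.{u} n = (i, j) := by
  refine (exists_unpairing.{u}.choose_spec.2.choose_spec.2 _).trans ?_
  change (∃ m, _ = ZFSet.pair (nat m) (ZFSet.pair (nat (unpair.{u} m).1) (nat (unpair.{u} m).2))) ↔ _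
  simp only [ZFSet.pair_inj, nat_inj]
  constructor
  · rintro ⟨m, rfl, rfl, rfl⟩
    rfl
  · intro h
    exact ⟨n, rfl, by rw [h], by rw [h]⟩

/-- The formula with code `n`. -/
noncomputable def decode (n : ℕ) : Fm :=
  if (unpair.{u} n).1 = 0 then
    if (unpair.{u} (unpair.{u} (unpair.{u} n).2).2).2 = 0 then
      .mem (unpair.{u} (unpair.{u} n).2).1 (unpair.{u} (unpair.{u} (unpair.{u} n).2).2).1
    else .lev (unpair.{u} (unpair.{u} n).2).1
  else if (unpair.{u} n).1 = 1 then
    .nand (if (unpair.{u} (unpair.{u} n).2).1 < n then decode (unpair.{u} (unpair.{u} n).2).1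
        else .mem 0 0)
      (if (unpair.{u} (unpair.{u} (unpair.{u} n).2).2).1 < n then
        decode (unpair.{u} (unpair.{u} (unpair.{u} n).2).2).1 else .mem 0 0)
  else .ex (if (unpair.{u} (unpair.{u} n).2).1 < n then decode (unpair.{u} (unpair.{u} n).2).1
    else .mem 0 0)
termination_by n

/-- The subformula with code `i` of the formula with code `n`. -/
noncomputable def decodeSub (n i : ℕ) : Fm := if i < n then decode.{u} i else .mem 0 0

lemma decode_eq {n op m i m' j k : ℕ} (h1 : unpair.{u} n = (op, m)) (h2 : unpair.{u} m = (i, m'))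
    (h3 : unpair.{u} m' = (j, k)) : decode.{u} n =
      if op = 0 then if k = 0 then .mem i j else .lev i
      else if op = 1 then .nand (decodeSub.{u} n i) (decodeSub.{u} n j)
      else .ex (decodeSub.{u} n i) := by
  rw [decode]
  simp only [h1, h2, h3, decodeSub]

lemma exists_unpair_eq (op i j k : ℕ) : ∃ n m m', unpair.{u} n = (op, m) ∧
    unpair.{u} m = (i, m') ∧ unpair.{u} m' = (j, k) := by
  obtain ⟨m', h3⟩ := unpair_surjective.{u} (j, k)
  obtain ⟨m, h2⟩ := unpair_surjective.{u} (i, m')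
  obtain ⟨n, h1⟩ := unpair_surjective.{u} (op, m)
  exact ⟨n, m, m', h1, h2, h3⟩

/-- The component `k` is free, so there are infinitely many codes with the prescribed other
components; one exceeds `N`, as needed for a compound formula to have a larger code than its parts.
-/
lemma exists_unpair_eq_gt (op i j N : ℕ) : ∃ n m m' k, N < n ∧ unpair.{u} n = (op, m) ∧
    unpair.{u} m = (i, m') ∧ unpair.{u} m' = (j, k) := by
  choose n m m' h1 h2 h3 using exists_unpair_eq.{u} op i j
  have hinj : Function.Injective n := by
    intro k k' h
    have e1 := (h1 k).symm.trans ((congrArg _ h).trans (h1 k'))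
    have e2 : m k = m k' := (Prod.ext_iff.1 e1).2
    have e3 : m' k = m' k' := (Prod.ext_iff.1 ((h2 k).symm.trans ((congrArg _ e2).trans (h2 k')))).2
    exact (Prod.ext_iff.1 ((h3 k).symm.trans ((congrArg _ e3).trans (h3 k')))).2
  obtain ⟨_, ⟨k, rfl⟩, hk⟩ := (Set.infinite_range_of_injective hinj).exists_gt N
  exact ⟨n k, m k, m' k, k, hk, h1 k, h2 k, h3 k⟩

lemma decode_surjective : Function.Surjective decode.{u} := by
  intro φ
  induction φ with
  | mem i j =>
    obtain ⟨n, m, m', h1, h2, h3⟩ := exists_unpair_eq.{u} 0 i j 0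
    exact ⟨n, by rw [decode_eq h1 h2 h3]; simp⟩
  | lev i =>
    obtain ⟨n, m, m', h1, h2, h3⟩ := exists_unpair_eq.{u} 0 i 0 1
    exact ⟨n, by rw [decode_eq h1 h2 h3]; simp⟩
  | nand φ ψ h h' =>
    obtain ⟨i, rfl⟩ := h
    obtain ⟨j, rfl⟩ := h'
    obtain ⟨n, m, m', k, hn, h1, h2, h3⟩ := exists_unpair_eq_gt.{u} 1 i j (max i j)
    refine ⟨n, ?_⟩
    rw [decode_eq h1 h2 h3]
    simp [decodeSub, (le_max_left i j).trans_lt hn, (le_max_right i j).trans_lt hn]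
  | ex φ h =>
    obtain ⟨i, rfl⟩ := h
    obtain ⟨n, m, m', k, hn, h1, h2, h3⟩ := exists_unpair_eq_gt.{u} 2 i 0 i
    refine ⟨n, ?_⟩
    rw [decode_eq h1 h2 h3]
    simp [decodeSub, hn]

/-- The default `.mem 0 0` is false by regularity, which matches the conjunct `i ∈ n` of `SatAt`. -/
lemma sat_decodeSub {x : ZFSet.{u}} {U : ZFSet.{u} → Prop} {n i : ℕ} {v : ℕ → ZFSet.{u}} :
    Sat x U (decodeSub.{u} n i) v ↔ i < n ∧ Sat x U (decode.{u} i) v := by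
  unfold decodeSub
  split_ifs with h
  · simp [h]
  · simp [h, Sat, ZFSet.mem_irrefl]

/-! ### Assignments as sets -/

/-- An assignment that is empty almost everywhere. -/
def FinSupp (v : ℕ → ZFSet.{u}) : Prop := ∃ N, ∀ i, N ≤ i → v i = ∅

lemma FinSupp.scons {v : ℕ → ZFSet.{u}} (hv : FinSupp v) (a : ZFSet.{u}) : FinSupp (scons a v) := by
  obtain ⟨N, hN⟩ := hv
  refine ⟨N + 1, fun i hi => ?_⟩
  cases i with
  | zero => omega
  | succ i => exact hN i (by omega)

/-- The set coding an assignment. -/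
noncomputable def asg (v : ℕ → ZFSet.{u}) : ZFSet.{u} :=
  (ZFSet.range fun i : ℕ => ZFSet.pair (nat i) (v i)).sep
    fun p => ∃ i, v i ≠ ∅ ∧ p = ZFSet.pair (nat i) (v i)

lemma mem_asg {v : ℕ → ZFSet.{u}} {p : ZFSet.{u}} :
    p ∈ asg v ↔ ∃ i, v i ≠ ∅ ∧ p = ZFSet.pair (nat i) (v i) := by
  rw [asg, ZFSet.mem_sep, ZFSet.mem_range]
  exact ⟨And.right, fun h => ⟨let ⟨i, _, e⟩ := h; ⟨i, e.symm⟩, h⟩⟩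

lemma pair_mem_asg {v : ℕ → ZFSet.{u}} {i : ℕ} {a : ZFSet.{u}} :
    ZFSet.pair (nat i) a ∈ asg v ↔ a ≠ ∅ ∧ v i = a := by
  rw [mem_asg]
  simp only [ZFSet.pair_inj, nat_inj]
  constructor
  · rintro ⟨j, hj, rfl, rfl⟩
    exact ⟨hj, rfl⟩
  · rintro ⟨ha, rfl⟩
    exact ⟨i, ha, rfl, rfl⟩

/-- Since empty values are left out of `asg v`, finite support makes it a finite set of pairs, and
the pairs lie in `L (a + 2)`. -/
lemma asg_mem_L {a : Ordinal.{u}} (ha : ω ≤ a) {v : ℕ → ZFSet.{u}} (hv : FinSupp v)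
    (h : ∀ i, v i ∈ L a) : asg v ∈ L (a + 3) := by
  have e : a + 3 = a + 2 + 1 := by
    rw [add_assoc]
    congr 1
  rw [e]
  obtain ⟨N, hN⟩ := hv
  refine finite_mem_L (((Set.finite_lt_nat N).image fun i => ZFSet.pair (nat i) (v i)).subset
    fun p hp => ?_) fun p hp => ?_
  · obtain ⟨i, hi, rfl⟩ := mem_asg.1 hp
    exact ⟨i, not_le.1 fun h => hi (hN i h), rfl⟩
  · obtain ⟨i, hi, rfl⟩ := mem_asg.1 hp
    exact pair_mem_L (nat_mem_L ha i) (h i)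

/-- `s` codes an assignment with values in `x`; here `o` is the set of natural numbers. -/
def AsgOf (o x s : ZFSet.{u}) : Prop :=
  ∃ n ∈ o, (∀ p ∈ s, ∃ i ∈ n, ∃ a ∈ x, p = ZFSet.pair i a ∧ a ≠ ∅) ∧
    ∀ i ∈ n, ∀ a ∈ x, ∀ b ∈ x, ZFSet.pair i a ∈ s → ZFSet.pair i b ∈ s → a = b

instance UDfn.asgOf {i j k : ℕ} : UDfn.{u} fun _ _ v => AsgOf (v i) (v j) (v k) := by
  unfold AsgOf
  infer_instance

/-- The assignment coded by `s` takes the value `a` at `i`. -/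
def Get (x s i a : ZFSet.{u}) : Prop :=
  ZFSet.pair i a ∈ s ∨ (a = ∅ ∧ ∀ b ∈ x, ZFSet.pair i b ∉ s)

instance UDfn.get {i j k m : ℕ} : UDfn.{u} fun _ _ v => Get (v i) (v j) (v k) (v m) := by
  unfold Get
  infer_instance

/-- `s'` codes the assignment coded by `s`, with `a` put in front. -/
def ConsOf (o x s' a s : ZFSet.{u}) : Prop :=
  AsgOf o x s' ∧ (∃ z ∈ o, z = ∅ ∧ Get x s' z a) ∧
    ∀ i ∈ o, ∀ j ∈ o, j = insert i i → ∀ b ∈ x, (Get x s' j b ↔ Get x s i b)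

instance UDfn.consOf {i j k m n : ℕ} :
    UDfn.{u} fun _ _ v => ConsOf (v i) (v j) (v k) (v m) (v n) := by
  unfold ConsOf
  infer_instance

section

variable {x : ZFSet.{u}} (hx : ∅ ∈ x)

include hx

lemma asgOf_iff {s : ZFSet.{u}} :
    AsgOf om x s ↔ ∃ v : ℕ → ZFSet.{u}, (∀ i, v i ∈ x) ∧ FinSupp v ∧ s = asg v := by
  constructor
  · rintro ⟨n, hn, h1, h2⟩
    obtain ⟨n, rfl⟩ := mem_om.1 hn
    classical
    let v : ℕ → ZFSet.{u} := fun i =>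
      if h : ∃ a ∈ x, ZFSet.pair (nat i) a ∈ s then h.choose else ∅
    have hv1 : ∀ i a, ZFSet.pair (nat i) a ∈ s → a ≠ ∅ ∧ v i = a := by
      intro i a ha
      obtain ⟨i', hi', a', ha', e, hne⟩ := h1 _ ha
      rw [ZFSet.pair_inj] at e
      obtain ⟨rfl, rfl⟩ := e
      have h : ∃ a ∈ x, ZFSet.pair (nat i) a ∈ s := ⟨a, ha', ha⟩
      have e : v i = h.choose := dif_pos h
      rw [e]
      exact ⟨hne, h2 _ hi' _ h.choose_spec.1 _ ha' h.choose_spec.2 ha⟩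
    refine ⟨v, fun i => ?_, ⟨n, fun i hi => ?_⟩, ?_⟩
    · by_cases h : ∃ a ∈ x, ZFSet.pair (nat i) a ∈ s
      · have e : v i = h.choose := dif_pos h
        rw [e]
        exact h.choose_spec.1
      · have e : v i = ∅ := dif_neg h
        rwa [e]
    · refine dif_neg ?_
      rintro ⟨a, ha, has⟩
      obtain ⟨i', hi', a', ha', e, hne⟩ := h1 _ has
      rw [ZFSet.pair_inj] at e
      rw [← e.1, nat_mem_nat] at hi'
      omega
    · ext p
      rw [mem_asg]
      constructor
      · intro hp
        obtain ⟨i, hi, a, ha, rfl, hne⟩ := h1 p hp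
        obtain ⟨i, -, rfl⟩ := mem_nat.1 hi
        exact ⟨i, by rw [(hv1 i a hp).2]; exact hne, by rw [(hv1 i a hp).2]⟩
      · rintro ⟨i, hi, rfl⟩
        by_cases h : ∃ a ∈ x, ZFSet.pair (nat i) a ∈ s
        · have e : v i = h.choose := dif_pos h
          rw [e]
          exact h.choose_spec.2
        · exact (hi (dif_neg h)).elim
  · rintro ⟨v, hv, ⟨N, hN⟩, rfl⟩
    refine ⟨nat N, nat_mem_om N, fun p hp => ?_, fun i hi a _ b _ h h' => ?_⟩
    · obtain ⟨i, hi, rfl⟩ := mem_asg.1 hp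
      exact ⟨nat i, nat_mem_nat.2 (not_le.1 fun h => hi (hN i h)), v i, hv i, rfl, hi⟩
    · obtain ⟨i, -, rfl⟩ := mem_nat.1 hi
      exact (pair_mem_asg.1 h).2.symm.trans (pair_mem_asg.1 h').2

omit hx in
lemma get_asg {v : ℕ → ZFSet.{u}} (hv : ∀ i, v i ∈ x) {i : ℕ} {a : ZFSet.{u}} :
    Get x (asg v) (nat i) a ↔ v i = a := by
  rw [Get]
  simp only [pair_mem_asg, not_and]
  constructor
  · rintro (h | ⟨rfl, h⟩)
    · exact h.2
    · by_contra hne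
      exact h (v i) (hv i) hne rfl
  · rintro rfl
    by_cases h : v i = ∅
    · exact .inr ⟨h, fun b _ hb => h ▸ Ne.symm hb⟩
    · exact .inl ⟨h, rfl⟩

omit hx in
lemma asg_injective {v w : ℕ → ZFSet.{u}} (hv : ∀ i, v i ∈ x) (hw : ∀ i, w i ∈ x)
    (h : asg v = asg w) : v = w := by
  funext k
  have := (get_asg hv (i := k)).2 rfl
  rw [h, get_asg hw] at this
  exact this.symm

lemma consOf_asg {v w : ℕ → ZFSet.{u}} {a : ZFSet.{u}} (hv : ∀ i, v i ∈ x) (hw : ∀ i, w i ∈ x)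
    (hws : FinSupp w) : ConsOf om x (asg w) a (asg v) ↔ w = scons a v := by
  constructor
  · rintro ⟨-, ⟨z, -, rfl, h0⟩, h⟩
    rw [← nat_zero, get_asg hw] at h0
    funext i
    cases i with
    | zero => exact h0
    | succ i =>
      have := h _ (nat_mem_om i) _ (nat_mem_om (i + 1)) (nat_succ i) (v i) (hv i)
      rw [get_asg hw, get_asg hv] at this
      exact this.2 rfl
  · rintro rfl
    refine ⟨(asgOf_iff hx).2 ⟨_, hw, hws, rfl⟩, ⟨nat 0, nat_mem_om 0, nat_zero, ?_⟩, ?_⟩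
    · rw [get_asg hw, scons_zero]
    · intro i hi j hj e b _
      obtain ⟨i, rfl⟩ := mem_om.1 hi
      rw [e, ← nat_succ, get_asg hw, get_asg hv, scons_succ]

end

/-! ### Satisfaction, defined inside a level -/

/-- `op = {∅}`. -/
def IsOne (op : ZFSet.{u}) : Prop := op ≠ ∅ ∧ ∀ z ∈ op, z = ∅

instance UDfn.isOne {i : ℕ} : UDfn.{u} fun _ _ v => IsOne (v i) := by
  unfold IsOne
  infer_instance

lemma isOne_nat {n : ℕ} : IsOne (nat.{u} n) ↔ n = 1 := by
  constructor
  · rintro ⟨h0, h⟩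
    have h0 : n ≠ 0 := fun e => h0 (e ▸ nat_zero)
    by_contra h1
    have := h (nat 1) (nat_mem_nat.2 (by omega))
    rw [← nat_zero, nat_inj] at this
    omega
  · rintro rfl
    refine ⟨fun h => ?_, fun z hz => ?_⟩
    · rw [← nat_zero, nat_inj] at h
      omega
    · obtain ⟨m, hm, rfl⟩ := mem_nat.1 hz
      rw [Nat.lt_one_iff.1 hm, nat_zero]

lemma nat_eq_empty {n : ℕ} : nat.{u} n = ∅ ↔ n = 0 := by
  rw [← nat_zero, nat_inj]

/-- According to `g`, the assignment `s` satisfies the formula with code `i`, and `i ∈ n`. -/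
def SatAt (W g n i s : ZFSet.{u}) : Prop := i ∈ n ∧ ∃ C ∈ W, ZFSet.pair i C ∈ g ∧ s ∈ C

instance UDfn.satAt {i j k m : ℕ} : UDfn.{u} fun x _ v => SatAt x (v i) (v j) (v k) (v m) := by
  unfold SatAt
  infer_instance

/-- The clause of the definition of satisfaction for a formula with the given components. -/
def SatCond (W o x Us g n op i j k s : ZFSet.{u}) : Prop :=
  (op = ∅ ∧ k = ∅ ∧ ∃ a ∈ x, ∃ b ∈ x, Get x s i a ∧ Get x s j b ∧ a ∈ b) ∨
  (op = ∅ ∧ k ≠ ∅ ∧ ∃ a ∈ x, Get x s i a ∧ a ∈ Us) ∨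
  (IsOne op ∧ ¬ (SatAt W g n i s ∧ SatAt W g n j s)) ∨
  (op ≠ ∅ ∧ ¬ IsOne op ∧ ∃ a ∈ x, ∃ s' ∈ W, ConsOf o x s' a s ∧ SatAt W g n i s')

instance UDfn.satCond {i1 i2 i3 i4 i5 i6 i7 i8 i9 i10 : ℕ} : UDfn.{u} fun x _ v =>
    SatCond x (v i1) (v i2) (v i3) (v i4) (v i5) (v i6) (v i7) (v i8) (v i9) (v i10) := by
  unfold SatCond
  infer_instance

/-- `B` is the set of assignments satisfying the formula with code `n`, as computed from `g`. -/
def SatRule (W o pr x Us g n B : ZFSet.{u}) : Prop :=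
  ∃ op ∈ o, ∃ m ∈ o, ∃ i ∈ o, ∃ m' ∈ o, ∃ j ∈ o, ∃ k ∈ o,
    ZFSet.pair n (ZFSet.pair op m) ∈ pr ∧ ZFSet.pair m (ZFSet.pair i m') ∈ pr ∧
    ZFSet.pair m' (ZFSet.pair j k) ∈ pr ∧
    ∀ s ∈ W, s ∈ B ↔ AsgOf o x s ∧ SatCond W o x Us g n op i j k s

instance UDfn.satRule {i1 i2 i3 i4 i5 i6 i7 : ℕ} : UDfn.{u} fun x _ v =>
    SatRule x (v i1) (v i2) (v i3) (v i4) (v i5) (v i6) (v i7) := by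
  unfold SatRule
  infer_instance

/-- `g` is an initial part of the function sending the code of a formula to the set of assignments
which satisfy it. -/
def SatApprox (W o pr x Us g : ZFSet.{u}) : Prop :=
  ∀ p ∈ g, ∃ n ∈ o, ∃ B ∈ W, p = ZFSet.pair n B ∧ (∀ i ∈ n, ∃ C ∈ W, ZFSet.pair i C ∈ g) ∧
    SatRule W o pr x Us g n B

instance UDfn.satApprox {i1 i2 i3 i4 i5 : ℕ} : UDfn.{u} fun x _ v =>
    SatApprox x (v i1) (v i2) (v i3) (v i4) (v i5) := by
  unfold SatApprox
  infer_instance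

/-- In the structure `(x, ∈, Us)` the formula with code `n` is true under the assignment `s`. -/
def SatCode (W o pr x Us n s : ZFSet.{u}) : Prop :=
  ∃ g ∈ W, SatApprox W o pr x Us g ∧ ∃ B ∈ W, ZFSet.pair n B ∈ g ∧ s ∈ B

instance UDfn.satCode {i1 i2 i3 i4 i5 i6 : ℕ} : UDfn.{u} fun x _ v =>
    SatCode x (v i1) (v i2) (v i3) (v i4) (v i5) (v i6) := by
  unfold SatCode
  infer_instance

section

variable {W x Us : ZFSet.{u}} (hx : ∅ ∈ x)
  (hW : ∀ v : ℕ → ZFSet.{u}, (∀ i, v i ∈ x) → FinSupp v → asg v ∈ W)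

include hx hW

lemma exists_consOf_iff {v : ℕ → ZFSet.{u}} (hv : ∀ i, v i ∈ x) (hvs : FinSupp v) {a : ZFSet.{u}}
    (ha : a ∈ x) {p : ZFSet.{u} → Prop} :
    (∃ s' ∈ W, ConsOf om x s' a (asg v) ∧ p s') ↔ p (asg (scons a v)) := by
  constructor
  · rintro ⟨s', -, hc, hs⟩
    obtain ⟨w, hw, hws, rfl⟩ := (asgOf_iff hx).1 hc.1
    rwa [(consOf_asg hx hv hw hws).1 hc] at hs
  · intro h
    have hav := scons_forall (p := (· ∈ x)) ha hv
    exact ⟨_, hW _ hav (hvs.scons a), (consOf_asg hx hv hav (hvs.scons a)).2 rfl, h⟩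

lemma satCond_iff {g : ZFSet.{u}} {n op m i m' j k : ℕ} (h1 : unpair.{u} n = (op, m))
    (h2 : unpair.{u} m = (i, m')) (h3 : unpair.{u} m' = (j, k))
    (hS : ∀ (i : ℕ) (v : ℕ → ZFSet.{u}), (∀ i, v i ∈ x) → FinSupp v →
      (SatAt W g (nat n) (nat i) (asg v) ↔ Sat x (· ∈ Us) (decodeSub.{u} n i) v))
    {v : ℕ → ZFSet.{u}} (hv : ∀ i, v i ∈ x) (hvs : FinSupp v) :
    SatCond W om x Us g (nat n) (nat op) (nat i) (nat j) (nat k) (asg v) ↔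
      Sat x (· ∈ Us) (decode.{u} n) v := by
  rw [decode_eq h1 h2 h3, SatCond]
  simp only [get_asg hv, hS _ v hv hvs, isOne_nat, nat_eq_empty, ne_eq]
  by_cases h0 : op = 0
  · subst h0
    by_cases hk : k = 0
    · subst hk
      simp only [true_and, not_true_eq_false, false_and, if_true, Sat, or_false, zero_ne_one]
      exact ⟨fun ⟨a, _, b, _, e, e', h⟩ => e ▸ e' ▸ h, fun h => ⟨_, hv i, _, hv j, rfl, rfl, h⟩⟩
    · simp only [hk, true_and, not_true_eq_false, not_false_eq_true, false_and, if_true, if_false,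
        Sat, or_false, false_or, zero_ne_one]
      exact ⟨fun ⟨a, _, e, h⟩ => e ▸ h, fun h => ⟨_, hv i, rfl, h⟩⟩
  · by_cases hop : op = 1
    · subst hop
      simp [Sat]
    · simp only [h0, hop, false_and, false_or, not_false_eq_true, true_and, if_false, Sat]
      refine exists_congr fun a => and_congr_right fun ha => ?_
      rw [exists_consOf_iff hx hW hv hvs ha,
        hS i _ (scons_forall (p := (· ∈ x)) ha hv) (hvs.scons a)]

/-- Strong induction on the code: an approximation has values at all smaller codes, and these decide
the clause for `n`. The set `W` need only contain all coded assignments. -/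
lemma SatApprox.sound {g : ZFSet.{u}}
    (h : SatApprox W om unpairGraph x Us g) (n : ℕ) {B : ZFSet.{u}}
    (hB : ZFSet.pair (nat n) B ∈ g) {v : ℕ → ZFSet.{u}} (hv : ∀ i, v i ∈ x) (hvs : FinSupp v) :
    asg v ∈ B ↔ Sat x (· ∈ Us) (decode.{u} n) v := by
  induction n using Nat.strong_induction_on generalizing B v with
  | _ n ih =>
    obtain ⟨n', -, B', -, e, hcl, op, hop, m, hm, i, hi, m', hm', j, hj, k, hk, h1, h2, h3, hr⟩ :=
      h _ hB
    rw [ZFSet.pair_inj] at e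
    obtain ⟨rfl, rfl⟩ := e
    obtain ⟨op, rfl⟩ := mem_om.1 hop
    obtain ⟨m, rfl⟩ := mem_om.1 hm
    obtain ⟨i, rfl⟩ := mem_om.1 hi
    obtain ⟨m', rfl⟩ := mem_om.1 hm'
    obtain ⟨j, rfl⟩ := mem_om.1 hj
    obtain ⟨k, rfl⟩ := mem_om.1 hk
    rw [mem_unpairGraph] at h1 h2 h3
    rw [hr _ (hW v hv hvs), satCond_iff hx hW h1 h2 h3 _ hv hvs,
      and_iff_right ((asgOf_iff hx).2 ⟨v, hv, hvs, rfl⟩)]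
    intro i v hv hvs
    rw [sat_decodeSub, SatAt, nat_mem_nat]
    refine and_congr_right fun hin => ?_
    constructor
    · rintro ⟨C, -, hC, hs⟩
      exact (ih i hin hC hv hvs).1 hs
    · intro hs
      obtain ⟨C, hCW, hC⟩ := hcl _ (nat_mem_nat.2 hin)
      exact ⟨C, hCW, hC, (ih i hin hC hv hvs).2 hs⟩

omit hx hW in
/-- Satisfaction of a fixed formula, with coded assignments. -/
def SatFm (W o x Us : ZFSet.{u}) : Fm → ZFSet.{u} → Prop
  | .mem i j, s => ∃ m ∈ o, m = nat i ∧ ∃ n ∈ o, n = nat j ∧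
      ∃ a ∈ x, ∃ b ∈ x, Get x s m a ∧ Get x s n b ∧ a ∈ b
  | .lev i, s => ∃ m ∈ o, m = nat i ∧ ∃ a ∈ x, Get x s m a ∧ a ∈ Us
  | .nand φ ψ, s => ¬ (SatFm W o x Us φ s ∧ SatFm W o x Us ψ s)
  | .ex φ, s => ∃ a ∈ x, ∃ s' ∈ W, ConsOf o x s' a s ∧ SatFm W o x Us φ s'

omit hx hW in
lemma UDfn.satFm (φ : Fm) (i j k m : ℕ) :
    UDfn.{u} fun x _ v => SatFm x (v i) (v j) (v k) φ (v m) := by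
  induction φ generalizing i j k m with
  | mem _ _ => unfold SatFm; infer_instance
  | lev _ => unfold SatFm; infer_instance
  | nand φ ψ h h' =>
    have := h i j k m
    have := h' i j k m
    unfold SatFm
    infer_instance
  | ex φ h =>
    have := h (i + 1 + 1) (j + 1 + 1) (k + 1 + 1) 0
    unfold SatFm
    infer_instance

lemma satFm_iff (φ : Fm) {v : ℕ → ZFSet.{u}} (hv : ∀ i, v i ∈ x) (hvs : FinSupp v) :
    SatFm W om x Us φ (asg v) ↔ Sat x (· ∈ Us) φ v := by
  induction φ generalizing v with
  | mem i j =>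
    constructor
    · rintro ⟨_, -, rfl, _, -, rfl, a, -, b, -, h1, h2, h⟩
      rw [get_asg hv] at h1 h2
      subst h1 h2
      exact h
    · intro h
      exact ⟨_, nat_mem_om i, rfl, _, nat_mem_om j, rfl, _, hv i, _, hv j, (get_asg hv).2 rfl,
        (get_asg hv).2 rfl, h⟩
  | lev i =>
    constructor
    · rintro ⟨_, -, rfl, a, -, h1, h⟩
      rw [get_asg hv] at h1
      subst h1
      exact h
    · intro h
      exact ⟨_, nat_mem_om i, rfl, _, hv i, (get_asg hv).2 rfl, h⟩
  | nand φ ψ h h' => rw [SatFm, Sat, h hv hvs, h' hv hvs]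
  | ex φ h =>
    refine exists_congr fun a => and_congr_right fun ha => ?_
    rw [exists_consOf_iff hx hW hv hvs ha, h (scons_forall (p := (· ∈ x)) ha hv) (hvs.scons a)]

end

/-- For each fixed formula the recursion is unfolded outside the structure by `SatFm`, a single
definition over `L a`. Hence all the sets `D n` appear at the same level, however complex the
formula. -/
lemma exists_satSets {a : Ordinal.{u}} {x Us : ZFSet.{u}} (hx : ∅ ∈ x) (hxa : x ∈ L a)
    (hUs : Us ∈ L a) (ho : om ∈ L a)
    (hW : ∀ v : ℕ → ZFSet.{u}, (∀ i, v i ∈ x) → FinSupp v → asg v ∈ L a) :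
    ∃ D : ℕ → ZFSet.{u}, ∀ n, D n ∈ L (a + 1) ∧ ∀ s, s ∈ D n ↔
      ∃ v : ℕ → ZFSet.{u}, (∀ i, v i ∈ x) ∧ FinSupp v ∧ s = asg v ∧
        Sat x (· ∈ Us) (decode.{u} n) v := by
  have key : ∀ n, ∃ D : ZFSet.{u}, D ∈ L (a + 1) ∧ ∀ s, s ∈ D ↔
      ∃ v : ℕ → ZFSet.{u}, (∀ i, v i ∈ x) ∧ FinSupp v ∧ s = asg v ∧
        Sat x (· ∈ Us) (decode.{u} n) v := by
    intro n
    have hsat := UDfn.satFm.{u} (decode.{u} n) 1 2 3 0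
    have hmem : ∀ s, s ∈ (L a).sep (fun s => AsgOf om x s ∧ SatFm (L a) om x Us (decode.{u} n) s) ↔
      s ∈ L a ∧ AsgOf om x s ∧ SatFm (L a) om x Us (decode.{u} n) s := fun s => ZFSet.mem_sep
    refine ⟨_, sep_mem_L_add_one (P := fun X _ v => AsgOf (v 1) (v 2) (v 0) ∧
      SatFm X (v 1) (v 2) (v 3) (decode.{u} n) (v 0)) inferInstance [x, Us] ho
      (by simp [hxa, hUs]) hmem, fun s => ?_⟩
    rw [hmem]
    constructor
    · rintro ⟨-, hs, h⟩
      obtain ⟨v, hv, hvs, rfl⟩ := (asgOf_iff hx).1 hs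
      exact ⟨v, hv, hvs, rfl, (satFm_iff hx hW _ hv hvs).1 h⟩
    · rintro ⟨v, hv, hvs, rfl, h⟩
      exact ⟨hW v hv hvs, (asgOf_iff hx).2 ⟨v, hv, hvs, rfl⟩, (satFm_iff hx hW _ hv hvs).2 h⟩
  choose D hD using key
  exact ⟨D, hD⟩

/-- A finite approximation up to `n` suffices: its values are in `L (a + 1)`, the pairs in `L (a + 1
+ 2)`, and the finite set of pairs one level higher, which accounts for `a + 4`. Satisfaction
thereby becomes one definition over `L b` for all codes. -/
lemma satCode_iff {a b : Ordinal.{u}} (hab : a + 4 ≤ b) {x Us : ZFSet.{u}} (hx : ∅ ∈ x)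
    (hxa : x ∈ L a) (hUs : Us ∈ L a) (ho : om ∈ L a)
    (hW : ∀ v : ℕ → ZFSet.{u}, (∀ i, v i ∈ x) → FinSupp v → asg v ∈ L a) (n : ℕ)
    {v : ℕ → ZFSet.{u}} (hv : ∀ i, v i ∈ x) (hvs : FinSupp v) :
    SatCode (L b) om unpairGraph x Us (nat n) (asg v) ↔ Sat x (· ∈ Us) (decode.{u} n) v := by
  have e4 : a + 1 + 2 + 1 = a + 4 := by
    rw [add_assoc, add_assoc]
    congr 1
    exact_mod_cast (rfl : 1 + (2 + 1) = 4)
  have e1 : a + 1 ≤ a + 4 := by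
    rw [← e4, add_assoc (a + 1)]
    exact le_self_add
  have hW' : ∀ v : ℕ → ZFSet.{u}, (∀ i, v i ∈ x) → FinSupp v → asg v ∈ L b := fun v hv hvs =>
    L_mono ((le_self_add.trans e1).trans hab) (hW v hv hvs)
  constructor
  · rintro ⟨g, hg, happ, B, -, hB, hs⟩
    exact (happ.sound hx hW' n hB hv hvs).1 hs
  · intro h
    obtain ⟨D, hD⟩ := exists_satSets hx hxa hUs ho hW
    have hDb : ∀ i, D i ∈ L b := fun i => L_mono (e1.trans hab) (hD i).1
    obtain ⟨g, hg⟩ := exists_zfset_of_finite (s := (fun i => ZFSet.pair (nat i) (D i)) ''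
      {i | i < n + 1}) ((Set.finite_lt_nat _).image _)
    have hpair : ∀ i B, ZFSet.pair (nat i) B ∈ g ↔ i < n + 1 ∧ B = D i := by
      intro i B
      rw [hg]
      constructor
      · rintro ⟨i', hi', e⟩
        rw [ZFSet.pair_inj, nat_inj] at e
        obtain ⟨rfl, rfl⟩ := e
        exact ⟨hi', rfl⟩
      · rintro ⟨hi, rfl⟩
        exact ⟨i, hi, rfl⟩
    have ha : ω ≤ a := (om_mem_L.1 ho).le
    have hgb : g ∈ L b := by
      refine L_mono hab ?_
      rw [← e4]
      refine finite_mem_L (((Set.finite_lt_nat (n + 1)).image _).subset fun p hp => (hg p).1 hp)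
        fun p hp => ?_
      obtain ⟨i, -, rfl⟩ := (hg p).1 hp
      exact pair_mem_L (nat_mem_L (ha.trans le_self_add) i) (hD i).1
    refine ⟨g, hgb, fun p hp => ?_, D n, hDb n, (hpair _ _).2 ⟨by omega, rfl⟩,
      ((hD n).2 _).2 ⟨v, hv, hvs, rfl, h⟩⟩
    obtain ⟨i, hi, rfl⟩ := (hg p).1 hp
    have hi : i < n + 1 := hi
    refine ⟨nat i, nat_mem_om i, D i, hDb i, rfl, fun j hj => ?_, ?_⟩
    · obtain ⟨j, hj, rfl⟩ := mem_nat.1 hj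
      exact ⟨D j, hDb j, (hpair _ _).2 ⟨by omega, rfl⟩⟩
    · obtain ⟨op, m, h1⟩ : ∃ op m, unpair.{u} i = (op, m) := ⟨_, _, rfl⟩
      obtain ⟨j, m', h2⟩ : ∃ j m', unpair.{u} m = (j, m') := ⟨_, _, rfl⟩
      obtain ⟨k, q, h3⟩ : ∃ k q, unpair.{u} m' = (k, q) := ⟨_, _, rfl⟩
      have hS : ∀ (j : ℕ) (v : ℕ → ZFSet.{u}), (∀ i, v i ∈ x) → FinSupp v →
          (SatAt (L b) g (nat i) (nat j) (asg v) ↔ Sat x (· ∈ Us) (decodeSub.{u} i j) v) := by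
        intro j v hv hvs
        rw [sat_decodeSub, SatAt, nat_mem_nat]
        refine and_congr_right fun hij => ?_
        constructor
        · rintro ⟨C, -, hC, hs⟩
          rw [((hpair _ _).1 hC).2, (hD j).2] at hs
          obtain ⟨w, hw, hws, e, hsat⟩ := hs
          rwa [asg_injective hv hw e]
        · intro hs
          exact ⟨D j, hDb j, (hpair _ _).2 ⟨by omega, rfl⟩, ((hD j).2 _).2 ⟨v, hv, hvs, rfl, hs⟩⟩
      refine ⟨_, nat_mem_om op, _, nat_mem_om m, _, nat_mem_om j, _, nat_mem_om m', _,
        nat_mem_om k, _, nat_mem_om q, mem_unpairGraph.2 h1, mem_unpairGraph.2 h2,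
        mem_unpairGraph.2 h3, fun s hs => ?_⟩
      rw [(hD i).2]
      constructor
      · rintro ⟨v, hv, hvs, rfl, h⟩
        exact ⟨(asgOf_iff hx).2 ⟨v, hv, hvs, rfl⟩, (satCond_iff hx hW' h1 h2 h3 hS hv hvs).2 h⟩
      · rintro ⟨hs, h⟩
        obtain ⟨v, hv, hvs, rfl⟩ := (asgOf_iff hx).1 hs
        exact ⟨v, hv, hvs, rfl, (satCond_iff hx hW' h1 h2 h3 hS hv hvs).1 h⟩

/-! ### The set of all levels below a given one -/

/-- `y` is in `Def w`, formulated in `W`. -/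
def InDef (W o pr e w y : ZFSet.{u}) : Prop :=
  y ⊆ w ∧ (w = ∅ ∨ ∃ n ∈ o, ∃ s ∈ W, AsgOf o w s ∧
    ∀ z ∈ w, z ∈ y ↔ ∃ s' ∈ W, ConsOf o w s' z s ∧ SatCode W o pr w e n s')

instance UDfn.inDef {i1 i2 i3 i4 i5 : ℕ} : UDfn.{u} fun x _ v =>
    InDef x (v i1) (v i2) (v i3) (v i4) (v i5) := by
  unfold InDef
  infer_instance

lemma exists_finSupp {x : ZFSet.{u}} (hx : ∅ ∈ x) (φ : Fm) {v : ℕ → ZFSet.{u}}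
    (hv : ∀ i, v i ∈ x) : ∃ w : ℕ → ZFSet.{u}, (∀ i, w i ∈ x) ∧ (∀ i, w i = v i ∨ w i = ∅) ∧
      FinSupp w ∧ ∀ (y : ZFSet.{u}) (U : ZFSet.{u} → Prop) (z : ZFSet.{u}),
        Sat y U φ (scons z w) ↔ Sat y U φ (scons z v) := by
  obtain ⟨N, hN⟩ := exists_sat_bound.{u} φ
  refine ⟨fun i => if i < N then v i else ∅, fun i => ?_, fun i => ?_, ⟨N, fun i hi => ?_⟩,
    fun y U z => hN _ _ _ _ fun i hi => ?_⟩
  · dsimp only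
    split_ifs
    exacts [hv i, hx]
  · dsimp only
    split_ifs
    exacts [.inl rfl, .inr rfl]
  · exact if_neg (not_lt.2 hi)
  · cases i with
    | zero => rfl
    | succ i => exact if_pos (by omega)

/-- Three of the seven levels make room for the coded assignments and four for `satCode_iff`. -/
lemma inDef_iff {c d b : Ordinal.{u}} (hc : ω ≤ c) (hd : d ≤ c) (hb : c + 7 ≤ b) {y : ZFSet.{u}} :
    InDef (L b) om unpairGraph ∅ (L d) y ↔ y ∈ Def (L d) := by
  have e7 : c + 3 + 4 = c + 7 := by
    rw [add_assoc]
    congr 1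
    exact_mod_cast (rfl : 3 + 4 = 7)
  have h3 : c < c + 3 := lt_add_of_pos_right c (by norm_num)
  rw [InDef, mem_Def_iff (L_transitive d)]
  refine and_congr_right fun hyd => ?_
  rcases eq_or_ne d 0 with rfl | hd0
  · simp [L_zero]
  have hx : ∅ ∈ L d := empty_mem_L (pos_iff_ne_zero.2 hd0)
  have hne : L d ≠ ∅ := fun h => ZFSet.notMem_empty _ (h ▸ hx)
  simp only [hne, false_or]
  have hW : ∀ v : ℕ → ZFSet.{u}, (∀ i, v i ∈ L d) → FinSupp v → asg v ∈ L (c + 3) :=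
    fun v hv hvs => asg_mem_L hc hvs fun i => L_mono hd (hv i)
  have hcb : c + 3 ≤ b := by
    refine le_trans ?_ hb
    rw [← e7]
    exact le_self_add
  have hW' : ∀ v : ℕ → ZFSet.{u}, (∀ i, v i ∈ L d) → FinSupp v → asg v ∈ L b :=
    fun v hv hvs => L_mono hcb (hW v hv hvs)
  have key : ∀ (n : ℕ) (v : ℕ → ZFSet.{u}), (∀ i, v i ∈ L d) → FinSupp v → ∀ z ∈ L d,
      (∃ s' ∈ L b, ConsOf om (L d) s' z (asg v) ∧
        SatCode (L b) om unpairGraph (L d) ∅ (nat n) s') ↔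
      Sat (L d) (fun _ => False) (decode.{u} n) (scons z v) := by
    intro n v hv hvs z hz
    have hzv := scons_forall (p := (· ∈ L d)) hz hv
    rw [exists_consOf_iff hx hW' hv hvs hz, satCode_iff (a := c + 3) (by rw [e7]; exact hb) hx
      (L_mem_L.2 (hd.trans_lt h3)) (empty_mem_L ((zero_le).trans_lt h3))
      (om_mem_L.2 (hc.trans_lt h3)) hW n hzv (hvs.scons z)]
    exact sat_congr_pred (fun z _ => by simp) _ hzv
  constructor
  · rintro ⟨n, hn, s, -, hs, h⟩
    obtain ⟨n, rfl⟩ := mem_om.1 hn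
    obtain ⟨v, hv, hvs, rfl⟩ := (asgOf_iff hx).1 hs
    exact ⟨_, v, hv, fun z hz => (h z hz).trans (key n v hv hvs z hz)⟩
  · rintro ⟨φ, v, hv, h⟩
    obtain ⟨w, hw, -, hws, hvw⟩ := exists_finSupp hx φ hv
    obtain ⟨n, rfl⟩ := decode_surjective.{u} φ
    exact ⟨_, nat_mem_om n, _, hW' w hw hws, (asgOf_iff hx).2 ⟨w, hw, hws, rfl⟩, fun z hz =>
      (h z hz).trans (((key n w hw hws z hz).trans (hvw _ _ _)).symm)⟩

/-- A union of successor levels is a level. -/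
lemma exists_eq_L {Z : Set Ordinal.{u}} {c : Ordinal.{u}} (hZ : ∀ d ∈ Z, d < c) {w : ZFSet.{u}}
    (hw : ∀ y, y ∈ w ↔ ∃ d ∈ Z, y ∈ Def (L d)) : ∃ d ≤ c, w = L d := by
  refine ⟨sInf {d | ∀ b ∈ Z, b < d}, csInf_le' hZ, ?_⟩
  have hs : ∀ b ∈ Z, b < sInf {d | ∀ b ∈ Z, b < d} :=
    csInf_mem (s := {d | ∀ b ∈ Z, b < d}) ⟨c, hZ⟩
  ext y
  rw [hw, mem_L_iff]
  constructor
  · rintro ⟨d, hd, hy⟩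
    exact ⟨d, hs d hd, hy⟩
  · rintro ⟨b, hb, hy⟩
    have := notMem_of_lt_csInf' hb
    simp only [Set.mem_ofPred_eq, not_forall, not_lt] at this
    obtain ⟨d, hd, hbd⟩ := this
    refine ⟨d, hd, ?_⟩
    rw [← L_add_one] at hy ⊢
    exact L_mono (add_le_add_left hbd 1) hy

/-- The set of the levels `L b` for `b < a`. -/
noncomputable def levels (a : Ordinal.{u}) : ZFSet.{u} := (L a).sep fun z => ∃ b < a, z = L b

lemma mem_levels {a : Ordinal.{u}} {z : ZFSet.{u}} : z ∈ levels a ↔ ∃ b < a, z = L b := by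
  rw [levels, ZFSet.mem_sep]
  refine ⟨And.right, fun h => ⟨?_, h⟩⟩
  obtain ⟨b, hb, rfl⟩ := h
  exact L_mem_L.2 hb

/-- `F` consists of levels, and is closed under taking smaller levels. -/
def LevelSet (W o pr e F : ZFSet.{u}) : Prop :=
  ∀ w ∈ F, (∀ y ∈ w, ∃ w' ∈ F, w' ∈ w ∧ InDef W o pr e w' y) ∧
    ∀ w' ∈ F, w' ∈ w → ∀ y ∈ W, InDef W o pr e w' y → y ∈ w

instance UDfn.levelSet {i1 i2 i3 i4 : ℕ} : UDfn.{u} fun x _ v =>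
    LevelSet x (v i1) (v i2) (v i3) (v i4) := by
  unfold LevelSet
  infer_instance

section

variable {c b : Ordinal.{u}} (hc : ω ≤ c) (hb : c + 7 ≤ b)

include hc hb

lemma levelSet_levels {a : Ordinal.{u}} (ha : a ≤ c) :
    LevelSet (L b) om unpairGraph ∅ (levels a) := by
  intro w hw
  obtain ⟨d, hd, rfl⟩ := mem_levels.1 hw
  constructor
  · intro y hy
    obtain ⟨k, hk, hy⟩ := mem_L_iff.1 hy
    exact ⟨L k, mem_levels.2 ⟨k, hk.trans hd, rfl⟩, L_mem_L.2 hk,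
      (inDef_iff hc ((hk.trans hd).le.trans ha) hb).2 hy⟩
  · intro w' hw' hlt y _ hy
    obtain ⟨k, hk, rfl⟩ := mem_levels.1 hw'
    rw [L_mem_L] at hlt
    rw [inDef_iff hc (hk.le.trans ha) hb] at hy
    exact mem_L_iff.2 ⟨k, hlt, hy⟩

/-- By ∈-induction, `w` is the union of `Def (L d)` over the levels `L d ∈ F` that belong to `w`,
and such a union is a level. -/
lemma LevelSet.exists_eq_L {F : ZFSet.{u}} (hF : LevelSet (L b) om unpairGraph ∅ F)
    (hFc : F ∈ L c) (w : ZFSet.{u}) (hw : w ∈ F) : ∃ d < c, w = L d := by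
  induction w using ZFSet.inductionOn with
  | h w ih =>
    have hcb : c ≤ b := le_self_add.trans hb
    have hwc : w ∈ L c := L_trans hFc hw
    obtain ⟨d, -, e⟩ := ConstructibleLevels.exists_eq_L (Z := {d | L d ∈ F ∧ L d ∈ w}) (c := c)
      (w := w) (fun d hd => L_mem_L.1 (L_trans hFc hd.1)) fun y => by
      constructor
      · intro hy
        obtain ⟨w', hw', hlt, hd⟩ := (hF w hw).1 y hy
        obtain ⟨d, hdc, rfl⟩ := ih w' hlt hw'
        exact ⟨d, ⟨hw', hlt⟩, (inDef_iff hc hdc.le hb).1 hd⟩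
      · rintro ⟨d, ⟨hd, hdw⟩, hy⟩
        have hdc := L_mem_L.1 (L_trans hFc hd)
        refine (hF w hw).2 _ hd hdw y ?_ ((inDef_iff hc hdc.le hb).2 hy)
        exact L_mono hcb (mem_L_iff.2 ⟨d, hdc, hy⟩)
    subst e
    exact ⟨d, L_mem_L.1 hwc, rfl⟩

end

/-- At a limit `a`, the levels below `a` are the elements of those `LevelSet`s that lie in `L a`.
The definition is evaluated over a level beyond `a + 7`, where `InDef` is correct, that also
contains `unpairGraph`. -/
lemma levels_mem_L (a : Ordinal.{u}) : levels a ∈ L (a + ω) := by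
  refine mem_L_add_omega0_of_step (t := L) ?_ (fun a => ?_)
    (fun a => L_mem_L.2 (lt_add_omega0 a)) (fun a ha ih => ?_) a
  · ext z
    simp [mem_levels]
  · ext z
    rw [ZFSet.mem_insert_iff, mem_levels, mem_levels]
    simp only [Order.lt_add_one_iff, le_iff_lt_or_eq]
    constructor
    · rintro ⟨b, hb | rfl, rfl⟩
      · exact .inr ⟨b, hb, rfl⟩
      · exact .inl rfl
    · rintro (rfl | ⟨b, hb, rfl⟩)
      · exact ⟨a, .inr rfl, rfl⟩
      · exact ⟨b, .inl hb, rfl⟩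
  · have hω : ω ≤ a := omega0_le_of_isSuccLimit ha
    have hl := isSuccLimit_add_omega0 a
    have ha' := lt_add_omega0 a
    obtain ⟨d, hd, hdp⟩ := exists_level hl [unpairGraph] (by
      simpa using L_mono (add_le_add_left hω ω) unpairGraph_mem_L)
    have h7 := add_nat_lt hl ha' 7
    have hb : a + 7 ≤ max d (a + 7) := le_max_right _ _
    have hab : a < max d (a + 7) := (lt_add_of_pos_right a (by norm_num)).trans_le hb
    refine L_mono (hl.add_one_lt (max_lt hd h7)).le
      (sep_mem_L_add_one (P := fun x _ v => v 0 ∈ v 1 ∧ ∃ F ∈ v 1, v 0 ∈ F ∧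
          LevelSet x (v 2) (v 3) (v 4) F) inferInstance [om, unpairGraph, ∅]
        (p := L a) (L_mem_L.2 hab) ?_ fun z => ?_)
    · simp only [List.mem_cons, List.not_mem_nil, or_false, forall_eq_or_imp, forall_eq]
      exact ⟨om_mem_L.2 (hω.trans_lt hab), L_mono (le_max_left _ _) (hdp _ (by simp)),
        empty_mem_L (zero_le.trans_lt hab)⟩
    change z ∈ levels a ↔ z ∈ L (max d (a + 7)) ∧ z ∈ L a ∧ ∃ F ∈ L a, z ∈ F ∧
      LevelSet (L (max d (a + 7))) om unpairGraph ∅ F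
    constructor
    · intro hz
      obtain ⟨b, hba, rfl⟩ := mem_levels.1 hz
      exact ⟨L_mem_L.2 (hba.trans hab), L_mem_L.2 hba, levels (b + 1), ih _ (ha.add_one_lt hba),
        mem_levels.2 ⟨b, lt_add_one b, rfl⟩, levelSet_levels hω hb (ha.add_one_lt hba).le⟩
    · rintro ⟨-, -, F, hF, hz, hl⟩
      exact mem_levels.2 (hl.exists_eq_L hω hb hF z hz)

/-! ### Definability with parameters, and definable hulls -/

/-- The predicates on assignments in `x` that are definable over `(x, ∈, U)` with parameters
from `B`. -/
inductive Dfn (x : ZFSet.{u}) (U : ZFSet.{u} → Prop) (B : Set ZFSet.{u}) :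
    ((ℕ → ZFSet.{u}) → Prop) → Prop
  | mem (i j : ℕ) : Dfn x U B fun v => v i ∈ v j
  | lev (i : ℕ) : Dfn x U B fun v => U (v i)
  | const (i : ℕ) {c : ZFSet.{u}} (hc : c ∈ B) : Dfn x U B fun v => v i = c
  | not {P : (ℕ → ZFSet.{u}) → Prop} (hP : Dfn x U B P) : Dfn x U B fun v => ¬ P v
  | and {P Q : (ℕ → ZFSet.{u}) → Prop} (hP : Dfn x U B P) (hQ : Dfn x U B Q) :
      Dfn x U B fun v => P v ∧ Q v
  | ex {P : (ℕ → ZFSet.{u}) → Prop} (hP : Dfn x U B P) :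
      Dfn x U B fun v => ∃ a ∈ x, P (scons a v)
  | rename {P : (ℕ → ZFSet.{u}) → Prop} (f : ℕ → ℕ) (hP : Dfn x U B P) :
      Dfn x U B fun v => P fun i => v (f i)
  | congr {P Q : (ℕ → ZFSet.{u}) → Prop} (hP : Dfn x U B P)
      (h : ∀ v, (∀ i, v i ∈ x) → (P v ↔ Q v)) : Dfn x U B Q

/-- The set of the elements of `x` that are definable over `(x, ∈, U)` with parameters
from `B`. -/
noncomputable def hull (x : ZFSet.{u}) (U : ZFSet.{u} → Prop) (B : Set ZFSet.{u}) : ZFSet.{u} :=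
  x.sep fun z => Dfn x U B fun v => v 0 = z

variable {x : ZFSet.{u}} {U : ZFSet.{u} → Prop} {B : Set ZFSet.{u}}

lemma mem_hull {z : ZFSet.{u}} : z ∈ hull x U B ↔ z ∈ x ∧ Dfn x U B fun v => v 0 = z :=
  ZFSet.mem_sep

lemma subset_hull {z : ZFSet.{u}} (hz : z ∈ B) (hx : z ∈ x) : z ∈ hull x U B :=
  mem_hull.2 ⟨hx, .const 0 hz⟩

namespace Dfn

variable {P Q : (ℕ → ZFSet.{u}) → Prop}

lemma imp (hP : Dfn x U B P) (hQ : Dfn x U B Q) : Dfn x U B fun v => P v → Q v :=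
  (hP.and hQ.not).not.congr fun v _ => by tauto

lemma iff (hP : Dfn x U B P) (hQ : Dfn x U B Q) : Dfn x U B fun v => P v ↔ Q v :=
  ((hP.imp hQ).and (hQ.imp hP)).congr fun v _ => by tauto

lemma all (hP : Dfn x U B P) : Dfn x U B fun v => ∀ a ∈ x, P (scons a v) :=
  hP.not.ex.not.congr fun v _ => by simp

lemma mono {C : Set ZFSet.{u}} (h : B ⊆ C) (hP : Dfn x U B P) : Dfn x U C P := by
  induction hP with
  | mem i j => exact .mem i j
  | lev i => exact .lev i
  | const i hc => exact .const i (h hc)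
  | not _ ih => exact ih.not
  | and _ _ ih ih' => exact ih.and ih'
  | ex _ ih => exact ih.ex
  | rename f _ ih => exact ih.rename f
  | congr _ h ih => exact ih.congr h

lemma exists_finite (hP : Dfn x U B P) : ∃ F : Finset ZFSet.{u}, ↑F ⊆ B ∧ Dfn x U F P := by
  classical
  induction hP with
  | mem i j => exact ⟨∅, by simp, .mem i j⟩
  | lev i => exact ⟨∅, by simp, .lev i⟩
  | @const i c hc => exact ⟨{c}, by simpa using hc, .const i (by simp)⟩
  | not _ ih =>
    obtain ⟨F, hF, h⟩ := ih
    exact ⟨F, hF, h.not⟩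
  | and _ _ ih ih' =>
    obtain ⟨F, hF, h⟩ := ih
    obtain ⟨F', hF', h'⟩ := ih'
    exact ⟨F ∪ F', by simp [hF, hF'], (h.mono (by simp)).and (h'.mono (by simp))⟩
  | ex _ ih =>
    obtain ⟨F, hF, h⟩ := ih
    exact ⟨F, hF, h.ex⟩
  | rename f _ ih =>
    obtain ⟨F, hF, h⟩ := ih
    exact ⟨F, hF, h.rename f⟩
  | congr _ h ih =>
    obtain ⟨F, hF, h'⟩ := ih
    exact ⟨F, hF, h'.congr h⟩

/-- The transposition of the first two variables. -/
def swapVar : ℕ → ℕ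
  | 0 => 1
  | 1 => 0
  | n + 2 => n + 2


/-- One parameter becomes the variable 0, so parameters can be removed one by one. Equality with `z`
is replaced by having the same elements. -/
lemma split (hx : x.IsTransitive) {z : ZFSet.{u}} (hz : z ∈ x) (hP : Dfn x U (insert z B) P) :
    ∃ Q, Dfn x U B Q ∧ ∀ v, (∀ i, v i ∈ x) → (P v ↔ Q (scons z v)) := by
  induction hP with
  | mem i j => exact ⟨_, .mem (i + 1) (j + 1), fun v _ => Iff.rfl⟩
  | lev i => exact ⟨_, .lev (i + 1), fun v _ => Iff.rfl⟩
  | @const i c hc =>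
    rcases hc with rfl | hc
    · refine ⟨fun v => ∀ a ∈ x, a ∈ v (i + 1) ↔ a ∈ v 0,
        ((Dfn.mem 0 (i + 2)).iff (.mem 0 1)).all, fun v hv => ?_⟩
      simp only [scons_succ, scons_zero]
      refine ⟨fun e a _ => by rw [e], fun h => ?_⟩
      ext a
      exact ⟨fun ha => (h a (hx _ (hv i) ha)).1 ha, fun ha => (h a (hx _ hz ha)).2 ha⟩
    · exact ⟨_, .const (i + 1) hc, fun v _ => Iff.rfl⟩
  | not _ ih =>
    obtain ⟨Q, hQ, h⟩ := ih
    exact ⟨_, hQ.not, fun v hv => not_congr (h v hv)⟩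
  | and _ _ ih ih' =>
    obtain ⟨Q, hQ, h⟩ := ih
    obtain ⟨Q', hQ', h'⟩ := ih'
    exact ⟨_, hQ.and hQ', fun v hv => and_congr (h v hv) (h' v hv)⟩
  | ex _ ih =>
    obtain ⟨Q, hQ, h⟩ := ih
    -- The induction hypothesis has the parameter before the quantified variable, whereas the
    -- quantifier binds index 0.
    refine ⟨_, (hQ.rename swapVar).ex, fun v hv => exists_congr fun a =>
      and_congr_right fun ha => ?_⟩
    rw [h _ (scons_forall (p := (· ∈ x)) ha hv)]
    apply iff_of_eq
    congr 1
    funext i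
    rcases i with _ | _ | i <;> rfl
  | rename f _ ih =>
    obtain ⟨Q, hQ, h⟩ := ih
    refine ⟨_, hQ.rename (liftVar f), fun v hv => ?_⟩
    rw [scons_liftVar]
    exact h _ fun i => hv _
  | congr _ h ih =>
    obtain ⟨Q, hQ, h'⟩ := ih
    exact ⟨Q, hQ, fun v hv => (h v hv).symm.trans (h' v hv)⟩


/-- Satisfaction of a formula, with elements of the hull substituted for some variables. -/
lemma of_sat (φ : Fm) (e : ℕ → ℕ ⊕ ZFSet.{u}) (he : ∀ i c, e i = .inr c → c ∈ hull x U B) :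
    Dfn x U B fun v => Sat x U φ fun i => (e i).elim v id := by
  have hdef : ∀ {c}, c ∈ hull x U B → ∀ i, Dfn x U B fun v => v i = c :=
    fun hc i => (mem_hull.1 hc).2.rename fun _ => i
  -- A parameter from the hull is eliminated by quantifying over the unique element satisfying its
  -- definition.
  have hex : ∀ {c} {P : (ℕ → ZFSet.{u}) → Prop}, c ∈ hull x U B → Dfn x U B P →
      Dfn x U B fun v => P (scons c v) := fun hc hP =>
    ((hdef hc 0).and hP).ex.congr fun v _ =>
      ⟨fun ⟨a, _, e, h⟩ => e ▸ h, fun h => ⟨_, (mem_hull.1 hc).1, rfl, h⟩⟩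
  induction φ generalizing e with
  | mem i j =>
    simp only [Sat]
    rcases hi : e i with i' | c <;> rcases hj : e j with j' | d <;>
      simp only [Sum.elim_inl, Sum.elim_inr, id]
    · exact .mem i' j'
    · exact hex (he _ _ hj) (.mem (i' + 1) 0)
    · exact hex (he _ _ hi) (.mem 0 (j' + 1))
    · exact hex (he _ _ hi) (hex (he _ _ hj) (.mem 1 0))
  | lev i =>
    simp only [Sat]
    rcases hi : e i with i' | c <;> simp only [Sum.elim_inl, Sum.elim_inr, id]
    · exact .lev i'
    · exact hex (he _ _ hi) (.lev 0)
  | nand φ ψ h h' => exact ((h e he).and (h' e he)).not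
  | ex φ h =>
    refine (h (scons (.inl 0) fun i => (e i).map Nat.succ id) fun i c hi => ?_).ex.congr
      fun v _ => exists_congr fun a => and_congr_right fun _ => ?_
    · cases i with
      | zero => cases hi
      | succ i =>
        rw [scons_succ] at hi
        rcases hj : e i with i' | d
        · simp [hj] at hi
        · rw [hj] at hi
          exact he i c (hj.trans hi)
    · apply iff_of_eq
      congr 1
      funext i
      cases i with
      | zero => rfl
      | succ i =>
        rw [scons_succ, scons_succ]
        rcases e i with i' | d <;> rfl

lemma of_udfn {R : ZFSet.{u} → (ZFSet.{u} → Prop) → (ℕ → ZFSet.{u}) → Prop} (hR : UDfn R)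
    (hx : x.IsTransitive) {c : ℕ → ZFSet.{u}} (hc : ∀ i, c i ∈ hull x U B) :
    Dfn x U B fun v => R x U (scons (v 0) c) := by
  obtain ⟨φ, hφ⟩ := hR.1
  refine (of_sat (B := B) (x := x) (U := U) φ (scons (.inl 0) fun i => .inr (c i))
    fun i d h => ?_).congr fun v hv => ?_
  · cases i with
    | zero => cases h
    | succ i =>
      cases h
      exact hc i
  · rw [← hφ x hx U _ (scons_forall (p := (· ∈ x)) (hv 0) fun i => (mem_hull.1 (hc i)).1)]
    apply iff_of_eq
    congr 1
    funext i
    cases i <;> rfl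

lemma mem_hull {P : (ℕ → ZFSet.{u}) → Prop} (hP : Dfn x U B P) {z : ZFSet.{u}} (hz : z ∈ x)
    (h : ∀ v, (∀ i, v i ∈ x) → (P v ↔ v 0 = z)) : z ∈ hull x U B :=
  ConstructibleLevels.mem_hull.2 ⟨hz, hP.congr h⟩

end Dfn

lemma mem_hull_of_udfn {R : ZFSet.{u} → (ZFSet.{u} → Prop) → (ℕ → ZFSet.{u}) → Prop} (hR : UDfn R)
    (hx : x.IsTransitive) {c : ℕ → ZFSet.{u}} (hc : ∀ i, c i ∈ hull x U B) {z : ZFSet.{u}}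
    (hz : z ∈ x) (h : ∀ a ∈ x, R x U (scons a c) ↔ a = z) : z ∈ hull x U B :=
  (Dfn.of_udfn hR hx hc).mem_hull hz fun _ hv => h _ (hv 0)

/-- An element of the hull is defined by a formula, with parameters from the base set. -/
lemma exists_fm_of_mem_hull (hx : x.IsTransitive) (h0 : ∅ ∈ B) (hB : B ⊆ x) {z : ZFSet.{u}}
    (hz : z ∈ hull x U B) : ∃ (φ : Fm) (c : ℕ → ZFSet.{u}), (∀ i, c i ∈ B) ∧ FinSupp c ∧
      ∀ a ∈ x, Sat x U φ (scons a c) ↔ a = z := by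
  have key : ∀ (l : List ZFSet.{u}) (P : (ℕ → ZFSet.{u}) → Prop), (∀ c ∈ l, c ∈ B) →
      Dfn x U {c | c ∈ l} P → ∃ (N : ℕ) (c : ℕ → ZFSet.{u}) (φ : Fm), (∀ i, c i ∈ B) ∧
        ∀ v, (∀ i, v i ∈ x) → (P v ↔ Sat x U φ fun i => if i < N then c i else v (i - N)) := by
    intro l
    induction l with
    | nil =>
      intro P _ hP
      refine ⟨0, fun _ => ∅, ?_⟩
      suffices ∃ φ, ∀ v, (∀ i, v i ∈ x) → (P v ↔ Sat x U φ v) by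
        obtain ⟨φ, hφ⟩ := this
        exact ⟨φ, fun _ => h0, fun v hv => by simpa using hφ v hv⟩
      induction hP with
      | mem i j => exact ⟨.mem i j, fun _ _ => Iff.rfl⟩
      | lev i => exact ⟨.lev i, fun _ _ => Iff.rfl⟩
      | const i hc => simp at hc
      | not _ ih =>
        obtain ⟨φ, hφ⟩ := ih
        exact ⟨φ.neg, fun v hv => (not_congr (hφ v hv)).trans sat_neg.symm⟩
      | and _ _ ih ih' =>
        obtain ⟨φ, hφ⟩ := ih
        obtain ⟨ψ, hψ⟩ := ih'
        exact ⟨(Fm.nand φ ψ).neg, fun v hv => by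
          rw [sat_neg, Sat, ← hφ v hv, ← hψ v hv, not_not]⟩
      | ex _ ih =>
        obtain ⟨φ, hφ⟩ := ih
        exact ⟨.ex φ, fun v hv => exists_congr fun a => and_congr_right fun ha =>
          hφ _ (scons_forall (p := (· ∈ x)) ha hv)⟩
      | rename f _ ih =>
        obtain ⟨φ, hφ⟩ := ih
        exact ⟨φ.rename f, fun v hv => by
          rw [sat_rename]
          exact hφ _ fun i => hv _⟩
      | congr _ h ih =>
        obtain ⟨φ, hφ⟩ := ih
        exact ⟨φ, fun v hv => (h v hv).symm.trans (hφ v hv)⟩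
    | cons d l ih =>
      intro P hl hP
      have hd : d ∈ B := hl d (by simp)
      have hP' : Dfn x U (insert d {c | c ∈ l}) P := hP.mono fun c hc => by simpa using hc
      obtain ⟨Q, hQ, h⟩ := hP'.split hx (hB hd)
      obtain ⟨N, c, φ, hc, hφ⟩ := ih Q (fun c hc => hl c (by simp [hc])) hQ
      -- `split` leaves `d` at the head of the variables, that is, at place `N` of the assignment,
      -- where it joins the block of parameters.
      refine ⟨N + 1, fun i => if i < N then c i else d, φ, fun i => ?_, fun v hv => ?_⟩
      · dsimp only
        split_ifs
        exacts [hc i, hd]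
      · rw [h v hv, hφ _ (scons_forall (p := (· ∈ x)) (hB hd) hv)]
        apply iff_of_eq
        congr 1
        funext i
        by_cases hi : i < N
        · simp [hi, hi.trans (Nat.lt_succ_self N)]
        · rcases eq_or_lt_of_le (not_lt.1 hi) with rfl | hi'
          · simp
          · obtain ⟨k, rfl⟩ := Nat.exists_eq_add_of_lt hi'
            simp [show N + k + 1 - N = k + 1 by omega, show N + k + 1 - (N + 1) = k by omega,
              show ¬ N + k + 1 < N by omega]
  obtain ⟨F, hF, hP⟩ := (mem_hull.1 hz).2.exists_finite
  obtain ⟨N, c, φ, hc, hφ⟩ := key F.toList _ (fun c hc => hF (by simpa using hc))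
    (hP.mono fun c hc => by simpa using hc)
  -- The defined element moves to index 0, ahead of the parameters. As only `v 0` matters, all
  -- variables past the block may be identified with it.
  refine ⟨φ.rename fun i => if i < N then i + 1 else 0, fun i => if i < N then c i else ∅,
    fun i => ?_, ⟨N, fun i hi => if_neg (not_lt.2 hi)⟩, fun a ha => ?_⟩
  · dsimp only
    split_ifs
    exacts [hc i, h0]
  · rw [sat_rename, hφ (fun _ => a) fun _ => ha]
    apply iff_of_eq
    congr 1
    funext i
    by_cases hi : i < N <;> simp [hi]

/-! ### Hulls are elementary -/

/-- `z` is a level of the constructible hierarchy. -/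
def IsLevel (z : ZFSet.{u}) : Prop := ∃ a, z = L a

lemma isLevel_L (a : Ordinal.{u}) : IsLevel (L a) := ⟨a, rfl⟩

/-- For a fixed formula, satisfaction in a set `v i` amounts to bounding its quantifiers by `v i`.
-/
lemma UDfn.sat_of_mem (ψ : Fm) (i : ℕ) (f : ℕ → ℕ) :
    UDfn.{u} fun _ _ v => Sat (v i) (fun _ => False) ψ fun k => v (f k) := by
  induction ψ generalizing i f with
  | mem i j => unfold Sat; infer_instance
  | lev i => unfold Sat; infer_instance
  | nand φ ψ h h' =>
    have := h i f
    have := h' i f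
    unfold Sat
    infer_instance
  | ex φ h =>
    have : UDfn.{u} fun _ _ v => Sat (v (i + 1)) (fun _ => False) φ
        (scons (v 0) fun k => v (f k + 1)) :=
      (h (i + 1) (scons 0 fun k => f k + 1)).congr fun _ _ _ v _ => by
        apply iff_of_eq
        congr 1
        funext k
        cases k <;> rfl
    exact UDfn.bex (Q := fun _ _ a v => Sat (v i) (fun _ => False) φ (scons a fun k => v (f k)))

lemma UDfn.sat_scons (ψ : Fm) (i : ℕ) (f : ℕ → ℕ) :
    UDfn.{u} fun _ _ v => Sat (v (i + 1)) (fun _ => False) ψ (scons (v 0) fun k => v (f k + 1)) :=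
  (UDfn.sat_of_mem ψ (i + 1) (scons 0 fun k => f k + 1)).congr fun _ _ _ v _ => by
    apply iff_of_eq
    congr 1
    funext k
    cases k <;> rfl

lemma Dfn.of_udfn' {x : ZFSet.{u}} {U : ZFSet.{u} → Prop} {B : Set ZFSet.{u}}
    (R : ZFSet.{u} → (ZFSet.{u} → Prop) → (ℕ → ZFSet.{u}) → Prop) [hR : UDfn R]
    (hx : x.IsTransitive) : Dfn x U B fun v => R x U v := by
  obtain ⟨φ, hφ⟩ := hR.1
  exact (of_sat φ Sum.inl (by simp)).congr fun v hv => hφ x hx U v hv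

/-- Every element of a level is definable from ordinals. -/
lemma mem_hull_ordinals {a b : Ordinal.{u}} (hb : b ≤ a) {z : ZFSet.{u}} (hz : z ∈ L b) :
    z ∈ hull (L a) IsLevel (a.toZFSet : Set ZFSet.{u}) := by
  induction b using WellFoundedLT.induction generalizing z with
  | ind b ih =>
    obtain ⟨c, hcb, hzc⟩ := mem_L_iff.1 hz
    have hca := hcb.trans_le hb
    have hord : c.toZFSet ∈ hull (L a) IsLevel (a.toZFSet : Set ZFSet.{u}) :=
      subset_hull (toZFSet_mem_toZFSet_iff.2 hca) (toZFSet_mem_L.2 hca)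
    -- `L c` is the only level that includes `c` without containing it; the predicate `IsLevel`
    -- makes this a definition from `c` inside `L a`.
    have hLc : L c ∈ hull (L a) IsLevel (a.toZFSet : Set ZFSet.{u}) := by
      refine mem_hull_of_udfn (R := fun _ U v => U (v 0) ∧ v 1 ⊆ v 0 ∧ v 1 ∉ v 0) inferInstance
        (L_transitive a) (c := fun _ => c.toZFSet) (fun _ => hord) (L_mem_L.2 hca) fun y hy => ?_
      constructor
      · rintro ⟨⟨d, rfl⟩, h1, h2⟩
        change c.toZFSet ⊆ L d at h1
        change c.toZFSet ∉ L d at h2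
        rw [toZFSet_mem_L, not_lt] at h2
        rcases h2.lt_or_eq with hdc | rfl
        · have := h1 (toZFSet_mem_toZFSet_iff.2 hdc)
          rw [toZFSet_mem_L] at this
          exact (lt_irrefl _ this).elim
        · rfl
      · rintro rfl
        exact ⟨isLevel_L c, toZFSet_subset_L le_rfl, fun h => lt_irrefl _ (toZFSet_mem_L.1 h)⟩
    rw [mem_Def_iff (L_transitive c)] at hzc
    obtain ⟨hzc, h⟩ := hzc
    have huniq : ∀ y ∈ L a, (∀ t ∈ L a, t ∈ y ↔ t ∈ z) → y = z := fun y hy h => by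
      ext t
      exact ⟨fun ht => (h t (L_trans hy ht)).1 ht,
        fun ht => (h t (L_mono hca.le (hzc ht))).2 ht⟩
    rcases h with h | ⟨ψ, d, hd, h⟩
    · refine mem_hull_of_udfn (R := fun _ _ v => v 0 = ∅) inferInstance
        (L_transitive a) (c := fun _ => c.toZFSet) (fun _ => hord) (L_mono hb hz) fun y hy => ?_
      have : z = ∅ := (ZFSet.eq_empty _).2 fun t ht => ZFSet.notMem_empty t (h ▸ hzc ht)
      rw [this]
      rfl
    · have hsat := UDfn.sat_scons.{u} ψ 1 (fun k => k + 2)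
      refine mem_hull_of_udfn (R := fun x _ v => ∀ t ∈ x, t ∈ v 0 ↔ t ∈ v 1 ∧
        Sat (v 1) (fun _ => False) ψ (scons t fun k => v (k + 2))) inferInstance
        (L_transitive a) (c := scons (L c) d)
        (scons_forall (p := (· ∈ hull _ _ _)) hLc fun i => ih c hcb hca.le (hd i)) (L_mono hb hz)
        fun y hy => ?_
      change (∀ t ∈ L a, t ∈ y ↔ t ∈ L c ∧ Sat (L c) (fun _ => False) ψ (scons t d)) ↔ _
      have hz' : ∀ t, t ∈ z ↔ t ∈ L c ∧ Sat (L c) (fun _ => False) ψ (scons t d) := fun t =>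
        ⟨fun ht => ⟨hzc ht, (h t (hzc ht)).1 ht⟩, fun ht => (h t ht.1).2 ht.2⟩
      simp only [← hz']
      exact ⟨huniq y hy, fun e t _ => by rw [e]⟩

/-- A nonempty set that is definable from elements of `B` meets the hull of `B`. -/
lemma exists_mem_hull {a : Ordinal.{u}} {B : Set ZFSet.{u}} {S : (ℕ → ZFSet.{u}) → Prop}
    (hS : Dfn (L a) IsLevel B S) (h : ∃ z ∈ L a, S fun _ => z) :
    ∃ z ∈ hull (L a) IsLevel B, S fun _ => z := by
  obtain ⟨z, hz, hSz⟩ := h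
  have hx := L_transitive a
  obtain ⟨F, hF, hP⟩ := (mem_hull.1 (mem_hull_ordinals le_rfl hz)).2.exists_finite
  suffices ∀ (l : List ZFSet.{u}) (z : ZFSet.{u}), (∀ c ∈ l, c ∈ a.toZFSet) → z ∈ L a →
      (S fun _ => z) → Dfn (L a) IsLevel ({c | c ∈ l} ∪ B) (fun v => v 0 = z) →
      ∃ z ∈ hull (L a) IsLevel B, S fun _ => z from
    this F.toList z (fun c hc => hF (by simpa using hc)) hz hSz
      (hP.mono fun c hc => .inl (by simpa using hc))
  intro l
  induction l with
  | nil => exact fun z _ hz hSz h => ⟨z, mem_hull.2 ⟨hz, h.mono (by simp)⟩, hSz⟩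
  | cons o l ih =>
    intro z hl hz hSz h
    have hoa : o ∈ a.toZFSet := hl o (by simp)
    have hol : o ∈ L a := toZFSet_subset_L le_rfl hoa
    have hP : Dfn (L a) IsLevel (insert o ({c | c ∈ l} ∪ B)) fun v => v 0 = z :=
      h.mono fun c hc => by simpa [or_assoc] using hc
    obtain ⟨Q, hQ, hQ'⟩ := hP.split hx hol
    -- `M b` says that `b`, put in place of the ordinal `o`, still defines an element of `S`. The
    -- least such `b` is definable from the remaining parameters, so the element it defines is too,
    -- and the list of ordinals gets shorter. The witness `z` changes on the way.
    let M : ZFSet.{u} → Prop := fun b => b.IsOrdinal ∧ ∃ z ∈ L a, (S fun _ => z) ∧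
      ∀ y ∈ L a, Q (scons b fun _ => y) ↔ y = z
    have hM : Dfn (L a) IsLevel ({c | c ∈ l} ∪ B) fun v => M (v 0) := by
      have h1 := Dfn.of_udfn' (U := IsLevel) (B := {c | c ∈ l} ∪ B)
        (fun _ _ v => (v 0).IsOrdinal) hx
      have h2 : Dfn (L a) IsLevel ({c | c ∈ l} ∪ B) fun v => S fun _ => v 0 :=
        (hS.mono (by simp)).rename fun _ => 0
      have h3 : Dfn (L a) IsLevel ({c | c ∈ l} ∪ B) fun v => Q (scons (v 2) fun _ => v 0) :=
        (hQ.rename (scons 2 fun _ => 0)).congr fun v _ => by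
          apply iff_of_eq
          congr 1
          funext k
          cases k <;> rfl
      have h4 := Dfn.of_udfn' (U := IsLevel) (B := {c | c ∈ l} ∪ B) (fun _ _ v => v 0 = v 1) hx
      exact h1.and (h2.and (h3.iff h4).all).ex
    have hMo : M o := by
      refine ⟨?_, z, hz, hSz, fun y hy => (hQ' (fun _ => y) fun _ => hy).symm⟩
      obtain ⟨b, -, rfl⟩ := mem_toZFSet_iff.1 hoa
      exact ZFSet.isOrdinal_toZFSet b
    have hex : ∃ b ∈ L a, M b ∧ ∀ c ∈ b, ¬ M c := by
      have : ∀ b : ZFSet.{u}, b ∈ L a → M b → ∃ b ∈ L a, M b ∧ ∀ c ∈ b, ¬ M c := by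
        intro b
        induction b using ZFSet.inductionOn with
        | h b ih' =>
          intro hb hMb
          by_cases hc : ∃ c ∈ b, M c
          · obtain ⟨c, hc, hMc⟩ := hc
            exact ih' c hc (L_trans hb hc) hMc
          · push Not at hc
            exact ⟨b, hb, hMb, hc⟩
      exact this o hol hMo
    obtain ⟨b, hb, hMb, hmin⟩ := hex
    have hbh : b ∈ hull (L a) IsLevel ({c | c ∈ l} ∪ B) := by
      have hd : Dfn (L a) IsLevel ({c | c ∈ l} ∪ B) fun v => M (v 0) ∧
          ∀ c ∈ L a, c ∈ v 0 → ¬ M c :=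
        hM.and ((Dfn.mem 0 1).imp hM.not).all
      refine hd.mem_hull hb fun v hv => ⟨fun ⟨h1, h2⟩ => ?_, fun e => ?_⟩
      · rcases ZFSet.IsOrdinal.mem_trichotomous h1.1 hMb.1 with h | h | h
        · exact (hmin _ h h1).elim
        · exact h
        · exact (h2 b hb h hMb).elim
      · rw [e]
        exact ⟨hMb, fun c _ hc => hmin c hc⟩
    obtain ⟨-, z', hz', hSz', hQz⟩ := hMb
    refine ih z' (fun c hc => hl c (by simp [hc])) hz' hSz' ?_
    have h5 : Dfn (L a) IsLevel ({c | c ∈ l} ∪ B) fun v =>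
        ∃ c ∈ L a, c = b ∧ Q (scons c fun _ => v 0) := by
      refine ((mem_hull.1 hbh).2.and (hQ.rename (scons 0 fun _ => 1))).ex.congr fun v _ => ?_
      refine exists_congr fun c => and_congr_right fun _ => and_congr_right fun _ => ?_
      apply iff_of_eq
      congr 1
      funext k
      cases k <;> rfl
    refine h5.congr fun v hv => ?_
    rw [← hQz _ (hv 0)]
    exact ⟨fun ⟨c, _, e, h⟩ => e ▸ h, fun h => ⟨b, hb, rfl, h⟩⟩

/-! ### The collapse -/

/-- The Mostowski collapse of `X`. -/
noncomputable def collapse (X z : ZFSet.{u}) : ZFSet.{u} :=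
  ZFSet.range fun w : (z ∩ X : ZFSet.{u}) => collapse X w.1
termination_by z
decreasing_by exact (ZFSet.mem_inter.1 w.2).1

lemma mem_collapse {X z y : ZFSet.{u}} :
    y ∈ collapse X z ↔ ∃ w ∈ X, w ∈ z ∧ y = collapse X w := by
  rw [collapse, ZFSet.mem_range]
  constructor
  · rintro ⟨⟨w, hw⟩, rfl⟩
    have := ZFSet.mem_inter.1 hw
    exact ⟨w, this.2, this.1, rfl⟩
  · rintro ⟨w, hw, hwz, rfl⟩
    exact ⟨⟨w, ZFSet.mem_inter.2 ⟨hwz, hw⟩⟩, rfl⟩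

/-- Satisfaction is preserved by the collapse of a subset satisfying the Tarski-Vaught criterion. -/
lemma sat_collapse {X x y : ZFSet.{u}} {U V : ZFSet.{u} → Prop}
    (htv : ∀ φ v, (∀ i, v i ∈ X ∧ v i ∈ x) → (∃ a ∈ x, Sat x U φ (scons a v)) →
      ∃ a ∈ X, a ∈ x ∧ Sat x U φ (scons a v))
    (hy : ∀ z, z ∈ y ↔ ∃ w ∈ X, w ∈ x ∧ z = collapse X w)
    (hU : ∀ w ∈ X, w ∈ x → (U w ↔ V (collapse X w)))
    (hm : ∀ a ∈ X, ∀ b ∈ X, collapse X a ∈ collapse X b ↔ a ∈ b)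
    (φ : Fm) {v : ℕ → ZFSet.{u}} (hv : ∀ i, v i ∈ X ∧ v i ∈ x) :
    Sat x U φ v ↔ Sat y V φ fun i => collapse X (v i) := by
  induction φ generalizing v with
  | mem i j => exact (hm _ (hv i).1 _ (hv j).1).symm
  | lev i => exact hU _ (hv i).1 (hv i).2
  | nand φ ψ h h' => exact not_congr (and_congr (h hv) (h' hv))
  | ex φ h =>
    have key : ∀ a ∈ X, a ∈ x → (Sat x U φ (scons a v) ↔
        Sat y V φ (scons (collapse X a) fun i => collapse X (v i))) := by
      intro a ha hax
      rw [h (scons_forall (p := fun z => z ∈ X ∧ z ∈ x) ⟨ha, hax⟩ hv)]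
      exact iff_of_eq (congrArg _ (scons_comp (collapse X) a v))
    constructor
    · intro h
      obtain ⟨a, ha, hax, h⟩ := htv φ v hv h
      exact ⟨_, (hy _).2 ⟨a, ha, hax, rfl⟩, (key a ha hax).1 h⟩
    · rintro ⟨b, hb, h⟩
      obtain ⟨a, ha, hax, rfl⟩ := (hy b).1 hb
      exact ⟨a, hax, (key a ha hax).2 h⟩

/-- `X` is an elementary substructure of `(L a, ∈, IsLevel)`, by the Tarski-Vaught criterion. -/
def Elementary (X : ZFSet.{u}) (a : Ordinal.{u}) : Prop :=
  X ⊆ L a ∧ ∀ φ v, (∀ i, v i ∈ X) → (∃ z ∈ L a, Sat (L a) IsLevel φ (scons z v)) →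
    ∃ z ∈ X, Sat (L a) IsLevel φ (scons z v)

/-- The assignment starting with the first `N` values of `d`, followed by `v`. -/
def app (N : ℕ) (d v : ℕ → ZFSet.{u}) : ℕ → ZFSet.{u} := fun i => if i < N then d i else v (i - N)

lemma app_zero (d v : ℕ → ZFSet.{u}) : app 0 d v = v := by
  funext i
  simp [app]

lemma app_scons (N : ℕ) (a : ZFSet.{u}) (d v : ℕ → ZFSet.{u}) :
    app (N + 1) (scons a d) v = scons a (app N d v) := by
  funext i
  cases i with
  | zero => simp [app]
  | succ i => simp [app]

lemma scons_eta (d : ℕ → ZFSet.{u}) : scons (d 0) (fun i => d (i + 1)) = d := by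
  funext i
  cases i <;> rfl

lemma elementary_hull {a : Ordinal.{u}} {B : Set ZFSet.{u}} : Elementary (hull (L a) IsLevel B) a :=
  ⟨fun z hz => (mem_hull.1 hz).1, fun φ v hv h => by
    refine exists_mem_hull (B := B) (S := fun w => Sat (L a) IsLevel φ (scons (w 0) v)) ?_ h
    refine (Dfn.of_sat φ (scons (.inl 0) fun i => .inr (v i)) fun i c h => ?_).congr fun w hw => ?_
    · cases i with
      | zero => cases h
      | succ i =>
        cases h
        exact hv i
    · apply iff_of_eq
      congr 1
      funext i
      cases i <;> rfl⟩

namespace Elementary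

variable {X : ZFSet.{u}} {a : Ordinal.{u}} (hX : Elementary X a)

include hX

lemma exists_of_udfn (R : ZFSet.{u} → (ZFSet.{u} → Prop) → (ℕ → ZFSet.{u}) → Prop) [hR : UDfn R]
    {v : ℕ → ZFSet.{u}} (hv : ∀ i, v i ∈ X) (h : ∃ z ∈ L a, R (L a) IsLevel (scons z v)) :
    ∃ z ∈ X, R (L a) IsLevel (scons z v) := by
  obtain ⟨φ, hφ⟩ := hR.1
  have hva := fun i => hX.1 (hv i)
  obtain ⟨z, hz, h⟩ := h
  obtain ⟨z, hz, h⟩ := hX.2 φ v hv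
    ⟨z, hz, (hφ _ (L_transitive a) _ _ (scons_forall (p := (· ∈ L a)) hz hva)).2 h⟩
  exact ⟨z, hz, (hφ _ (L_transitive a) _ _ (scons_forall (p := (· ∈ L a)) (hX.1 hz) hva)).1 h⟩

/-- Tarski–Vaught for a block of `N` existential quantifiers, handled one variable at a time. -/
lemma exists_app (N : ℕ) (R : ZFSet.{u} → (ZFSet.{u} → Prop) → (ℕ → ZFSet.{u}) → Prop)
    [hR : UDfn R] {v d : ℕ → ZFSet.{u}} (hv : ∀ i, v i ∈ X) (hd : ∀ i, d i ∈ L a)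
    (h : R (L a) IsLevel (app N d v)) :
    ∃ d : ℕ → ZFSet.{u}, (∀ i, d i ∈ X) ∧ R (L a) IsLevel (app N d v) := by
  induction N generalizing R d with
  | zero =>
    rw [app_zero] at h
    exact ⟨v, hv, by rwa [app_zero]⟩
  | succ N ih =>
    have hR' : UDfn fun x U v => ∃ z ∈ x, R x U (scons z v) := by
      have : UDfn fun x U v => R x U (scons (v 0) fun k => v (k + 1)) :=
        hR.congr fun _ _ _ v _ => by rw [scons_eta]
      exact UDfn.ex (Q := fun x U z v => R x U (scons z v))
    rw [← scons_eta d, app_scons] at h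
    obtain ⟨d', hd', h'⟩ := ih (fun x U v => ∃ z ∈ x, R x U (scons z v))
      (fun i => hd (i + 1)) ⟨d 0, hd 0, h⟩
    have hav : ∀ i, app N d' v i ∈ X := fun i => by
      unfold app
      split_ifs
      exacts [hd' i, hv _]
    obtain ⟨z, hz, h⟩ := hX.exists_of_udfn R hav h'
    exact ⟨scons z d', scons_forall (p := (· ∈ X)) hz hd', by rwa [app_scons]⟩

lemma mem_of_mem_diff {b c : ZFSet.{u}} (hb : b ∈ X) (hc : c ∈ X) (h : ∃ t ∈ b, t ∉ c) :
    ∃ t ∈ X, t ∈ b ∧ t ∉ c := by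
  obtain ⟨t, htb, htc⟩ := h
  exact hX.exists_of_udfn (fun _ _ v => v 0 ∈ v 1 ∧ v 0 ∉ v 2) (v := scons b fun _ => c)
    (scons_forall (p := (· ∈ X)) hb fun _ => hc) ⟨t, L_trans (hX.1 hb) htb, htb, htc⟩

/-- Elementarity makes `X` extensional: distinct elements of `X` are told apart by an element of
`X`. -/
lemma collapse_injOn {b c : ZFSet.{u}} (hb : b ∈ X) (hc : c ∈ X)
    (h : collapse X b = collapse X c) : b = c := by
  induction b using ZFSet.inductionOn generalizing c with
  | h b ih =>
    by_contra hne
    by_cases hbc : ∃ t ∈ b, t ∉ c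
    · obtain ⟨t, ht, htb, htc⟩ := hX.mem_of_mem_diff hb hc hbc
      have : collapse X t ∈ collapse X c := h ▸ mem_collapse.2 ⟨t, ht, htb, rfl⟩
      obtain ⟨s, hs, hsc, e⟩ := mem_collapse.1 this
      exact htc (ih t htb ht hs e ▸ hsc)
    · by_cases hcb : ∃ t ∈ c, t ∉ b
      · obtain ⟨t, ht, htc, htb⟩ := hX.mem_of_mem_diff hc hb hcb
        have : collapse X t ∈ collapse X b := h.symm ▸ mem_collapse.2 ⟨t, ht, htc, rfl⟩
        obtain ⟨s, hs, hsb, e⟩ := mem_collapse.1 this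
        exact htb (ih s hsb hs ht e.symm ▸ hsb)
      · push Not at hbc hcb
        exact hne (ZFSet.ext fun t => ⟨hbc t, hcb t⟩)

lemma collapse_mem_collapse {b c : ZFSet.{u}} (hb : b ∈ X) :
    collapse X b ∈ collapse X c ↔ b ∈ c := by
  constructor
  · intro h
    obtain ⟨t, ht, htc, e⟩ := mem_collapse.1 h
    exact hX.collapse_injOn hb ht e ▸ htc
  · exact fun h => mem_collapse.2 ⟨b, hb, h, rfl⟩

/-- For the least `c` with `w ∈ Def (L c)`, the set `L c` is the largest level not containing `w`.
This defines it from `w`, so it belongs to `X`. -/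
lemma exists_level {b : Ordinal.{u}} (hb : b ≤ a) {w : ZFSet.{u}} (hw : w ∈ X) (hwb : w ∈ L b) :
    ∃ c < b, L c ∈ X ∧ w ∈ Def (L c) ∧ w ∉ L c := by
  obtain ⟨c, ⟨hcb, hwc⟩, hmin⟩ : ∃ c, (c < b ∧ w ∈ Def (L c)) ∧
      ∀ d < c, ¬ (d < b ∧ w ∈ Def (L d)) := by
    have h := mem_L_iff.1 hwb
    exact ⟨sInf {c | c < b ∧ w ∈ Def (L c)}, csInf_mem h, fun d hd =>
      notMem_of_lt_csInf' (s := {c | c < b ∧ w ∈ Def (L c)}) hd⟩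
  have hwc' : w ∉ L c := by
    intro h
    obtain ⟨d, hd, hwd⟩ := mem_L_iff.1 h
    exact hmin d hd ⟨hd.trans hcb, hwd⟩
  have hmax : ∀ d, w ∉ L d → d ≤ c := by
    intro d hd
    by_contra hcd
    exact hd (mem_L_iff.2 ⟨c, not_le.1 hcd, hwc⟩)
  obtain ⟨y, hy, ⟨d, rfl⟩, hwd, hd⟩ := hX.exists_of_udfn (fun x U v => U (v 0) ∧ v 1 ∉ v 0 ∧
    ∀ y ∈ x, U y → v 1 ∉ y → y = v 0 ∨ y ∈ v 0) (v := fun _ => w) (fun _ => hw)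
    ⟨L c, L_mem_L.2 (hcb.trans_le hb), isLevel_L c, hwc', by
      rintro y - ⟨d, rfl⟩ hwd
      rcases (hmax d hwd).lt_or_eq with h | rfl
      exacts [.inr (L_mem_L.2 h), .inl rfl]⟩
  replace hd : ∀ y ∈ L a, IsLevel y → w ∉ y → y = L d ∨ y ∈ L d := hd
  have hdc : d ≤ c := hmax d hwd
  have hcd : c ≤ d := by
    rcases hd (L c) (L_mem_L.2 (hcb.trans_le hb)) (isLevel_L c) hwc' with h | h
    · exact (L_injective h).le
    · exact (L_mem_L.1 h).le
  rw [le_antisymm hdc hcd] at hy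
  exact ⟨c, hcb, hy, hwc, hwc'⟩

/-- Since `L b ∈ X`, the quantifiers of `φ` over `L b` are bounded by an element of `X`, and
elementarity of `X` supplies the Tarski–Vaught witnesses inside `L b`. -/
lemma sat_collapse_L {b c : Ordinal.{u}} (hb : L b ∈ X)
    (hc : ∀ y, y ∈ L c ↔ ∃ w ∈ X, w ∈ L b ∧ y = collapse X w) (φ : Fm) {v : ℕ → ZFSet.{u}}
    (hv : ∀ i, v i ∈ X ∧ v i ∈ L b) : Sat (L b) (fun _ => False) φ v ↔
      Sat (L c) (fun _ => False) φ fun i => collapse X (v i) := by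
  refine sat_collapse (V := fun _ => False) (fun φ v hv h => ?_) hc (fun _ _ _ => Iff.rfl)
    (fun s hs _ _ => hX.collapse_mem_collapse hs) φ hv
  obtain ⟨z, hz, h⟩ := h
  have hsat := UDfn.sat_scons.{u} φ 0 (fun k => k + 1)
  have : UDfn.{u} fun _ _ v => v 0 ∈ v 1 ∧
      Sat (v 1) (fun _ => False) φ (scons (v 0) fun k => v (k + 2)) := inferInstance
  exact hX.exists_of_udfn (fun _ _ v => v 0 ∈ v 1 ∧
      Sat (v 1) (fun _ => False) φ (scons (v 0) fun k => v (k + 2))) (v := scons (L b) v)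
    (scons_forall (p := (· ∈ X)) hb fun i => (hv i).1) ⟨z, L_trans (hX.1 hb) hz, hz, h⟩

end Elementary

lemma UDfn.ball_lt {P : ℕ → ZFSet.{u} → (ZFSet.{u} → Prop) → (ℕ → ZFSet.{u}) → Prop}
    (hP : ∀ i, UDfn (P i)) (N : ℕ) : UDfn fun x U v => ∀ i < N, P i x U v := by
  induction N with
  | zero => exact UDfn.congr (P := fun _ _ _ => True) inferInstance fun _ _ _ _ _ => by simp
  | succ N ih =>
    have := hP N
    exact UDfn.congr (P := fun x U v => (∀ i < N, P i x U v) ∧ P N x U v) inferInstance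
      fun _ _ _ _ _ => Nat.forall_lt_succ_right.symm

namespace Elementary

variable {X : ZFSet.{u}} {a : Ordinal.{u}} (hX : Elementary X a)

include hX

/-- The collapse commutes with `Def`. A set defined over `L b` from parameters in `X` is in `X` by
elementarity; conversely, if some parameters define `w ∈ X` over `L b`, then parameters in `X` do.
-/
lemma mem_Def_collapse {b c : Ordinal.{u}} (hb : L b ∈ X)
    (hc : ∀ y, y ∈ L c ↔ ∃ w ∈ X, w ∈ L b ∧ y = collapse X w) {y : ZFSet.{u}} :
    y ∈ Def (L c) ↔ ∃ w ∈ X, w ∈ Def (L b) ∧ y = collapse X w := by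
  have hba : b < a := L_mem_L.1 (hX.1 hb)
  rw [mem_Def_iff (L_transitive c)]
  simp only [mem_Def_iff (L_transitive b)]
  constructor
  · rintro ⟨hy, h⟩
    rcases h with h | ⟨φ, v, hv, h⟩
    · refine ⟨L b, hb, (mem_Def_iff (L_transitive b)).1 (self_mem_Def _), ?_⟩
      ext t
      rw [mem_collapse, ← hc]
      exact ⟨fun ht => hy ht, fun ht => (ZFSet.notMem_empty t (h ▸ ht)).elim⟩
    · choose d hd hdb e using fun i => (hc _).1 (hv i)
      have hmem : ∀ t, t ∈ (L b).sep (fun t => Sat (L b) (fun _ => False) φ (scons t d)) ↔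
        t ∈ L b ∧ Sat (L b) (fun _ => False) φ (scons t d) := fun t => ZFSet.mem_sep
      set w := (L b).sep (fun t => Sat (L b) (fun _ => False) φ (scons t d))
      have hwDef : w ∈ Def (L b) := mem_Def_of_sat (fun t ht => ((hmem t).1 ht).1) φ d hdb
        fun t ht => by rw [hmem, and_iff_right ht]
      have hwa : w ∈ L a := mem_L_iff.2 ⟨b, hba, hwDef⟩
      have hsat := UDfn.sat_scons.{u} φ 1 (fun k => k + 2)
      obtain ⟨w', hw', h'⟩ := hX.exists_of_udfn (fun x _ v => ∀ t ∈ x, t ∈ v 0 ↔ t ∈ v 1 ∧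
        Sat (v 1) (fun _ => False) φ (scons t fun k => v (k + 2))) (v := scons (L b) d)
        (scons_forall (p := (· ∈ X)) hb hd) ⟨w, hwa, fun t _ => hmem t⟩
      replace h' : ∀ t ∈ L a, t ∈ w' ↔ t ∈ L b ∧ Sat (L b) (fun _ => False) φ (scons t d) := h'
      obtain rfl : w' = w := by
        ext t
        rw [hmem]
        exact ⟨fun ht => (h' t (L_trans (hX.1 hw') ht)).1 ht,
          fun ht => (h' t (L_mono hba.le ht.1)).2 ht⟩
      refine ⟨w, hw', (mem_Def_iff (L_transitive b)).1 hwDef, ?_⟩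
      have key : ∀ t ∈ X, t ∈ L b → (collapse X t ∈ y ↔ t ∈ w) := by
        intro t ht htb
        rw [h _ ((hc _).2 ⟨t, ht, htb, rfl⟩), hmem, and_iff_right htb, hX.sat_collapse_L hb hc φ
          (scons_forall (p := fun z => z ∈ X ∧ z ∈ L b) ⟨ht, htb⟩ fun i => ⟨hd i, hdb i⟩)]
        refine iff_of_eq (congrArg _ ?_)
        funext i
        cases i with
        | zero => rfl
        | succ i => exact e i
      ext s
      rw [mem_collapse]
      constructor
      · intro hs
        obtain ⟨t, ht, htb, rfl⟩ := (hc s).1 (hy hs)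
        exact ⟨t, ht, (key t ht htb).1 hs, rfl⟩
      · rintro ⟨t, ht, htw, rfl⟩
        exact (key t ht ((hmem t).1 htw).1).2 htw
  · rintro ⟨w, hw, ⟨hwb, h⟩, rfl⟩
    refine ⟨fun s hs => ?_, ?_⟩
    · obtain ⟨t, ht, htw, rfl⟩ := mem_collapse.1 hs
      exact (hc _).2 ⟨t, ht, hwb htw, rfl⟩
    rcases h with h | ⟨φ, v, hv, h⟩
    · refine .inl ((ZFSet.eq_empty _).2 fun s hs => ?_)
      obtain ⟨t, -, ht, -⟩ := (hc s).1 hs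
      exact ZFSet.notMem_empty t (h ▸ ht)
    · right
      obtain ⟨N, hN⟩ := exists_sat_bound.{u} φ
      have hb0 : 0 < b := by
        rw [pos_iff_ne_zero]
        rintro rfl
        exact ZFSet.notMem_empty _ (L_zero ▸ hv 0)
      have h0b := empty_mem_L hb0
      have h0X : ∅ ∈ X := by
        obtain ⟨z, hz, e⟩ := hX.exists_of_udfn (fun _ _ v => v 0 = ∅) (v := fun _ => w)
          (fun _ => hw) ⟨∅, L_mono hba.le h0b, rfl⟩
        exact e ▸ hz
      have h1 : UDfn.{u} fun _ _ v => ∀ i < N, v i ∈ v (N + 1) :=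
        UDfn.ball_lt (P := fun i _ _ v => v i ∈ v (N + 1)) (fun i => UDfn.mem) N
      have h2 := UDfn.sat_scons.{u} φ (N + 1) (fun k => k)
      -- Only the first `N` parameters matter to `φ`, so "they lie in `L b` and define `w`" is one
      -- formula about `w` and `L b`, to which elementarity applies.
      obtain ⟨d, hd, h3, h4⟩ := hX.exists_app N (fun x _ v => (∀ i < N, v i ∈ v (N + 1)) ∧
          ∀ z ∈ x, z ∈ v (N + 1) → (z ∈ v N ↔
            Sat (v (N + 1)) (fun _ => False) φ (scons z fun k => v k)))
        (v := scons w fun _ => L b) (d := v) (scons_forall (p := (· ∈ X)) hw fun _ => hb)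
        (fun i => L_mono hba.le (hv i)) (by
          have e0 : app N v (scons w fun _ => L b) N = w := by simp [app]
          have e1 : app N v (scons w fun _ => L b) (N + 1) = L b := by simp [app]
          simp only [e0, e1]
          refine ⟨fun i hi => ?_, fun z _ hz => ?_⟩
          · simpa [app, hi] using hv i
          · rw [h z hz]
            refine hN _ _ _ _ fun i hi => ?_
            cases i with
            | zero => rfl
            | succ i => simp [app, show i < N by omega])
      have e0 : app N d (scons w fun _ => L b) N = w := by simp [app]
      have e1 : app N d (scons w fun _ => L b) (N + 1) = L b := by simp [app]
      simp only [e0, e1] at h3 h4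
      have hd' : ∀ i, (if i < N then d i else ∅) ∈ X ∧ (if i < N then d i else ∅) ∈ L b := by
        intro i
        split_ifs with hi
        · have := h3 i hi
          simp only [app, hi, if_true] at this
          exact ⟨hd i, this⟩
        · exact ⟨h0X, h0b⟩
      refine ⟨φ, fun i => collapse X (if i < N then d i else ∅),
        fun i => (hc _).2 ⟨_, (hd' i).1, (hd' i).2, rfl⟩, fun s hs => ?_⟩
      obtain ⟨t, ht, htb, rfl⟩ := (hc s).1 hs
      rw [hX.collapse_mem_collapse ht, h4 t (L_mono hba.le htb) htb]
      have h5 := hX.sat_collapse_L hb hc φ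
        (scons_forall (p := fun z => z ∈ X ∧ z ∈ L b) ⟨ht, htb⟩ hd')
      rw [show (fun i => collapse X (scons t (fun i => if i < N then d i else ∅) i)) =
        scons (collapse X t) fun i => collapse X (if i < N then d i else ∅) from
          scons_comp (collapse X) t _] at h5
      rw [← h5]
      refine hN _ _ _ _ fun i hi => ?_
      cases i with
      | zero => rfl
      | succ i => simp [app, show i < N by omega]

/-- By `exists_level`, `X ∩ L b` is the union of the sets `X ∩ Def (L c)` over `c < b` with `L c ∈
X`. Inductively these collapse to sets `Def (L d)`, whose union is a level. The case `b = a` is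
admitted separately because `L a` is not in `X`. -/
lemma exists_collapse_L (b : Ordinal.{u}) (hb : b = a ∨ L b ∈ X) :
    ∃ c ≤ b, ∀ y, y ∈ L c ↔ ∃ w ∈ X, w ∈ L b ∧ y = collapse X w := by
  induction b using WellFoundedLT.induction with
  | ind b ih =>
    have hba : b ≤ a := hb.elim (fun e => e.le) fun h => (L_mem_L.1 (hX.1 h)).le
    choose! f hf hf' using fun c (h : c < b ∧ L c ∈ X) => ih c h.1 (.inr h.2)
    have key : ∀ y, (∃ w ∈ X, w ∈ L b ∧ y = collapse X w) ↔
        ∃ d ∈ f '' {c | c < b ∧ L c ∈ X}, y ∈ Def (L d) := by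
      intro y
      constructor
      · rintro ⟨w, hw, hwb, rfl⟩
        obtain ⟨c, hcb, hc, hwc, -⟩ := hX.exists_level hba hw hwb
        exact ⟨_, ⟨c, ⟨hcb, hc⟩, rfl⟩, (hX.mem_Def_collapse hc (hf' c ⟨hcb, hc⟩)).2
          ⟨w, hw, hwc, rfl⟩⟩
      · rintro ⟨_, ⟨c, hc, rfl⟩, hy⟩
        obtain ⟨w, hw, hwc, rfl⟩ := (hX.mem_Def_collapse hc.2 (hf' c hc)).1 hy
        exact ⟨w, hw, mem_L_iff.2 ⟨c, hc.1, hwc⟩, rfl⟩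
    obtain ⟨e, he, h⟩ := exists_eq_L (Z := f '' {c | c < b ∧ L c ∈ X}) (c := b) (by
      rintro _ ⟨c, hc, rfl⟩
      exact (hf c hc).trans_lt hc.1) (w := collapse X (L b)) fun y => by
        rw [mem_collapse, key]
    refine ⟨e, he, fun y => ?_⟩
    rw [← h, mem_collapse]

/-- The condensation lemma. -/
theorem condensation : ∃ d ≤ a, (∀ y, y ∈ L d ↔ ∃ w ∈ X, y = collapse X w) ∧
    ∀ (φ : Fm) (v : ℕ → ZFSet.{u}), (∀ i, v i ∈ X) →
      (Sat (L a) IsLevel φ v ↔ Sat (L d) IsLevel φ fun i => collapse X (v i)) := by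
  obtain ⟨d, hda, hd⟩ := hX.exists_collapse_L a (.inl rfl)
  refine ⟨d, hda, fun y => ?_, fun φ v hv => ?_⟩
  · rw [hd]
    exact ⟨fun ⟨w, hw, h⟩ => ⟨w, hw, h.2⟩, fun ⟨w, hw, h⟩ => ⟨w, hw, hX.1 hw, h⟩⟩
  refine sat_collapse (fun φ v hv h => ?_) hd (fun w hw hwa => ?_)
    (fun s hs _ _ => hX.collapse_mem_collapse hs) φ fun i => ⟨hv i, hX.1 (hv i)⟩
  · obtain ⟨z, hz, h⟩ := hX.2 φ v (fun i => (hv i).1) h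
    exact ⟨z, hz, hX.1 hz, h⟩
  · have hL : ∀ b, L b ∈ X → ∃ c, (∀ y, y ∈ L c ↔ ∃ w ∈ X, w ∈ L b ∧ y = collapse X w) ∧
        collapse X (L b) = L c := by
      intro b hb
      obtain ⟨c, -, hc⟩ := hX.exists_collapse_L b (.inr hb)
      exact ⟨c, hc, ZFSet.ext fun y => by rw [mem_collapse, hc]⟩
    constructor
    · rintro ⟨b, rfl⟩
      obtain ⟨c, -, e⟩ := hL b hw
      exact ⟨c, e⟩
    -- Let `w` collapse to `L s`, and take `L b ∈ X` with `w` in `Def (L b)` but not in `L b`. Then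
    -- `L s` lies in `Def (L c)` but not in `L c`, the collapse of `L b`; so `s = c`, and `w = L b`
    -- by injectivity.
    · rintro ⟨s, hs⟩
      obtain ⟨b, hba, hb, hwb, hwb'⟩ := hX.exists_level le_rfl hw hwa
      obtain ⟨c, hc, e⟩ := hL b hb
      have h1 : L s ∈ Def (L c) := hs ▸ (hX.mem_Def_collapse hb hc).2 ⟨w, hw, hwb, rfl⟩
      have h2 : L s ∉ L c := by
        rw [← e, ← hs, hX.collapse_mem_collapse hw]
        exact hwb'
      rw [L_mem_L, not_lt] at h2
      rw [← L_add_one, L_mem_L, Order.lt_add_one_iff] at h1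
      rw [le_antisymm h1 h2, ← e] at hs
      exact ⟨b, hX.collapse_injOn hw hb hs⟩

end Elementary

/-! ### Counting a hull -/

lemma asg_mem_finSubsets {B : Set ZFSet.{u}} (hB : ∀ n : ℕ, nat n ∈ B) {v : ℕ → ZFSet.{u}}
    (hv : ∀ i, v i ∈ B) (hvs : FinSupp v) : asg v ∈ finSubsets (finSubsets (finSubsets B)) := by
  obtain ⟨N, hN⟩ := hvs
  refine ⟨((Set.finite_lt_nat N).image fun i => ZFSet.pair (nat i) (v i)).subset
    fun p hp => ?_, fun p hp => ?_⟩
  · obtain ⟨i, hi, rfl⟩ := mem_asg.1 hp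
    exact ⟨i, not_le.1 fun h => hi (hN i h), rfl⟩
  · obtain ⟨i, -, rfl⟩ := mem_asg.1 hp
    exact pair_mem_finSubsets (hB i) (hv i)

/-- `s` codes a formula together with parameters, and they define `z`. -/
def CodeDefines (W o pr x Us s z : ZFSet.{u}) : Prop :=
  ∃ n ∈ o, ∃ r ∈ W, AsgOf o x r ∧ ConsOf o x s n r ∧
    ∀ w ∈ x, (∃ q ∈ W, ConsOf o x q w r ∧ SatCode W o pr x Us n q) ↔ w = z

instance UDfn.codeDefines {i1 i2 i3 i4 i5 i6 : ℕ} : UDfn.{u} fun x _ v =>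
    CodeDefines x (v i1) (v i2) (v i3) (v i4) (v i5) (v i6) := by
  unfold CodeDefines
  infer_instance

/-- An element of the hull is determined by a formula code and finitely many parameters from `B`,
stored together as `asg (scons (nat n) v)`, a member of the third iterate of `finSubsets` on `B`.
That iterate is covered from `k`, and the decoding relation is in `L l` because satisfaction for `(L
c, ∈, levels c)` is definable over `L (d + 4)`. -/
lemma onto_hull {l k c : Ordinal.{u}} (hl : Order.IsSuccLimit l) (hk : ω ≤ k) (hkl : k < l)
    (hc : ω < c) (hcl : c < l) {B : Set ZFSet.{u}} (hBn : ∀ n : ℕ, nat n ∈ B) (hB : B ⊆ L c)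
    (h : Onto l k B) : Onto l k (hull (L c) IsLevel B : Set ZFSet.{u}) := by
  have hfin := onto_finSubsets hl k hk hkl
  have h3 := Onto.fin hl hfin (Onto.fin hl hfin (Onto.fin hl hfin h))
  have hω : ω + ω ≤ l := add_omega0_le hl (hk.trans_lt hkl)
  have hx : ∅ ∈ L c := empty_mem_L (omega0_pos.trans hc)
  have hn0 : nat 0 = (∅ : ZFSet.{u}) := nat_zero
  obtain ⟨d, hd, hdp⟩ := exists_level hl [unpairGraph, levels c, L (c + 3)] (by
    simp only [List.mem_cons, List.not_mem_nil, or_false, forall_eq_or_imp, forall_eq]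
    exact ⟨L_mono hω unpairGraph_mem_L, L_mono (add_omega0_le hl hcl) (levels_mem_L c),
      L_mem_L.2 (add_nat_lt hl hcl 3)⟩)
  have hcd : c + 3 < d := L_mem_L.1 (hdp _ (by simp))
  have hcd' : c < d := le_self_add.trans_lt hcd
  have hW : ∀ v : ℕ → ZFSet.{u}, (∀ i, v i ∈ L c) → FinSupp v → asg v ∈ L d := fun v hv hvs =>
    L_mono hcd.le (asg_mem_L hc.le hvs hv)
  have hd4 : d < d + 4 := lt_add_of_pos_right d (by norm_num)
  have hW' : ∀ v : ℕ → ZFSet.{u}, (∀ i, v i ∈ L c) → FinSupp v → asg v ∈ L (d + 4) :=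
    fun v hv hvs => L_mono hd4.le (hW v hv hvs)
  have hsat : ∀ (n : ℕ) (v : ℕ → ZFSet.{u}), (∀ i, v i ∈ L c) → FinSupp v → ∀ w ∈ L c,
      ((∃ q ∈ L (d + 4), ConsOf om (L c) q w (asg v) ∧
        SatCode (L (d + 4)) om unpairGraph (L c) (levels c) (nat n) q) ↔
      Sat (L c) IsLevel (decode.{u} n) (scons w v)) := by
    intro n v hv hvs w hw
    have hwv := scons_forall (p := (· ∈ L c)) hw hv
    rw [exists_consOf_iff hx hW' hv hvs hw, satCode_iff le_rfl hx (L_mem_L.2 hcd') (hdp _ (by simp))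
      (om_mem_L.2 (hc.trans hcd')) hW n hwv (hvs.scons w)]
    refine sat_congr_pred (fun z hz => ?_) _ hwv
    rw [mem_levels]
    constructor
    · rintro ⟨b, -, rfl⟩
      exact isLevel_L b
    · rintro ⟨b, rfl⟩
      exact ⟨b, L_mem_L.1 hz, rfl⟩
  have hdef : ∀ s z, CodeDefines (L (d + 4)) om unpairGraph (L c) (levels c) s z ↔
      ∃ (n : ℕ) (v : ℕ → ZFSet.{u}), (∀ i, v i ∈ L c) ∧ FinSupp v ∧ s = asg (scons (nat n) v) ∧
        ∀ w ∈ L c, Sat (L c) IsLevel (decode.{u} n) (scons w v) ↔ w = z := by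
    intro s z
    constructor
    · rintro ⟨n, hn, r, -, hr, hs, h⟩
      obtain ⟨n, rfl⟩ := mem_om.1 hn
      obtain ⟨v, hv, hvs, rfl⟩ := (asgOf_iff hx).1 hr
      obtain ⟨v', hv', hvs', rfl⟩ := (asgOf_iff hx).1 hs.1
      rw [consOf_asg hx hv hv' hvs'] at hs
      exact ⟨n, v, hv, hvs, by rw [hs], fun w hw => (hsat n v hv hvs w hw).symm.trans (h w hw)⟩
    · rintro ⟨n, v, hv, hvs, rfl, h⟩
      have hnv := scons_forall (p := (· ∈ L c)) (nat_mem_L hc.le n) hv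
      exact ⟨_, nat_mem_om n, _, hW' v hv hvs, (asgOf_iff hx).2 ⟨v, hv, hvs, rfl⟩,
        (consOf_asg hx hv hnv (hvs.scons _)).2 rfl,
        fun w hw => (hsat n v hv hvs w hw).trans (h w hw)⟩
  let R : ZFSet.{u} := (L (d + 4)).sep fun p => ∃ s ∈ L d, ∃ z ∈ L c, p = ZFSet.pair s z ∧
    CodeDefines (L (d + 4)) om unpairGraph (L c) (levels c) s z
  have hR : R ∈ L (d + 4 + 1) := by
    refine sep_mem_L_add_one (P := fun x _ v => ∃ s ∈ v 1, ∃ z ∈ v 4, v 0 = ZFSet.pair s z ∧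
      CodeDefines x (v 2) (v 3) (v 4) (v 5) s z) inferInstance
      [om, unpairGraph, L c, levels c] (p := L d) (L_mem_L.2 hd4) ?_ fun z => ZFSet.mem_sep
    simp only [List.mem_cons, List.not_mem_nil, or_false, forall_eq_or_imp, forall_eq]
    exact ⟨om_mem_L.2 ((hc.trans hcd').trans hd4), L_mono hd4.le (hdp _ (by simp)),
      L_mem_L.2 (hcd'.trans hd4), L_mono hd4.le (hdp _ (by simp))⟩
  have hRm : ∀ s z, ZFSet.pair s z ∈ R ↔ ZFSet.pair s z ∈ L (d + 4) ∧ s ∈ L d ∧ z ∈ L c ∧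
      CodeDefines (L (d + 4)) om unpairGraph (L c) (levels c) s z := by
    intro s z
    rw [ZFSet.mem_sep]
    refine and_congr_right fun _ => ?_
    constructor
    · rintro ⟨s', hs, z', hz, e, h⟩
      rw [ZFSet.pair_inj] at e
      obtain ⟨rfl, rfl⟩ := e
      exact ⟨hs, hz, h⟩
    · rintro ⟨hs, hz, h⟩
      exact ⟨s, hs, z, hz, rfl, h⟩
  refine Onto.comp hl h3 (L_mono (hl.add_one_lt (add_nat_lt hl hd 4)).le hR) ?_ ?_
  · intro s z z' h1 h2
    obtain ⟨-, -, hz, h1⟩ := (hRm s z).1 h1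
    obtain ⟨-, -, hz', h2⟩ := (hRm s z').1 h2
    obtain ⟨n, v, hv, hvs, rfl, g1⟩ := (hdef _ _).1 h1
    obtain ⟨m, v', hv', hvs', e, g2⟩ := (hdef _ _).1 h2
    have := asg_injective (x := L c) (scons_forall (p := (· ∈ L c)) (nat_mem_L hc.le n) hv)
      (scons_forall (p := (· ∈ L c)) (nat_mem_L hc.le m) hv') e
    have hnm : n = m := nat_injective (congrFun this 0)
    have hvv : v = v' := funext fun i => congrFun this (i + 1)
    subst hnm hvv
    exact (g2 z hz).1 ((g1 z hz).2 rfl)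
  · intro z hz
    have hz : z ∈ hull (L c) IsLevel B := hz
    obtain ⟨φ, v, hv, hvs, h⟩ :=
      exists_fm_of_mem_hull (L_transitive c) (hn0 ▸ hBn 0) hB hz
    obtain ⟨n, rfl⟩ := decode_surjective.{u} φ
    have hnv := scons_forall (p := (· ∈ B)) (hBn n) hv
    have hs := hW _ (fun i => hB (hnv i)) (hvs.scons _)
    have hzc := (mem_hull.1 hz).1
    refine ⟨_, asg_mem_finSubsets hBn hnv (hvs.scons _), (hRm _ _).2 ⟨?_, hs, hzc,
      (hdef _ _).2 ⟨n, v, fun i => hB (hv i), hvs, rfl, h⟩⟩⟩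
    have : d + 2 ≤ d + 4 := by gcongr; norm_num
    exact L_mono this (pair_mem_L hs (L_mono hcd'.le hzc))

/-! ### Bounded subsets and reflection at a successor cardinal -/

lemma collapse_eq_self {X z : ZFSet.{u}} (h : ∀ t ∈ z, t ∈ X ∧ collapse X t = t) :
    collapse X z = z := by
  ext t
  rw [mem_collapse]
  constructor
  · rintro ⟨w, -, hwz, rfl⟩
    rwa [(h w hwz).2]
  · intro ht
    exact ⟨t, (h t ht).1, ht, (h t ht).2.symm⟩

lemma collapse_eq_self_of_subset {X y : ZFSet.{u}} (hy : y.IsTransitive) (hX : y ⊆ X)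
    {z : ZFSet.{u}} (hz : z ∈ y) : collapse X z = z := by
  induction z using ZFSet.inductionOn with
  | h z ih =>
    exact collapse_eq_self fun t ht => ⟨hX (hy _ hz ht), ih t ht (hy _ hz ht)⟩

lemma mem_hull_of_sat {x : ZFSet.{u}} {U : ZFSet.{u} → Prop} {B : Set ZFSet.{u}} (φ : Fm)
    {c : ℕ → ZFSet.{u}} (hc : ∀ i, c i ∈ B) (hB : B ⊆ x) {z : ZFSet.{u}} (hz : z ∈ x)
    (h : ∀ a ∈ x, Sat x U φ (scons a c) ↔ a = z) : z ∈ hull x U B := by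
  refine (Dfn.of_sat (B := B) (x := x) (U := U) φ (scons (.inl 0) fun i => .inr (c i))
    fun i d h => ?_).mem_hull hz fun v hv => ?_
  · cases i with
    | zero => cases h
    | succ i =>
      cases h
      exact subset_hull (hc i) (hB (hc i))
  · rw [← h _ (hv 0)]
    apply iff_of_eq
    congr 1
    funext i
    cases i <;> rfl

section

variable {l k m : Ordinal.{u}} (hl : Order.IsSuccLimit l) (hk : ω ≤ k) (hkm : k < m) (hml : m < l)

include hl hk hkm hml

lemma Onto.union_finite {B F : Set ZFSet.{u}} (hF : F.Finite) (hFl : F ⊆ L l)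
    (hB : Onto l k B) : Onto l k (B ∪ F) := by
  have hfin := onto_finSubsets hl k hk (hkm.trans hml)
  induction F, hF using Set.Finite.induction_on with
  | empty => simpa using hB
  | @insert a s _ _ ih =>
    rw [Set.union_insert]
    exact Onto.insert hl hfin (ih fun t ht => hFl (.inr ht)) (hFl (.inl rfl))

variable (h1 : ¬ Onto l k (m.toZFSet : Set ZFSet.{u}))
  (h2 : ∀ n < m, Onto l k (n.toZFSet : Set ZFSet.{u}))

include h1 h2

/-- If `m` were the successor of `n`, adding one value to a map onto `n` would give a map onto `m`.
-/
lemma isSuccLimit_of_not_onto : Order.IsSuccLimit m := by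
  have hfin := onto_finSubsets hl k hk (hkm.trans hml)
  rcases Ordinal.zero_or_succ_or_isSuccLimit m with rfl | ⟨n, rfl⟩ | h
  · exact (not_lt_zero hkm).elim
  · have hn : n < Order.succ n := Order.lt_succ n
    refine (h1 ?_).elim
    rw [Order.succ_eq_add_one, toZFSet_add_one, ZFSet.coe_insert]
    exact Onto.insert hl hfin (h2 n hn) (toZFSet_mem_L.2 (hn.trans hml))
  · exact h

/-- A level is the hull of its ordinals, so it is counted by `onto_hull`. Passing to `max n (k + 1)`
only ensures a level above `ω`. -/
lemma onto_L {n : Ordinal.{u}} (hn : n < m) : Onto l k (L n : Set ZFSet.{u}) := by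
  have hm := isSuccLimit_of_not_onto hl hk hkm hml h1 h2
  have hn' : max n (k + 1) < m := max_lt hn (hm.add_one_lt hkm)
  have hω : ω < max n (k + 1) :=
    (hk.trans_lt (lt_add_one k)).trans_le (le_max_right _ _)
  refine (onto_hull hl hk (hkm.trans hml) hω (hn'.trans hml) (B := (max n (k + 1)).toZFSet)
    (fun i => ?_) (toZFSet_subset_L le_rfl) (h2 _ hn')).mono le_rfl fun z hz => ?_
  · exact toZFSet_mem_toZFSet_iff.2 ((natCast_lt_omega0 i).trans hω)
  · exact mem_hull_ordinals le_rfl (L_mono (le_max_left _ _) hz)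

/-- The subsets in `L l` of the levels below `m` are in `L m`. -/
lemma mem_L_of_subset {n : Ordinal.{u}} (hn : n < m) {G : ZFSet.{u}} (hG : G ∈ L l)
    (hGn : G ⊆ L n) : G ∈ L m := by
  have hm := isSuccLimit_of_not_onto hl hk hkm hml h1 h2
  -- With `k ≤ n` all natural numbers lie in `L n`, as `onto_hull` requires of the generating set.
  wlog hkn : k ≤ n generalizing n
  · exact this hkm (hGn.trans (L_mono (not_le.1 hkn).le)) le_rfl
  obtain ⟨c, ⟨hcl, hGc⟩, hmin⟩ : ∃ c, (c < l ∧ G ∈ Def (L c)) ∧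
      ∀ d < c, ¬ (d < l ∧ G ∈ Def (L d)) := by
    have h := mem_L_iff.1 hG
    exact ⟨sInf {c | c < l ∧ G ∈ Def (L c)}, csInf_mem h, fun d hd =>
      notMem_of_lt_csInf' (s := {c | c < l ∧ G ∈ Def (L c)}) hd⟩
  by_cases hcm : c < m
  · exact mem_L_iff.2 ⟨c, hcm, hGc⟩
  exfalso
  have hmc : m ≤ c := not_lt.1 hcm
  have hkc : k < c := hkm.trans_le hmc
  have hωc : ω < c := hk.trans_lt hkc
  have h0 : ∅ ∈ L c := empty_mem_L (omega0_pos.trans hωc)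
  obtain ⟨-, h⟩ := (mem_Def_iff (L_transitive c)).1 hGc
  obtain ⟨φ, q, hq, hφ⟩ := h.resolve_left fun h => ZFSet.notMem_empty _ (h ▸ h0)
  obtain ⟨p, hp, -, ⟨N, hN⟩, hpq⟩ := exists_finSupp h0 φ hq
  have hGφ : ∀ z ∈ L c, z ∈ G ↔ Sat (L c) IsLevel φ.delev (scons z p) := fun z hz => by
    rw [hφ z hz, sat_delev, hpq]
  have hrange : ∀ f : ZFSet.{u} → ZFSet.{u}, (Set.range fun i => f (p i)).Finite := fun f =>
    ((Set.finite_lt_nat (N + 1)).image fun i => f (p i)).subset (by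
      rintro _ ⟨i, rfl⟩
      by_cases hi : i < N + 1
      · exact ⟨i, hi, rfl⟩
      · exact ⟨N, Nat.lt_succ_self N, by
          change f (p N) = f (p i)
          rw [hN N le_rfl, hN i (by omega)]⟩)
  have hnc : n < c := hn.trans_le hmc
  have hBn : ∀ F : Set ZFSet.{u}, ∀ i : ℕ, nat i ∈ (L n : Set ZFSet.{u}) ∪ F := fun F i =>
    .inl (nat_mem_L (hk.trans hkn) i)
  have hLn := onto_L hl hk hkm hml h1 h2 hn
  let B : Set ZFSet.{u} := (L n : Set ZFSet.{u}) ∪ Set.range p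
  have hB : B ⊆ L c := Set.union_subset (L_mono hnc.le) (by
    rintro _ ⟨i, rfl⟩
    exact hp i)
  have hX : Elementary (hull (L c) IsLevel B) c := elementary_hull
  have hBX : ∀ z ∈ B, z ∈ hull (L c) IsLevel B := fun z hz => subset_hull hz (hB hz)
  obtain ⟨d, hdc, hd, hsat⟩ := hX.condensation
  generalize hXe : hull (L c) IsLevel B = X at *
  have hLnX : L n ⊆ X := fun z hz => hBX z (.inl hz)
  have hpX : ∀ i, p i ∈ X := fun i => hBX _ (.inr ⟨i, rfl⟩)
  have hcol : ∀ z ∈ L n, collapse X z = z := fun z hz =>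
    collapse_eq_self_of_subset (L_transitive n) hLnX hz
  have hsat' : ∀ (ψ : Fm) (w : ZFSet.{u}) (v : ℕ → ZFSet.{u}), w ∈ X → (∀ i, v i ∈ X) →
      (Sat (L c) IsLevel ψ (scons w v) ↔
        Sat (L d) IsLevel ψ (scons (collapse X w) fun i => collapse X (v i))) := by
    intro ψ w v hw hv
    rw [hsat ψ _ (scons_forall (p := (· ∈ X)) hw hv)]
    exact iff_of_eq (congrArg _ (scons_comp (collapse X) w v))
  have hdX : ∀ w ∈ X, collapse X w ∈ L d := fun w hw => (hd _).2 ⟨w, hw, rfl⟩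
  -- The collapse fixes `L n` pointwise and `G ⊆ L n`, so the same formula with collapsed parameters
  -- defines `G` over `L d`.
  have hGd : G ∈ Def (L d) := by
    refine mem_Def_of_sat (fun z hz => ?_) φ (fun i => collapse X (p i))
      (fun i => hdX _ (hpX i)) fun z hz => ?_
    · rw [← hcol z (hGn hz)]
      exact hdX z (hLnX (hGn hz))
    · obtain ⟨w, hw, rfl⟩ := (hd z).1 hz
      rw [← sat_delev _ IsLevel, ← hsat' _ w p hw hpX, ← hGφ w (hX.1 hw)]
      constructor
      · intro h
        have h3 := hcol _ (hGn h)
        have h4 := hX.collapse_injOn (hLnX (hGn h)) hw h3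
        rwa [h4] at h
      · intro h
        rwa [hcol w (hGn h)]
  -- A smaller `d` would contradict the choice of `c`.
  obtain rfl : d = c := by
    rcases hdc.lt_or_eq with h | h
    · exact (hmin d h ⟨h.trans hcl, hGd⟩).elim
    · exact h
  have hBd : (L n : Set ZFSet.{u}) ∪ Set.range (fun i => collapse X (p i)) ⊆ L d :=
    Set.union_subset (L_mono hnc.le) (by
      rintro _ ⟨i, rfl⟩
      exact hdX _ (hpX i))
  -- Each element of `L d` is the collapse of a hull element, hence definable over `L d` from `L n`
  -- and the collapsed parameters. So `k` maps onto `L d`, which includes `m`.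
  refine h1 ((onto_hull hl hk (hkm.trans hml) hωc hcl (hBn _) hBd
    (Onto.union_finite hl hk hkm hml (hrange _) ?_ hLn)).mono le_rfl fun z hz => ?_)
  · rintro _ ⟨i, rfl⟩
    exact L_mono hcl.le (hdX _ (hpX i))
  · have hzd : z ∈ L d := toZFSet_subset_L hmc hz
    obtain ⟨w, hw, rfl⟩ := (hd z).1 hzd
    rw [← hXe] at hw
    obtain ⟨ψ, b, hb, -, h⟩ := exists_fm_of_mem_hull (L_transitive d)
      (nat_zero.{u} ▸ hBn (Set.range p) 0) hB hw
    rw [hXe] at hw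
    have hbX : ∀ i, b i ∈ X := fun i => hBX _ (hb i)
    refine mem_hull_of_sat ψ (c := fun i => collapse X (b i)) (fun i => ?_) hBd hzd fun a ha => ?_
    · rcases hb i with h | ⟨j, h⟩
      · left
        rw [hcol _ h]
        exact h
      · right
        exact ⟨j, by rw [← h]⟩
    · obtain ⟨t, ht, rfl⟩ := (hd a).1 ha
      rw [← hsat' ψ t b ht hbX, h t (hX.1 ht)]
      exact ⟨fun e => by rw [e], hX.collapse_injOn ht hw⟩

/-- A map from `k` covering `z` exists in `L l`; its restriction to pairs in a fixed level below `m`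
is in `L m` by `mem_L_of_subset`. -/
lemma exists_surjection {z : ZFSet.{u}} (hz : z ∈ L m) : ∃ G ∈ L m,
    (∀ x y y', ZFSet.pair x y ∈ G → ZFSet.pair x y' ∈ G → y = y') ∧
      ∀ t ∈ z, ∃ b ∈ k.toZFSet, ZFSet.pair b t ∈ G := by
  have hm := isSuccLimit_of_not_onto hl hk hkm hml h1 h2
  obtain ⟨n, hn, hzn⟩ := (mem_L_limit hm).1 hz
  obtain ⟨G, hG, hf, hc⟩ := onto_L hl hk hkm hml h1 h2 hn
  have hr : max n k < m := max_lt hn hkm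
  have hr2 := add_nat_lt hm hr 2
  obtain ⟨G', hG', h⟩ := exists_sep hl (fun v => v 0 ∈ v 1) (t := L (max n k + 2))
    (L_mem_L.2 (hr2.trans hml)) [G] (by simpa using hG)
  replace h : ∀ p, p ∈ G' ↔ p ∈ L (max n k + 2) ∧ p ∈ G := h
  refine ⟨G', mem_L_of_subset hl hk hkm hml h1 h2 hr2 hG' fun p hp => ((h p).1 hp).1,
    fun x y y' h3 h4 => hf x y y' ((h _).1 h3).2 ((h _).1 h4).2, fun t ht => ?_⟩
  have htn : t ∈ L n := L_trans hzn ht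
  obtain ⟨b, hb, hbt⟩ := hc t htn
  exact ⟨b.toZFSet, toZFSet_mem_toZFSet_iff.2 hb, (h _).2 ⟨pair_mem_L
    (toZFSet_mem_L.2 (hb.trans_le (le_max_right _ _))) (L_mono (le_max_left _ _) htn), hbt⟩⟩

/-- Reflection for `L m`. -/
lemma exists_elementary_level {c : ℕ → ZFSet.{u}} (hc : ∀ i, c i ∈ L m) (hcs : FinSupp c) :
    ∃ d < m, (∀ i, c i ∈ L d) ∧ ∀ (φ : Fm) (v : ℕ → ZFSet.{u}), (∀ i, v i ∈ L d) →
      (Sat (L m) (fun _ => False) φ v ↔ Sat (L d) (fun _ => False) φ v) := by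
  obtain ⟨N, hN⟩ := hcs
  have hrange : (Set.range c).Finite :=
    ((Set.finite_lt_nat (N + 1)).image c).subset (by
      rintro _ ⟨i, rfl⟩
      by_cases hi : i < N + 1
      · exact ⟨i, hi, rfl⟩
      · exact ⟨N, Nat.lt_succ_self N, by rw [hN N le_rfl, hN i (by omega)]⟩)
  have hm := isSuccLimit_of_not_onto hl hk hkm hml h1 h2
  have hk1 : k < k + 1 := lt_add_one k
  have hk1m := hm.add_one_lt hkm
  -- Taking `k + 1` instead of `k` makes `k` itself an element of the hull, so maps from `k` can be
  -- found in it.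
  let B : Set ZFSet.{u} := ((k + 1).toZFSet : Set ZFSet.{u}) ∪ Set.range c
  have hB : B ⊆ L m := Set.union_subset (toZFSet_subset_L hk1m.le) (by
    rintro _ ⟨i, rfl⟩
    exact hc i)
  have hX : Elementary (hull (L m) IsLevel B) m := elementary_hull
  have hBX : ∀ z ∈ B, z ∈ hull (L m) IsLevel B := fun z hz => subset_hull hz (hB hz)
  have honto : Onto l k (hull (L m) IsLevel B : Set ZFSet.{u}) := by
    refine onto_hull hl hk (hkm.trans hml) (hk.trans_lt hkm) hml (fun i => .inl ?_) hB
      (Onto.union_finite hl hk hkm hml hrange ?_ (h2 _ hk1m))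
    · exact toZFSet_mem_toZFSet_iff.2 ((natCast_lt_omega0 i).trans_le (hk.trans hk1.le))
    · rintro _ ⟨i, rfl⟩
      exact L_mono hml.le (hc i)
  obtain ⟨d, hdm, hd, hsat⟩ := hX.condensation
  generalize hull (L m) IsLevel B = X at *
  have hkX : k.toZFSet ∈ X := hBX _ (.inl (toZFSet_mem_toZFSet_iff.2 hk1))
  -- For `z ∈ X`, elementarity gives a map `g ∈ X` from `k` covering `z`. Each `t ∈ z` is the value
  -- of `g` at some `b ∈ k ⊆ X`, hence is in `X`.
  have htr : X.IsTransitive := by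
    intro z hz t ht
    obtain ⟨G, hG, hf, hcov⟩ := exists_surjection hl hk hkm hml h1 h2 (hX.1 hz)
    obtain ⟨g, hg, hgf, hgc⟩ := hX.exists_of_udfn (fun x _ v =>
      (∀ a ∈ x, ∀ b ∈ x, ∀ b' ∈ x, ZFSet.pair a b ∈ v 0 → ZFSet.pair a b' ∈ v 0 → b = b') ∧
        ∀ t ∈ v 1, ∃ b ∈ v 2, ZFSet.pair b t ∈ v 0) (v := scons z fun _ => k.toZFSet)
      (scons_forall (p := (· ∈ X)) hz fun _ => hkX)
      ⟨G, hG, fun a _ b _ b' _ => hf a b b', hcov⟩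
    replace hgf : ∀ a ∈ L m, ∀ b ∈ L m, ∀ b' ∈ L m, ZFSet.pair a b ∈ g → ZFSet.pair a b' ∈ g →
      b = b' := hgf
    replace hgc : ∀ t ∈ z, ∃ b ∈ k.toZFSet, ZFSet.pair b t ∈ g := hgc
    obtain ⟨b, hb, hbt⟩ := hgc t ht
    have hbX : b ∈ X := hBX b (.inl (by
      rw [toZFSet_add_one]
      exact ZFSet.mem_insert_iff.2 (.inr hb)))
    have htm := L_trans (hX.1 hz) ht
    obtain ⟨s, hs, hbs⟩ := hX.exists_of_udfn (fun _ _ v => ZFSet.pair (v 1) (v 0) ∈ v 2)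
      (v := scons b fun _ => g) (scons_forall (p := (· ∈ X)) hbX fun _ => hg) ⟨t, htm, hbt⟩
    rwa [hgf b (hX.1 hbX) t htm s (hX.1 hs) hbt hbs]
  have hcol : ∀ z ∈ X, collapse X z = z := fun z hz =>
    collapse_eq_self_of_subset htr (fun _ => id) hz
  have hdX : ∀ z, z ∈ L d ↔ z ∈ X := fun z => by
    rw [hd]
    constructor
    · rintro ⟨w, hw, rfl⟩
      rwa [hcol w hw]
    · exact fun hz => ⟨z, hz, (hcol z hz).symm⟩
  refine ⟨d, lt_of_le_of_ne hdm ?_, fun i => (hdX _).2 (hBX _ (.inr ⟨i, rfl⟩)), fun φ v hv => ?_⟩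
  -- If `d = m`, the hull would be all of `L m`, and `k` would map onto `m`.
  · rintro rfl
    exact h1 (honto.mono le_rfl fun z hz => (hdX z).1 (toZFSet_subset_L le_rfl hz))
  · have hvX := fun i => (hdX _).1 (hv i)
    rw [← sat_delev _ IsLevel, hsat _ v hvX, ← sat_delev (L d) IsLevel]
    simp only [hcol _ (hvX _)]

end

/-! ### The notions of the statement, evaluated in a limit level -/

section

variable {l : Ordinal.{u}}

lemma isUnorderedPair_iff {z x y : Carrier (L l)} :
    IsUnorderedPair z x y ↔ z.val = {x.val, y.val} := by
  constructor
  · intro h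
    ext w
    rw [ZFSet.mem_pair]
    constructor
    · intro hw
      rcases (h ⟨w, L_trans z.property hw⟩).1 hw with e | e
      · exact .inl (congrArg Carrier.val e)
      · exact .inr (congrArg Carrier.val e)
    · rintro (rfl | rfl)
      · exact (h x).2 (.inl rfl)
      · exact (h y).2 (.inr rfl)
  · intro h w
    change w.val ∈ z.val ↔ _
    rw [h, ZFSet.mem_pair]
    exact or_congr ⟨Carrier.ext, congrArg _⟩ ⟨Carrier.ext, congrArg _⟩

lemma isOrderedPair_iff {p x y : Carrier (L l)} :
    IsOrderedPair p x y ↔ p.val = ZFSet.pair x.val y.val := by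
  simp only [IsOrderedPair, isUnorderedPair_iff]
  constructor
  · rintro ⟨s, t, hs, ht, hp⟩
    rw [hp, hs, ht, ZFSet.pair_eq_singleton, ZFSet.pair]
  · intro h
    have h1 : {x.val} ∈ p.val := by simp [h, ZFSet.pair]
    have h2 : {x.val, y.val} ∈ p.val := by simp [h, ZFSet.pair]
    exact ⟨⟨_, L_trans p.property h1⟩, ⟨_, L_trans p.property h2⟩, (ZFSet.pair_eq_singleton _).symm,
      rfl, h⟩

lemma isTrans_iff {x : Carrier (L l)} : IsTrans x ↔ x.val.IsTransitive := by
  constructor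
  · intro h y hy z hz
    have hyl := L_trans x.property hy
    exact h ⟨y, hyl⟩ hy ⟨z, L_trans hyl hz⟩ hz
  · exact fun h y hy z hz => h y.val hy hz

lemma isOrd_iff {x : Carrier (L l)} : IsOrd x ↔ x.val.IsOrdinal := by
  rw [IsOrd, isTrans_iff, ZFSet.isOrdinal_iff_forall_mem_isTransitive]
  refine and_congr_right fun _ => ⟨fun h y hy => ?_, fun h y hy => isTrans_iff.2 (h y.val hy)⟩
  exact isTrans_iff.1 (h ⟨y, L_trans x.property hy⟩ hy)

lemma isOrd_toZFSet {b : Ordinal.{u}} (hb : b.toZFSet ∈ L l) :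
    IsOrd (⟨b.toZFSet, hb⟩ : Carrier (L l)) := isOrd_iff.2 (ZFSet.isOrdinal_toZFSet b)

lemma omega0_lt_of_exceedsOmega {m : Ordinal.{u}} (hm : m.toZFSet ∈ L l)
    (h : ExceedsOmega (⟨m.toZFSet, hm⟩ : Carrier (L l))) : ω < m := by
  obtain ⟨⟨w, hw⟩, ⟨⟨-, ⟨⟨y, hy⟩, hyw⟩, hlim⟩, -⟩, hwm⟩ := h
  obtain ⟨b, hbm, rfl⟩ := mem_toZFSet_iff.1 (show w ∈ m.toZFSet from hwm)
  refine lt_of_le_of_lt ?_ hbm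
  have hb0 : 0 < b := by
    obtain ⟨c, hc, -⟩ := mem_toZFSet_iff.1 (show y ∈ b.toZFSet from hyw)
    exact zero_le.trans_lt hc
  have hsucc : ∀ c < b, c + 1 < b := by
    intro c hc
    have hcb := toZFSet_mem_toZFSet_iff.2 hc
    obtain ⟨⟨z, hz⟩, hzb, hcz⟩ := hlim ⟨c.toZFSet, L_trans hw hcb⟩ hcb
    obtain ⟨d, hd, rfl⟩ := mem_toZFSet_iff.1 (show z ∈ b.toZFSet from hzb)
    exact (Order.add_one_le_of_lt (toZFSet_mem_toZFSet_iff.1 hcz)).trans_lt hd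
  rw [omega0_le]
  intro n
  have : ∀ n : ℕ, (n : Ordinal.{u}) < b := by
    intro n
    induction n with
    | zero => simpa using hb0
    | succ n ih => exact_mod_cast hsucc _ ih
  exact (this n).le

variable (hl : Order.IsSuccLimit l)

include hl

/-- The partial map is restricted to values in `m` and made total with default value `∅`, which is
an element of `m` because `0 < m`. -/
lemma Onto.exists_isSurjection {k m : Ordinal.{u}} (hk : k.toZFSet ∈ L l) (hm : m.toZFSet ∈ L l)
    (hm0 : 0 < m) (h : Onto l k (m.toZFSet : Set ZFSet.{u})) :
    ∃ f, IsSurjection f (⟨k.toZFSet, hk⟩ : Carrier (L l)) ⟨m.toZFSet, hm⟩ := by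
  obtain ⟨G, hG, hf, hc⟩ := h
  obtain ⟨c, hcl, hcp⟩ := exists_level hl [k.toZFSet, m.toZFSet] (by simp [hk, hm])
  obtain ⟨F, hF, h⟩ := exists_sep hl (fun v => ∃ a ∈ v 1, ∃ b ∈ v 2, v 0 = ZFSet.pair a b ∧
      (ZFSet.pair a b ∈ v 3 ∨ (b = ∅ ∧ ∀ b' ∈ v 2, ZFSet.pair a b' ∉ v 3)))
    (t := L (c + 2)) (L_mem_L.2 (add_nat_lt hl hcl 2)) [k.toZFSet, m.toZFSet, G]
    (by simp [hG, hk, hm])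
  replace h : ∀ p, p ∈ F ↔ p ∈ L (c + 2) ∧ ∃ a ∈ k.toZFSet, ∃ b ∈ m.toZFSet, p = ZFSet.pair a b ∧
      (ZFSet.pair a b ∈ G ∨ (b = ∅ ∧ ∀ b' ∈ m.toZFSet, ZFSet.pair a b' ∉ G)) := h
  have hF' : ∀ a ∈ k.toZFSet, ∀ b ∈ m.toZFSet, ZFSet.pair a b ∈ F ↔
      (ZFSet.pair a b ∈ G ∨ (b = ∅ ∧ ∀ b' ∈ m.toZFSet, ZFSet.pair a b' ∉ G)) := by
    intro a ha b hb
    rw [h]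
    constructor
    · rintro ⟨-, a', -, b', -, e, h⟩
      rw [ZFSet.pair_inj] at e
      obtain ⟨rfl, rfl⟩ := e
      exact h
    · exact fun h => ⟨pair_mem_L (L_trans (hcp _ (by simp)) ha) (L_trans (hcp _ (by simp)) hb),
        a, ha, b, hb, rfl, h⟩
  have hval : ∀ (a : Carrier (L l)) (b : Carrier (L l)),
      (∃ p ∈ (⟨F, hF⟩ : Carrier (L l)), IsOrderedPair p a b) ↔ ZFSet.pair a.val b.val ∈ F := by
    intro a b
    constructor
    · rintro ⟨p, hp, e⟩
      rw [isOrderedPair_iff] at e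
      rw [← e]
      exact hp
    · exact fun hp => ⟨⟨_, L_trans hF hp⟩, hp, isOrderedPair_iff.2 rfl⟩
  refine ⟨⟨F, hF⟩, fun p hp => ?_, fun a ha => ?_, fun b hb => ?_⟩
  · obtain ⟨-, a, ha, b, hb, e, -⟩ := (h p.val).1 hp
    exact ⟨⟨a, L_trans hk ha⟩, ha, ⟨b, L_trans hm hb⟩, hb, isOrderedPair_iff.2 e⟩
  · simp only [hval]
    have hFm : ∀ b, ZFSet.pair a.val b ∈ F → b ∈ m.toZFSet := by
      intro b hb
      obtain ⟨-, a', -, b', hb', e, -⟩ := (h _).1 hb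
      exact (ZFSet.pair_inj.1 e).2 ▸ hb'
    have huniq : ∀ b b', ZFSet.pair a.val b ∈ F → ZFSet.pair a.val b' ∈ F → b = b' := by
      intro b b' hb hb'
      have h1 := hFm b hb
      have h2 := hFm b' hb'
      rw [hF' _ ha _ h1] at hb
      rw [hF' _ ha _ h2] at hb'
      rcases hb with hb | ⟨hb, hb1⟩ <;> rcases hb' with hb' | ⟨hb', hb1'⟩
      · exact hf _ _ _ hb hb'
      · exact (hb1' _ h1 hb).elim
      · exact (hb1 _ h2 hb').elim
      · rw [hb, hb']
    have hex : ∃ b, ZFSet.pair a.val b ∈ F := by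
      by_cases hb : ∃ b ∈ m.toZFSet, ZFSet.pair a.val b ∈ G
      · obtain ⟨b, hb, hab⟩ := hb
        exact ⟨b, (hF' _ ha _ hb).2 (.inl hab)⟩
      · push Not at hb
        refine ⟨∅, (hF' _ ha _ ?_).2 (.inr ⟨rfl, hb⟩)⟩
        rw [← toZFSet_zero]
        exact toZFSet_mem_toZFSet_iff.2 hm0
    obtain ⟨b, hb⟩ := hex
    exact ⟨⟨b, L_trans hm (hFm b hb)⟩, hb, fun b' hb' => Carrier.ext (huniq _ _ hb' hb)⟩
  · obtain ⟨c, hck, hcb⟩ := hc b.val hb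
    have hck' := toZFSet_mem_toZFSet_iff.2 hck
    exact ⟨⟨c.toZFSet, L_trans hk hck'⟩, hck', (hval _ _).2 ((hF' _ hck' _ hb).2 (.inl hcb))⟩

lemma IsCard.not_onto {k m : Ordinal.{u}} {hm : m.toZFSet ∈ L l}
    (h : IsCard (⟨m.toZFSet, hm⟩ : Carrier (L l))) (hkm : k < m) :
    ¬ Onto l k (m.toZFSet : Set ZFSet.{u}) := by
  intro ho
  have hk := toZFSet_mem_toZFSet_iff.2 hkm
  exact h.2 ⟨⟨k.toZFSet, L_trans hm hk⟩, hk,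
    ho.exists_isSurjection hl (L_trans hm hk) hm (zero_le.trans_lt hkm)⟩

omit hl in
-- Choosing preimages would inject the natural numbers into some `N`.
lemma isCard_omega0 (h : (ω : Ordinal.{u}).toZFSet ∈ L l) :
    IsCard (⟨(ω : Ordinal.{u}).toZFSet, h⟩ : Carrier (L l)) := by
  refine ⟨isOrd_toZFSet h, ?_⟩
  rintro ⟨⟨b, hb⟩, hbω, f, -, hf, hs⟩
  obtain ⟨N, rfl⟩ := mem_om.1 (show b ∈ om from hbω)
  have key : ∀ n : ℕ, ∃ i < N, ∃ p ∈ f.val, p = ZFSet.pair (nat i) (nat n) := by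
    intro n
    obtain ⟨⟨a, ha⟩, haN, p, hp, e⟩ := hs ⟨nat n, L_trans h (nat_mem_om n)⟩ (nat_mem_om n)
    obtain ⟨i, hi, rfl⟩ := mem_nat.1 (show a ∈ nat N from haN)
    exact ⟨i, hi, p.val, hp, isOrderedPair_iff.1 e⟩
  choose g hg p hp e using key
  have hinj : Function.Injective g := by
    intro n n' hnn
    have hi : nat (g n) ∈ nat.{u} N := nat_mem_nat.2 (hg n)
    obtain ⟨y, -, hy⟩ := hf ⟨nat (g n), L_trans hb hi⟩ hi
    have h1 := hy ⟨nat n, L_trans h (nat_mem_om n)⟩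
      ⟨⟨p n, L_trans f.property (hp n)⟩, hp n, isOrderedPair_iff.2 (e n)⟩
    have h2 := hy ⟨nat n', L_trans h (nat_mem_om n')⟩
      ⟨⟨p n', L_trans f.property (hp n')⟩, hp n', isOrderedPair_iff.2 ((e n').trans
        (congrArg (fun i => ZFSet.pair (nat i) (nat n')) hnn.symm))⟩
    exact nat_injective (congrArg Carrier.val (h1.trans h2.symm))
  exact Set.infinite_range_of_injective hinj
    ((Set.finite_lt_nat N).subset (by rintro _ ⟨n, rfl⟩; exact hg n))

/-- Let `k` be the largest cardinal below `m`; it is infinite because `ω` is a cardinal of `L l`. An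
`n` with `k < n < m` is not a cardinal, so some smaller `c` maps onto it, and by induction `k` maps
onto `c`. -/
lemma IsSuccCard.exists_onto {m : Ordinal.{u}} {hm : m.toZFSet ∈ L l} (hω : ω < m)
    (h : IsSuccCard (⟨m.toZFSet, hm⟩ : Carrier (L l))) :
    ∃ k < m, ω ≤ k ∧ ∀ n < m, Onto l k (n.toZFSet : Set ZFSet.{u}) := by
  obtain ⟨-, ⟨x, hx⟩, hxm, -, hmax⟩ := h
  obtain ⟨k, hkm, rfl⟩ := mem_toZFSet_iff.1 (show x ∈ m.toZFSet from hxm)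
  have hml := toZFSet_mem_L.1 hm
  have hcard : ∀ n (hn : n < m), IsCard (⟨n.toZFSet, L_trans hm (toZFSet_mem_toZFSet_iff.2 hn)⟩ :
      Carrier (L l)) → n ≤ k := by
    intro n hn hc
    rcases hmax _ (toZFSet_mem_toZFSet_iff.2 hn) hc with h | h
    · exact (toZFSet_mem_toZFSet_iff.1 h).le
    · exact (toZFSet_injective (congrArg Carrier.val h)).le
  refine ⟨k, hkm, hcard ω hω (isCard_omega0 _), fun n hn => ?_⟩
  induction n using WellFoundedLT.induction with
  | ind n ih =>
    by_cases hnk : n ≤ k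
    · exact (Onto.self hl (hn.trans hml)).mono hnk le_rfl
    have hnc := fun h => hnk (hcard n hn h)
    have hex : ∃ b ∈ (⟨n.toZFSet, L_trans hm (toZFSet_mem_toZFSet_iff.2 hn)⟩ : Carrier (L l)),
        ∃ f, IsSurjection f b ⟨n.toZFSet, L_trans hm (toZFSet_mem_toZFSet_iff.2 hn)⟩ := by
      by_contra hne
      exact hnc ⟨isOrd_toZFSet _, hne⟩
    obtain ⟨⟨b, hbl⟩, hbn, f, hf1, hf2, hf3⟩ := hex
    obtain ⟨c, hcn, rfl⟩ := mem_toZFSet_iff.1 (show b ∈ n.toZFSet from hbn)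
    refine Onto.comp hl (ih c hcn (hcn.trans hn)) f.property (fun a y y' h h' => ?_) fun y hy => ?_
    · have hmem : ∀ {y}, ZFSet.pair a y ∈ f.val → ∃ ha : a ∈ c.toZFSet, ∃ hy : y ∈ L l,
          ∃ p ∈ f, IsOrderedPair p ⟨a, L_trans hbl ha⟩ ⟨y, hy⟩ := by
        intro y h
        obtain ⟨a', ha', y', -, e⟩ := hf1 ⟨_, L_trans f.property h⟩ h
        rw [isOrderedPair_iff] at e
        obtain ⟨rfl, rfl⟩ := ZFSet.pair_inj.1 e
        exact ⟨ha', y'.property, ⟨_, L_trans f.property h⟩, h, isOrderedPair_iff.2 rfl⟩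
      obtain ⟨ha, hy, hp⟩ := hmem h
      obtain ⟨ha', hy', hp'⟩ := hmem h'
      exact congrArg Carrier.val ((hf2 _ ha).unique hp hp')
    · have hnl := L_trans hm (toZFSet_mem_toZFSet_iff.2 hn)
      obtain ⟨a, ha, p, hp, e⟩ := hf3 ⟨y, L_trans hnl hy⟩ hy
      rw [isOrderedPair_iff] at e
      exact ⟨a.val, ha, e ▸ hp⟩

end

/-! ### The axioms -/

lemma exists_fm_of_formula {m : Ordinal.{u}} {n j : ℕ} (φ : setLang.Formula (Fin n ⊕ Fin j)) :
    ∃ ψ : Fm, ∀ (p : Fin n → Carrier (L m)) (t : Fin j → Carrier (L m)) (v : ℕ → ZFSet.{u}),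
      (∀ i, v i ∈ L m) → (∀ i : Fin j, v i = (t i).val) → (∀ i : Fin n, v (j + i) = (p i).val) →
      (φ.Realize (Sum.elim p t) ↔ Sat (L m) (fun _ => False) ψ v) := by
  obtain ⟨ψ, hψ⟩ := exists_fm_of_boundedFormula (L_transitive m) φ
    (Sum.elim (Sum.elim (fun i : Fin n => j + (i : ℕ)) fun i : Fin j => (i : ℕ)) fun _ => 0)
  refine ⟨ψ, fun p t v hv ht hp => ?_⟩
  have := hψ fun i => ⟨v i, hv i⟩
  rw [← this, FirstOrder.Language.Formula.Realize]
  apply iff_of_eq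
  congr 1
  · funext i
    rcases i with i | i
    · exact Carrier.ext (hp i).symm
    · exact Carrier.ext (ht i).symm
  · funext i
    exact i.elim0

/-- The assignment with values `p`. -/
def ofFin {x : ZFSet.{u}} {n : ℕ} (p : Fin n → Carrier x) : ℕ → ZFSet.{u} :=
  fun i => if h : i < n then (p ⟨i, h⟩).val else ∅

lemma UDfn.sat (φ : Fm) : UDfn.{u} fun x U v => Sat x U φ v := ⟨φ, fun _ _ _ _ _ => Iff.rfl⟩

/-- A limit level that reflects every formula, in the sense below, is a model of `ZF⁻`. -/
lemma modelsZFMinus_of_reflection {m : Ordinal.{u}} (hm : Order.IsSuccLimit m) (hω : ω < m)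
    (href : ∀ c : ℕ → ZFSet.{u}, (∀ i, c i ∈ L m) → FinSupp c →
      ∃ d < m, (∀ i, c i ∈ L d) ∧ ∀ (φ : Fm) (v : ℕ → ZFSet.{u}), (∀ i, v i ∈ L d) →
        (Sat (L m) (fun _ => False) φ v ↔ Sat (L d) (fun _ => False) φ v)) :
    ModelsZFMinus (Carrier (L m)) := by
  have h0 : ∅ ∈ L m := empty_mem_L (omega0_pos.trans hω)
  have hfin : ∀ {n : ℕ} (p : Fin n → Carrier (L m)), (∀ i, ofFin p i ∈ L m) ∧
      FinSupp (ofFin p) ∧ ∀ i : Fin n, ofFin p i = (p i).val := by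
    intro n p
    refine ⟨fun i => ?_, ⟨n, fun i hi => dif_neg (not_lt.2 hi)⟩, fun i => dif_pos i.2⟩
    unfold ofFin
    split_ifs
    exacts [(p _).property, h0]
  have hreal1 : ∀ {n : ℕ} (φ : setLang.Formula (Fin n ⊕ Fin 1)) (p : Fin n → Carrier (L m)),
      ∃ ψ, ∀ x : Carrier (L m), φ.Realize (Sum.elim p ![x]) ↔
        Sat (L m) (fun _ => False) ψ (scons x.val (ofFin p)) := by
    intro n φ p
    obtain ⟨ψ, hψ⟩ := exists_fm_of_formula (m := m) φ
    refine ⟨ψ, fun x => hψ _ _ _ (scons_forall (p := (· ∈ L m)) x.property (hfin p).1)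
      (fun i => ?_) fun i => ?_⟩
    · fin_cases i
      rfl
    · rw [add_comm, scons_succ, (hfin p).2.2]
  have hreal2 : ∀ {n : ℕ} (φ : setLang.Formula (Fin n ⊕ Fin 2)) (p : Fin n → Carrier (L m)),
      ∃ ψ, ∀ x y : Carrier (L m), φ.Realize (Sum.elim p ![x, y]) ↔
        Sat (L m) (fun _ => False) ψ (scons x.val (scons y.val (ofFin p))) := by
    intro n φ p
    obtain ⟨ψ, hψ⟩ := exists_fm_of_formula (m := m) φ
    refine ⟨ψ, fun x y => hψ _ _ _ (scons_forall (p := (· ∈ L m)) x.property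
      (scons_forall (p := (· ∈ L m)) y.property (hfin p).1)) (fun i => ?_) fun i => ?_⟩
    · fin_cases i <;> rfl
    · rw [show 2 + (i : ℕ) = i + 1 + 1 by omega, scons_succ, scons_succ, (hfin p).2.2]
  have href' : ∀ {n : ℕ} (p : Fin n → Carrier (L m)) (a : Carrier (L m)),
      ∃ d < m, a.val ∈ L d ∧ (∀ i, ofFin p i ∈ L d) ∧ ∀ (φ : Fm) (v : ℕ → ZFSet.{u}),
        (∀ i, v i ∈ L d) →
        (Sat (L m) (fun _ => False) φ v ↔ Sat (L d) (fun _ => False) φ v) := by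
    intro n p a
    obtain ⟨d, hd, h1, h2⟩ := href (scons a.val (ofFin p))
      (scons_forall (p := (· ∈ L m)) a.property (hfin p).1) ((hfin p).2.1.scons _)
    exact ⟨d, hd, h1 0, fun i => h1 (i + 1), h2⟩
  have hrefl2 : ∀ {n : ℕ} (p : Fin n → Carrier (L m)) (a : Carrier (L m)) (ψ : Fm),
      (∀ x ∈ a, ∃ y : Carrier (L m),
        Sat (L m) (fun _ => False) ψ (scons x.val (scons y.val (ofFin p)))) →
      ∃ d < m, a.val ∈ L d ∧ (∀ i, ofFin p i ∈ L d) ∧ (∀ x ∈ L d, ∀ y ∈ L d,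
        (Sat (L m) (fun _ => False) ψ (scons x (scons y (ofFin p))) ↔
          Sat (L d) (fun _ => False) ψ (scons x (scons y (ofFin p))))) ∧
        ∀ x ∈ a.val, ∃ y ∈ L d, Sat (L m) (fun _ => False) ψ (scons x (scons y (ofFin p))) := by
    intro n p a ψ h
    obtain ⟨d, hd, had, hpd, hs⟩ := href' p a
    have hs2 : ∀ x ∈ L d, ∀ y ∈ L d,
        (Sat (L m) (fun _ => False) ψ (scons x (scons y (ofFin p))) ↔
          Sat (L d) (fun _ => False) ψ (scons x (scons y (ofFin p)))) := fun x hx y hy =>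
      hs ψ _ (scons_forall (p := (· ∈ L d)) hx (scons_forall (p := (· ∈ L d)) hy hpd))
    refine ⟨d, hd, had, hpd, hs2, fun x hx => ?_⟩
    have hxd := L_trans had hx
    obtain ⟨y, hy⟩ := h ⟨x, L_mono hd.le hxd⟩ hx
    -- The first two variables are exchanged so that the quantifier binds the value `y`. Reflecting
    -- this existential formula brings a witness into `L d`.
    let χ : Fm := .ex (ψ.rename fun i => if i = 0 then 1 else if i = 1 then 0 else i)
    have hχ : ∀ b, Sat (L b) (fun _ => False) χ (scons x (ofFin p)) ↔
        ∃ y ∈ L b, Sat (L b) (fun _ => False) ψ (scons x (scons y (ofFin p))) := by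
      intro b
      refine exists_congr fun y => and_congr_right fun _ => ?_
      rw [sat_rename]
      apply iff_of_eq
      congr 1
      funext i
      rcases i with _ | _ | i <;> rfl
    have h3 := hs χ (scons x (ofFin p)) (scons_forall (p := (· ∈ L d)) hxd hpd)
    rw [hχ, hχ] at h3
    obtain ⟨y, hy, h4⟩ := h3.1 ⟨y.val, y.property, hy⟩
    exact ⟨y, hy, (hs2 x hxd y hy).2 h4⟩
  constructor
  · intro a b h
    refine Carrier.ext (ZFSet.ext fun x => ⟨fun hx => ?_, fun hx => ?_⟩)
    · exact (h ⟨x, L_trans a.property hx⟩).1 hx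
    · exact (h ⟨x, L_trans b.property hx⟩).2 hx
  · rintro a ⟨x, hx⟩
    obtain ⟨y, hy, h⟩ := ZFSet.regularity a.val fun e => ZFSet.notMem_empty x.val (e ▸ hx)
    refine ⟨⟨y, L_trans a.property hy⟩, hy, fun z hz hzy => ?_⟩
    exact ZFSet.notMem_empty z.val (h ▸ ZFSet.mem_inter.2 ⟨hz, hzy⟩)
  · intro a b
    obtain ⟨c, hc, h⟩ := exists_level hm [a.val, b.val] (by simp [a.property, b.property])
    refine ⟨⟨{a.val, b.val}, L_mono (hm.add_one_lt hc).le
      (upair_mem_L (h _ (by simp)) (h _ (by simp)))⟩, fun x => ?_⟩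
    change x.val ∈ ({a.val, b.val} : ZFSet.{u}) ↔ _
    rw [ZFSet.mem_pair]
    exact or_congr ⟨Carrier.ext, congrArg _⟩ ⟨Carrier.ext, congrArg _⟩
  · intro a
    obtain ⟨c, hc, h⟩ := exists_level hm [a.val] (by simp [a.property])
    refine ⟨⟨ZFSet.sUnion a.val, L_mono (hm.add_one_lt hc).le (sUnion_mem_L (h _ (by simp)))⟩,
      fun x => ?_⟩
    change x.val ∈ ZFSet.sUnion a.val ↔ _
    rw [ZFSet.mem_sUnion]
    exact ⟨fun ⟨y, hy, hxy⟩ => ⟨⟨y, L_trans a.property hy⟩, hy, hxy⟩,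
      fun ⟨y, hy, hxy⟩ => ⟨y.val, hy, hxy⟩⟩
  · refine ⟨⟨om, om_mem_L.2 hω⟩, ⟨⟨∅, h0⟩, ?_, fun x => ZFSet.notMem_empty x.val⟩, ?_⟩
    · exact mem_om.2 ⟨0, nat_zero.symm⟩
    · rintro ⟨x, hx⟩ hxo
      obtain ⟨n, rfl⟩ := mem_om.1 (show x ∈ om from hxo)
      refine ⟨⟨nat (n + 1), nat_mem_L hω.le _⟩, nat_mem_om _, fun y => ?_⟩
      change y.val ∈ nat (n + 1) ↔ y.val ∈ nat n ∨ _
      rw [nat_succ, ZFSet.mem_insert_iff, or_comm]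
      exact or_congr Iff.rfl ⟨Carrier.ext (a := y) (b := ⟨nat n, hx⟩), congrArg _⟩
  · intro n φ p a
    obtain ⟨ψ, hψ⟩ := hreal1 φ p
    obtain ⟨d, hd, had, hpd, hs⟩ := href' p a
    have hsat := UDfn.sat.{u} ψ
    have h1 : UDfn.{u} fun x U v => Sat x U ψ (scons (v 0) fun k => v (k + 2)) :=
      (hsat.rename (scons 0 fun k => k + 2)).congr fun _ _ _ v _ => by
        apply iff_of_eq
        congr 1
        funext k
        cases k <;> rfl
    -- Evaluating `ψ` in `L d` instead of `L m` makes no difference on elements of `a`, and makes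
    -- `b` an element of `L (d + 1)`.
    obtain ⟨b, hmem⟩ : ∃ b : ZFSet.{u}, ∀ z, z ∈ b ↔
        z ∈ a.val ∧ Sat (L d) (fun _ => False) ψ (scons z (ofFin p)) :=
      ⟨a.val.sep fun z => Sat (L d) (fun _ => False) ψ (scons z (ofFin p)), fun z => ZFSet.mem_sep⟩
    refine ⟨⟨b, L_mono (hm.add_one_lt hd).le (mem_L_add_one_of_udfn (P := fun x U v => v 0 ∈ v 1 ∧
      Sat x U ψ (scons (v 0) fun k => v (k + 2))) inferInstance (v := scons a.val (ofFin p))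
      (scons_forall (p := (· ∈ L d)) had hpd) fun z => ?_)⟩, fun x => (hmem x.val).trans ?_⟩
    · rw [hmem]
      exact ⟨fun h => ⟨L_trans had h.1, h⟩, And.right⟩
    · refine and_congr_right fun hx => ?_
      rw [hψ, hs ψ _ (scons_forall (p := (· ∈ L d)) (L_trans had hx) hpd)]
  · intro n φ p a h
    obtain ⟨ψ, hψ⟩ := hreal2 φ p
    simp only [hψ] at h ⊢
    obtain ⟨d, hd, had, hpd, hs, hex⟩ := hrefl2 p a ψ fun x hx => (h x hx).exists
    have hsat := UDfn.sat.{u} ψ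
    have h1 : UDfn.{u} fun x U v =>
        Sat x U ψ (scons (v 0) (scons (v 1) fun k => v (k + 1 + 2))) :=
      (hsat.rename (scons 0 (scons 1 fun k => k + 1 + 2))).congr fun _ _ _ v _ => by
        apply iff_of_eq
        congr 1
        funext k
        rcases k with _ | _ | k <;> rfl
    obtain ⟨b, hmem⟩ : ∃ b : ZFSet.{u}, ∀ z, z ∈ b ↔ z ∈ L d ∧ ∃ x ∈ a.val,
        Sat (L d) (fun _ => False) ψ (scons x (scons z (ofFin p))) :=
      ⟨(L d).sep fun z => ∃ x ∈ a.val,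
        Sat (L d) (fun _ => False) ψ (scons x (scons z (ofFin p))), fun z => ZFSet.mem_sep⟩
    refine ⟨⟨b, L_mono (hm.add_one_lt hd).le (mem_L_add_one_of_udfn (P := fun x U v =>
      ∃ t ∈ v 1, Sat x U ψ (scons t (scons (v 0) fun k => v (k + 2)))) inferInstance
      (v := scons a.val (ofFin p)) (scons_forall (p := (· ∈ L d)) had hpd) hmem)⟩,
      fun y => (hmem y.val).trans ?_⟩
    constructor
    · rintro ⟨hy, x, hx, hxy⟩
      exact ⟨⟨x, L_trans a.property hx⟩, hx, (hs x (L_trans had hx) _ hy).2 hxy⟩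
    · rintro ⟨x, hx, hxy⟩
      obtain ⟨y', hy', h'⟩ := hex x.val hx
      -- By uniqueness the value in `L m` is the witness already found in `L d`.
      have e := (h x hx).unique (y₂ := ⟨y', L_mono hd.le hy'⟩) hxy h'
      subst e
      exact ⟨hy', x.val, hx, (hs _ (L_trans had hx) _ hy').1 hxy⟩
  · intro n φ p a h
    obtain ⟨ψ, hψ⟩ := hreal2 φ p
    simp only [hψ] at h ⊢
    obtain ⟨d, hd, -, -, -, hex⟩ := hrefl2 p a ψ h
    -- The reflecting level itself collects the witnesses.
    refine ⟨⟨L d, L_mem_L.2 hd⟩, fun x hx => ?_⟩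
    obtain ⟨y, hy, h'⟩ := hex x.val hx
    exact ⟨⟨y, L_mono hd.le hy⟩, hy, h'⟩

end ConstructibleLevels

theorem mainTheorem10 (l : Ordinal.{u}) (hl : Order.IsSuccLimit l) (m : Ordinal.{u})
    (hm : m.toZFSet ∈ ConstructibleLevels.L l)
    (hω : ConstructibleLevels.ExceedsOmega
      (⟨m.toZFSet, hm⟩ : ConstructibleLevels.Carrier (ConstructibleLevels.L l)))
    (hsucc : ConstructibleLevels.IsSuccCard
      (⟨m.toZFSet, hm⟩ : ConstructibleLevels.Carrier (ConstructibleLevels.L l))) :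
    ConstructibleLevels.ModelsZFMinus
      (ConstructibleLevels.Carrier (ConstructibleLevels.L m)) := by
  have hωm := ConstructibleLevels.omega0_lt_of_exceedsOmega hm hω
  have hml := ConstructibleLevels.toZFSet_mem_L.1 hm
  obtain ⟨k, hkm, hk, h2⟩ := hsucc.exists_onto hl hωm
  have h1 := hsucc.1.not_onto hl hkm
  exact ConstructibleLevels.modelsZFMinus_of_reflection
    (ConstructibleLevels.isSuccLimit_of_not_onto hl hk hkm hml h1 h2) hωm
    fun c hc hcs => ConstructibleLevels.exists_elementary_level hl hk hkm hml h1 h2 hc hcs
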